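/- Let $\tau$ be a finite connected metric fatgraph: a graph (loops and multiple edges allowed) with vertex valences $m_v\ge 3$, a cyclic (counterclockwise) ordering of the half-edges at every vertex, and a length $L_e>0$ for every edge $e$. Number the half-edges at $v$ by $j=0,\dots,m_v-1$ compatibly with the cyclic order and put $c_{v,j}=e^{2\pi i j/m_v}$. Base surface. For every vertex $v$ let $U_v\subset\mathbb C$ (coordinate $w$) be the union of the stripes $0\le \mathrm{Re}\,z<L$ of the half-edges at $v$, placed by $w=c_{v,j}z^{2/m_v}$. For every boundary cycle $p$ let $V_p$ be the unit disc (coordinate $y$). Along an edge of length $L$ directed from $v$ to $v'$ glue $U_v$ to $U_{v'}$ on the open stripe $0<\mathrm{Re}\,z<L$ by $$w'=f_{v',v}(w)=c'\,(L-z)^{2/m_{v'}},\qquad z=(w/c)^{m_v/2},$$ where $c,c'$ are the roots of unity of its two half-edges. If the directed edges $1,\dots,n$ form the boundary cycle $p$, directed so that the puncture lies on the left, and $a_p=L_1+\dots+L_n$, glue $U_v$ to $V_p$, on the corner at $v$ between the $k$-th edge and the next half-edge counterclockwise, by $$y=\exp\Big(\tfrac{2\pi i}{a_p}(L_1+\dots+L_{k-1}+z)\Big).$$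 The result $F^c$ is a compact connected Riemann surface, the patches $U_v$ and $V_p$ are locally biholomorphic onto open subsets of $F^c$, no points are identified other than by these transition functions, and the patches $U_v$ cover exactly the punctured surface $F=F^c\setminus\{\text{centres of the discs }V_p\}$. Super Riemann surface. A split $N=1$ super Riemann surface (SRS) with base $F$ is given by coordinates $(w,\xi)$ with transition functions $w'=f(w)$, $\xi'=g(w)\xi$ (satisfying the cocycle condition) that preserve the odd subbundle generated by $D=\partial_\xi+\xi\partial_w$; a patch may overlap itself. A puncture $p$ is Neveu–Schwarz (NS) if near $p$ there are coordinates $(y,\theta)$, with $y(p)=0$, in which on the punctured neighbourhood this subbundle is generated by $\partial_\theta+\theta\partial_y$, and Ramond (R) if there are such coordinates in which it is generated by $\partial_\theta+y\theta\partial_y$. Let $\omega$ be an orientation of the edges of $\tau$. Two orientations are equivalent if they differ by finitely many reflections at vertices; a reflection at $v$ reverses an edge once for every end it has at $v$. A spin structure on $\tau$ is an equivalence class of orientations. For an edge directed from $v$ to $v'$ put $\mathrm{sign}(v',v)=+1$ if $\omega$ orients it from $v$ to $v'$ and $-1$ otherwise. Fix a square root $r_h$ of $c_h$ for every half-edge $h$;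 let $\sqrt{\partial_w f_{v',v}}$ be the branch that in the stripe coordinates $z$ and $z'=L-z$ is the root $+i$ of $\partial_z z'=-1$, where $\sqrt{dw/dz}=\sqrt{2/m_v}\;r_h\,z^{1/m_v-1/2}$ (principal power on $\mathrm{Re}\,z>0$) on the stripe of $h$, and likewise for $dw'/dz'$. For a boundary cycle $p$, directed with the puncture on the left, let $m_p(\omega)$ be the number of edges on $p$ that $\omega$ orients against the direction of $p$ (an edge passed twice is counted for each passage). Theorem. (1) For every choice of the roots $r_h$ and every $\omega$, the transition functions $$w'=f_{v',v}(w),\qquad \xi'=\mathrm{sign}(v',v)\sqrt{\partial_w f_{v',v}(w)}\;\xi$$ define a split $N=1$ SRS with base $F$. For fixed $r$, the SRS of two orientations are isomorphic over the identity of $F$ if and only if the orientations are equivalent; thus a spin structure on $\tau$ defines a split $N=1$ SRS. Every puncture is either Ramond or Neveu–Schwarz, not both, and for two orientations $\omega,\omega'$ the types of $p$ agree if and only if $m_p(\omega)\equiv m_p(\omega')\pmod 2$. (2) Suppose that the number of vertices of even valence is even (for instance, that $\tau$ is trivalent). Then the roots $r_h$ can be chosen, depending on $\tau$ only and not on $\omega$,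 such that for every $\omega$ and every puncture $p$: $p$ is Ramond if and only if $m_p(\omega)$ is even, and Neveu–Schwarz if and only if $m_p(\omega)$ is odd. If all valences are odd, then $r_h=c_h^{(m_v+1)/2}$, for $h$ a half-edge at $v$, is such a choice. -/

import Mathlib

open Complex
open scoped Manifold ContDiff Topology

/-! ### Superfunctions in one even and one odd variable, and superconformal transitions -/

/-- A superfunction `a(w) + b(w) ξ` (`ξ` odd, so `ξ² = 0`) is a function `ℂ → ℂ[ε]`, with `ε` in the
role of `ξ`.  This is the action of the odd vector field `D = ∂_ξ + h(w) ξ ∂_w`: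
`D (a + b ξ) = b + h a' ξ`.  For `h = 1` it is the standard superconformal vector field
`D_ξ = ∂_ξ + ξ ∂_w`, for `h(w) = w` the field `D*_ξ = ∂_ξ + w ξ ∂_w`, whose square vanishes
modulo itself along `w = 0`. -/
noncomputable def superD (h : ℂ → ℂ) (F : ℂ → DualNumber ℂ) (w : ℂ) : DualNumber ℂ :=
  TrivSqZeroExt.inl (F w).snd + TrivSqZeroExt.inr (h w * deriv (fun u => (F u).fst) w)

/-- The split change of coordinates `w' = f(w)`, `ξ' = g(w) ξ` carries, at the point `w`, the
subbundle generated by `D = ∂_ξ + h ξ ∂_w` to the one generated by `D' = ∂_ξ' + h' ξ' ∂_w'`: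
`D = (D ξ') D'`, that is `D w' = h'(w') ξ' (D ξ')`, and the factor `D ξ'` is invertible. -/
def PreservesD (h h' f g : ℂ → ℂ) (w : ℂ) : Prop :=
  superD h (fun u => TrivSqZeroExt.inl (f u)) w =
      TrivSqZeroExt.inl (h' (f w)) * TrivSqZeroExt.inr (g w) *
        superD h (fun u => TrivSqZeroExt.inr (g u)) w ∧
    IsUnit (superD h (fun u => TrivSqZeroExt.inr (g u)) w)

section SuperRiemannSurface

/-- A compact connected Riemann surface. -/
structure IsCompactRiemannSurface (X : Type*) [TopologicalSpace X] [ChartedSpace ℂ X] : Prop where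
  isManifold : IsManifold 𝓘(ℂ) ω X
  t2 : T2Space X
  compact : CompactSpace X
  connected : ConnectedSpace X

/-- `c : U → X` and `c' : U' → X` are (not necessarily injective) holomorphic coordinate patches,
with odd coordinates `ξ`, `ξ'` and odd subbundles generated by `∂_ξ + h ξ ∂_w`, `∂_ξ' + h' ξ' ∂_w'`.
The points of the overlap are the pairs `(w, w')` with `c w = c' w'`; near such a pair `w'` is a
holomorphic function `f` of `w`.  The function `k` on the overlap is a transition function
`ξ' = k ξ` of the odd coordinates: it is holomorphic, without zeros, and `(w, ξ) ↦ (f, k ξ)`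
preserves the odd subbundles. -/
def IsSuperTransition {X : Type*} (U : Set ℂ) (c : ℂ → X) (h : ℂ → ℂ)
    (U' : Set ℂ) (c' : ℂ → X) (h' : ℂ → ℂ) (k : ℂ → ℂ → ℂ) : Prop :=
  ∀ w ∈ U, ∀ w' ∈ U', c w = c' w' →
    ∃ f : ℂ → ℂ, AnalyticAt ℂ f w ∧ f w = w' ∧ (∀ᶠ u in 𝓝 w, c' (f u) = c u) ∧
      AnalyticAt ℂ (fun u => k u (f u)) w ∧ k w w' ≠ 0 ∧
      PreservesD h h' f (fun u => k u (f u)) w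

/-- A split `N = 1` super Riemann surface with base the punctured surface `X ∖ P`, given by an atlas
of superconformal coordinates `(w_i, ξ_i)`, `i : ι`.  `chart i : dom i → X ∖ P` is a locally
biholomorphic parametrization (it may fail to be injective, so a patch may overlap itself), and
`ξ_j = odd i j w_i w_j * ξ_i` at the points `(w_i, w_j)` of the overlap of the patches `i`, `j`. -/
structure SplitSRS (ι : Type*) (X : Type*) [TopologicalSpace X] [ChartedSpace ℂ X]
    (P : Set X) where
  dom : ι → Set ℂ
  isOpen_dom : ∀ i, IsOpen (dom i)
  chart : ι → ℂ → X
  holomorphic_chart : ∀ i, IsLocalDiffeomorphOn 𝓘(ℂ) 𝓘(ℂ) ω (chart i) (dom i)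
  cover : ⋃ i, chart i '' dom i = Pᶜ
  odd : ι → ι → ℂ → ℂ → ℂ
  superconformal : ∀ i j,
    IsSuperTransition (dom i) (chart i) (fun _ => 1) (dom j) (chart j) (fun _ => 1) (odd i j)
  cocycle : ∀ i j l, ∀ x ∈ dom i, ∀ y ∈ dom j, ∀ z ∈ dom l,
    chart i x = chart j y → chart j y = chart l z → odd i l x z = odd j l y z * odd i j x y

namespace SplitSRS

variable {ι κ X : Type*} [TopologicalSpace X] [ChartedSpace ℂ X] {P : Set X}

/-- There is an isomorphism of super Riemann surfaces from `S` to `T` which is the identity on the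
base `X ∖ P`; it is written `ξ_T = k ξ_S` in coordinates. -/
def IsIso (S : SplitSRS ι X P) (T : SplitSRS κ X P) : Prop :=
  ∃ k : ι → κ → ℂ → ℂ → ℂ,
    (∀ i l, IsSuperTransition (S.dom i) (S.chart i) (fun _ => 1)
      (T.dom l) (T.chart l) (fun _ => 1) (k i l)) ∧
    (∀ i j l, ∀ x ∈ S.dom i, ∀ y ∈ S.dom j, ∀ z ∈ T.dom l,
      S.chart i x = S.chart j y → S.chart j y = T.chart l z →
        k i l x z = k j l y z * S.odd i j x y) ∧
    (∀ i l n, ∀ x ∈ S.dom i, ∀ z ∈ T.dom l, ∀ t ∈ T.dom n,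
      S.chart i x = T.chart l z → T.chart l z = T.chart n t →
        k i n x t = T.odd l n z t * k i l x z)

/-- There are coordinates `(y, θ)` on a neighbourhood of `p`, with `y = 0` at `p`, which on the
punctured neighbourhood are coordinates of the super Riemann surface `S` in which its odd subbundle
is generated by `∂_θ + h(y) θ ∂_y`. -/
def HasModelAt (S : SplitSRS ι X P) (p : X) (h : ℂ → ℂ) : Prop :=
  ∃ (ρ : ℝ) (c : ℂ → X) (k : ι → ℂ → ℂ → ℂ), 0 < ρ ∧
    IsLocalDiffeomorphOn 𝓘(ℂ) 𝓘(ℂ) ω c (Metric.ball 0 ρ) ∧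
    Set.InjOn c (Metric.ball 0 ρ) ∧ c 0 = p ∧
    (∀ y ∈ Metric.ball (0 : ℂ) ρ, c y ∈ P → y = 0) ∧
    (∀ i, IsSuperTransition (S.dom i) (S.chart i) (fun _ => 1) (Metric.ball 0 ρ) c h (k i)) ∧
    (∀ i j, ∀ x ∈ S.dom i, ∀ x' ∈ S.dom j, ∀ y ∈ Metric.ball (0 : ℂ) ρ,
      S.chart i x = S.chart j x' → S.chart j x' = c y → k i x y = k j x' y * S.odd i j x x')

/-- `p` is a Neveu–Schwarz puncture: the superconformal structure extends over `p`, i.e. the odd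
subbundle is generated by `∂_θ + θ ∂_y` in suitable coordinates `(y, θ)` around `p`. -/
def IsNeveuSchwarz (S : SplitSRS ι X P) (p : X) : Prop :=
  p ∈ P ∧ S.HasModelAt p (fun _ => 1)

/-- `p` is a Ramond puncture: the odd subbundle is generated by `∂_θ + y θ ∂_y` in suitable
coordinates `(y, θ)` around `p`. -/
def IsRamond (S : SplitSRS ι X P) (p : X) : Prop :=
  p ∈ P ∧ S.HasModelAt p (fun y => y)

end SplitSRS

end SuperRiemannSurface

/-! ### Metric fatgraphs -/

/-- A connected fatgraph with vertex set `V`.  The half-edges at a vertex `v` are numbered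
`0, …, valence v - 1` counterclockwise (only the cyclic order matters, but the coordinate at the
vertex depends on the numbering by a rotation); a half-edge `⟨v, j⟩` is also regarded as an edge
with the direction pointing out of `v`.  `inv` joins the half-edges in pairs, the edges; in terms
of directed edges it reverses the direction.  Loops and multiple edges are allowed. -/
structure Fatgraph (V : Type*) where
  valence : V → ℕ
  three_le_valence : ∀ v, 3 ≤ valence v
  inv : (Σ v, Fin (valence v)) → Σ v, Fin (valence v)
  inv_inv : ∀ d, inv (inv d) = d
  inv_ne : ∀ d, inv d ≠ d
  nonempty : Nonempty V
  connected : ∀ v v' : V, Relation.ReflTransGen (fun a b => ∃ j, (inv ⟨a, j⟩).1 = b) v v'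

/-- A metric fatgraph: every edge has a positive length. -/
structure MetricFatgraph (V : Type*) extends Fatgraph V where
  len : (Σ v, Fin (valence v)) → ℝ
  len_pos : ∀ d, 0 < len d
  len_inv : ∀ d, len (inv d) = len d

namespace Fatgraph

variable {V : Type*} (τ : Fatgraph V)

/-- Half-edges, or directed edges. -/
abbrev Dart : Type _ := Σ v, Fin (τ.valence v)

/-- The next half-edge at the same vertex, counterclockwise. -/
def next : Equiv.Perm τ.Dart := Equiv.sigmaCongrRight fun v => finRotate (τ.valence v)

/-- Reversal of directed edges, as a permutation. -/
def invPerm : Equiv.Perm τ.Dart := ⟨τ.inv, τ.inv, τ.inv_inv, τ.inv_inv⟩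

/-- The next directed edge along the boundary on the left-hand side: go along `d` to its end and
turn left, so that the puncture stays on the left (the boundary is directed counterclockwise
around the puncture). -/
def bdryNext : Equiv.Perm τ.Dart := τ.invPerm.trans τ.next.symm

/-- Boundary cycles, equivalently punctures. -/
abbrev Puncture : Type _ := Quotient (Equiv.Perm.SameCycle.setoid τ.bdryNext)

/-- The boundary cycle on the left of a directed edge. -/
def bdry (d : τ.Dart) : τ.Puncture := Quotient.mk _ d

/-- An orientation of the edges: `pos d` says that the edge of `d` is oriented in the direction
of `d`. -/
@[ext] structure Orientation where
  pos : τ.Dart → Bool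
  pos_inv : ∀ d, pos (τ.inv d) = !pos d

variable {τ}

open Classical in
/-- Fatgraph reflection at `v`: the orientation of an edge is reversed once for every end of the
edge at `v` (so a loop at `v` is reversed twice, and keeps its orientation). -/
noncomputable def Orientation.reflect (o : τ.Orientation) (v : V) : τ.Orientation where
  pos d := xor (o.pos d) (xor (decide (d.1 = v)) (decide ((τ.inv d).1 = v)))
  pos_inv d := by
    rw [o.pos_inv, τ.inv_inv]
    cases o.pos d <;> cases decide (d.1 = v) <;> cases decide ((τ.inv d).1 = v) <;> rfl

/-- Two orientations define the same spin structure: they differ by finitely many fatgraph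
reflections. -/
def Orientation.Equivalent (o o' : τ.Orientation) : Prop :=
  Relation.ReflTransGen (fun a b => ∃ v, b = a.reflect v) o o'

/-- The sign attached to a directed edge from `v` to `v'`: `+1` if the edge is oriented from `v`
to `v'`, and `-1` otherwise. -/
def Orientation.sign (o : τ.Orientation) (d : τ.Dart) : ℂ := if o.pos d then 1 else -1

/-- The number of edges on the boundary cycle `p` which are oriented against the direction of
the cycle. -/
noncomputable def Orientation.numOpposite (o : τ.Orientation) (p : τ.Puncture) : ℕ :=
  Set.ncard {d : τ.Dart | τ.bdry d = p ∧ o.pos d = false}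

variable (τ)

/-- The root of unity `exp (2 π i j / m)`, the direction of the `j`-th half-edge in the coordinate
`w` at an `m`-valent vertex. -/
noncomputable def root (d : τ.Dart) : ℂ :=
  exp (2 * Real.pi * I * (d.2 : ℕ) / (τ.valence d.1 : ℂ))

/-- A choice of a square root of every `root d`. -/
def IsRootChoice (r : τ.Dart → ℂ) : Prop := ∀ d, r d ^ 2 = τ.root d

end Fatgraph

/-! ### The Riemann surface of a metric fatgraph -/

namespace MetricFatgraph

variable {V : Type*} (τ : MetricFatgraph V)

/-- The coordinate `z = (w / c) ^ (m / 2)` on the stripe of the directed edge `d`, as a function of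
the vertex coordinate `w`; so `w = c z ^ (2 / m)`. -/
noncomputable def stripeCoord (d : τ.Dart) (w : ℂ) : ℂ :=
  (w / τ.root d) ^ ((τ.valence d.1 : ℂ) / 2)

/-- The domain of the coordinate `w` at the vertex `v`: the union of the stripes
`0 ≤ Re z < L` of the half-edges at `v`, each of which fills a sector of angle `2 π / m`. -/
def star (v : V) : Set ℂ :=
  {w | ∀ j : Fin (τ.valence v), |arg (w / τ.root ⟨v, j⟩)| ≤ Real.pi / τ.valence v →
    (τ.stripeCoord ⟨v, j⟩ w).re < τ.len ⟨v, j⟩}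

/-- The open stripe `0 < Re z < L` of a directed edge in the coordinate `w` at its initial vertex.
This is the overlap of the patches at the two ends which corresponds to the edge. -/
def stripe (d : τ.Dart) : Set ℂ :=
  {w | w ≠ 0 ∧ |arg (w / τ.root d)| < Real.pi / τ.valence d.1 ∧ (τ.stripeCoord d w).re < τ.len d}

/-- The transition function `w' = c' (L - z) ^ (2 / m')` along a directed edge, where
`z = (w / c) ^ (m / 2)`. -/
noncomputable def transition (d : τ.Dart) (w : ℂ) : ℂ :=
  τ.root (τ.inv d) * ((τ.len d : ℂ) - τ.stripeCoord d w) ^ (2 / (τ.valence (τ.inv d).1 : ℂ))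

/-- The corner between `d` and the next half-edge at the same vertex. -/
def corner (d : τ.Dart) : Set ℂ :=
  {w | w ∈ τ.star d.1 ∧ 0 < arg (w / τ.root d) ∧
    arg (w / τ.root d) < 2 * Real.pi / τ.valence d.1}

/-- The perimeter `L_1 + ⋯ + L_n` of a boundary cycle. -/
noncomputable def perimeter (p : τ.Puncture) : ℝ :=
  ∑ᶠ d ∈ {d : τ.Dart | τ.bdry d = p}, τ.len d

/-- The length `L_1 + ⋯ + L_(k-1)` of the part of the boundary cycle of `d` before `d`, the cycle
being started at a chosen directed edge. -/
noncomputable def offset (d : τ.Dart) : ℝ :=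
  ∑ i ∈ Finset.range (sInf {k : ℕ | (τ.bdryNext ^ k) (τ.bdry d).out = d}),
    τ.len ((τ.bdryNext ^ i) (τ.bdry d).out)

/-- The transition function `y = exp (2 π i (L_1 + ⋯ + L_(k-1) + z) / a)` from the patch at a
vertex to the unit disc around a puncture, on a corner at the vertex. -/
noncomputable def cornerTransition (d : τ.Dart) (w : ℂ) : ℂ :=
  exp (2 * Real.pi * I / (τ.perimeter (τ.bdry d) : ℂ) * ((τ.offset d : ℂ) + τ.stripeCoord d w))

/-- The disjoint union of the patches: one for every vertex, and a unit disc for every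
puncture. -/
abbrev Patches : Type _ := (Σ v : V, τ.star v) ⊕ (Σ _ : τ.Puncture, Metric.ball (0 : ℂ) 1)

/-- The gluing of the patches. -/
inductive Glue : τ.Patches → τ.Patches → Prop
  | edge (d : τ.Dart) (w : ℂ) (hw : w ∈ τ.star d.1) (hd : w ∈ τ.stripe d)
      (hw' : τ.transition d w ∈ τ.star (τ.inv d).1) :
      Glue (.inl ⟨d.1, w, hw⟩) (.inl ⟨(τ.inv d).1, τ.transition d w, hw'⟩)
  | corner (d : τ.Dart) (w : ℂ) (hw : w ∈ τ.star d.1) (hd : w ∈ τ.corner d)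
      (hy : τ.cornerTransition d w ∈ Metric.ball (0 : ℂ) 1) :
      Glue (.inl ⟨d.1, w, hw⟩) (.inr ⟨τ.bdry d, τ.cornerTransition d w, hy⟩)

/-- The closed surface of a metric fatgraph, with the quotient topology. -/
def Surface : Type _ := Quot τ.Glue

instance : TopologicalSpace τ.Surface := inferInstanceAs (TopologicalSpace (Quot τ.Glue))

theorem zero_mem_star (v : V) : (0 : ℂ) ∈ τ.star v := by
  intro j _
  have h : (τ.valence v : ℂ) / 2 ≠ 0 := by
    have := τ.three_le_valence v
    simp only [ne_eq, div_eq_zero_iff, Nat.cast_eq_zero, OfNat.ofNat_ne_zero, or_false]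
    omega
  simpa [stripeCoord, Complex.zero_cpow h] using τ.len_pos ⟨v, j⟩

open Classical in
/-- The patch at a vertex, as a map from `star v` to the surface (with the value of the
origin outside `star v`). -/
noncomputable def vertexChart (v : V) (w : ℂ) : τ.Surface :=
  Quot.mk _ (.inl ⟨v, if hw : w ∈ τ.star v then ⟨w, hw⟩ else ⟨0, τ.zero_mem_star v⟩⟩)

open Classical in
/-- The patch at a puncture, as a map from the unit disc to the surface (with the value of
the origin outside the unit disc). -/
noncomputable def punctureChart (p : τ.Puncture) (y : ℂ) : τ.Surface :=
  Quot.mk _ (.inr ⟨p, if hy : y ∈ Metric.ball (0 : ℂ) 1 then ⟨y, hy⟩ else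
    ⟨0, Metric.mem_ball_self one_pos⟩⟩)

/-- The set of punctures on the closed surface. -/
def punctures : Set τ.Surface := Set.range fun p => τ.punctureChart p 0

/-! ### The square roots of the derivatives of the transition functions -/

/-- A branch of the square root of `dw / dz = c (2 / m) z ^ (2 / m - 1)` on the stripe of `d`, given
a square root `r d` of `c`; the power of `z` is the principal one on `Re z > 0`. -/
noncomputable def sqrtStripe (r : τ.Dart → ℂ) (d : τ.Dart) (z : ℂ) : ℂ :=
  (Real.sqrt (2 / τ.valence d.1) : ℂ) * r d *
    z ^ (1 / (τ.valence d.1 : ℂ) - 1 / 2)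

/-- The branch of the square root of `∂_w (transition d)` which in the coordinates `z` and
`z' = L - z` on the stripe is the square root `+i` of `∂_z z' = -1`. -/
noncomputable def sqrtTransition (r : τ.Dart → ℂ) (d : τ.Dart) (w : ℂ) : ℂ :=
  I * τ.sqrtStripe r (τ.inv d) ((τ.len d : ℂ) - τ.stripeCoord d w) /
    τ.sqrtStripe r d (τ.stripeCoord d w)

/-- `S` is the split super Riemann surface of the metric fatgraph with edge orientation `o`: its
patches are those at the vertices, and along the edge of `d`, from `v` to `v'`, the transition
functions are `w' = f(w)`, `ξ' = sign * √(∂_w f) * ξ`. -/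
def Presents [ChartedSpace ℂ τ.Surface] (r : τ.Dart → ℂ) (o : τ.Orientation)
    (S : SplitSRS V τ.Surface τ.punctures) : Prop :=
  S.dom = τ.star ∧ S.chart = τ.vertexChart ∧
    ∀ d, ∀ w ∈ τ.stripe d,
      S.odd d.1 (τ.inv d).1 w (τ.transition d w) = o.sign d * τ.sqrtTransition r d w

end MetricFatgraph

section Gluing

variable {ι X : Type*} [TopologicalSpace X]

/-- Parametrizations `chart i : dom i → X` by plane domains which are glued along holomorphic
transition functions: `X` carries the final topology. -/
structure IsHolomorphicGluing (dom : ι → Set ℂ) (chart : ι → ℂ → X) : Prop where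
  isOpen_dom : ∀ i, IsOpen (dom i)
  isOpen_iff : ∀ s : Set X, IsOpen s ↔ ∀ i, IsOpen (dom i ∩ chart i ⁻¹' s)
  cover : ∀ x, ∃ i, ∃ u ∈ dom i, chart i u = x
  transition : ∀ i j, ∀ x ∈ dom i, ∀ y ∈ dom j, chart i x = chart j y →
    ∃ f : ℂ → ℂ, AnalyticAt ℂ f x ∧ f x = y ∧ ∀ᶠ u in 𝓝 x, chart j (f u) = chart i u
  injective : ∀ i, ∀ x ∈ dom i, ∀ᶠ q in 𝓝 (x, x), chart i q.1 = chart i q.2 → q.1 = q.2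

namespace IsHolomorphicGluing

variable {dom : ι → Set ℂ} {chart : ι → ℂ → X} (H : IsHolomorphicGluing dom chart)
include H

theorem continuousOn (i : ι) : ContinuousOn (chart i) (dom i) := by
  rw [continuousOn_open_iff (H.isOpen_dom i)]
  exact fun s hs => (H.isOpen_iff s).1 hs i

theorem isOpen_image (i : ι) {s : Set ℂ} (hs : IsOpen s) (hsub : s ⊆ dom i) :
    IsOpen (chart i '' s) := by
  rw [H.isOpen_iff]
  intro j
  rw [isOpen_iff_mem_nhds]
  rintro y ⟨hy, x, hx, hxy⟩
  obtain ⟨f, hf, hfx, hfe⟩ := H.transition j i y hy x (hsub hx) hxy.symm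
  have h1 : ∀ᶠ u in 𝓝 y, f u ∈ s :=
    hf.continuousAt.eventually_mem (by rw [hfx]; exact hs.mem_nhds hx)
  filter_upwards [h1, hfe, (H.isOpen_dom j).mem_nhds hy] with u hu1 hu2 hu3
  exact ⟨hu3, f u, hu1, hu2⟩

theorem exists_injOn (i : ι) {x : ℂ} (hx : x ∈ dom i) :
    ∃ s : Set ℂ, IsOpen s ∧ s ⊆ dom i ∧ x ∈ s ∧ Set.InjOn (chart i) s := by
  obtain ⟨a, b, ha, hxa, hb, hxb, hab⟩ := mem_nhds_prod_iff'.1 (H.injective i x hx)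
  refine ⟨a ∩ b ∩ dom i, (ha.inter hb).inter (H.isOpen_dom i), Set.inter_subset_right,
    ⟨⟨hxa, hxb⟩, hx⟩, fun u hu t ht h => hab (Set.mk_mem_prod hu.1.1 ht.1.2) h⟩

theorem exists_openPartialHomeomorph (i : ι) {x : ℂ} (hx : x ∈ dom i) :
    ∃ e : OpenPartialHomeomorph ℂ X, x ∈ e.source ∧ e.source ⊆ dom i ∧ ⇑e = chart i := by
  obtain ⟨s, hs, hsd, hxs, hinj⟩ := H.exists_injOn i hx
  let e : PartialEquiv ℂ X := hinj.toPartialEquiv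
  have he : e.source = s := rfl
  refine ⟨OpenPartialHomeomorph.ofContinuousOpenRestrict e ((H.continuousOn i).mono hsd) ?_ hs,
    hxs, hsd, rfl⟩
  intro t ht
  obtain ⟨t', ht', rfl⟩ := isOpen_induced_iff.1 ht
  have := H.isOpen_image i (ht'.inter hs) (Set.inter_subset_right.trans hsd)
  convert this using 1
  ext y
  constructor
  · rintro ⟨⟨u, hu⟩, hu', rfl⟩
    exact ⟨u, ⟨hu', hu⟩, rfl⟩
  · rintro ⟨u, ⟨hu', hu⟩, rfl⟩
    exact ⟨⟨u, hu⟩, hu', rfl⟩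

theorem analyticAt_transition {i j : ι} {e e' : OpenPartialHomeomorph ℂ X}
    (hes : e.source ⊆ dom i) (he : ⇑e = chart i) (hes' : e'.source ⊆ dom j) (he' : ⇑e' = chart j)
    {u : ℂ} (hu : u ∈ (e ≫ₕ e'.symm).source) : AnalyticAt ℂ (e ≫ₕ e'.symm) u := by
  have hu1 : u ∈ e.source := hu.1
  have hu2 : e u ∈ e'.target := hu.2
  have hy := e'.map_target hu2
  obtain ⟨f, hf, hfx, hfe⟩ := H.transition i j u (hes hu1) (e'.symm (e u)) (hes' hy)
    (by rw [← he, ← he', e'.right_inv hu2])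
  refine hf.congr ?_
  have h1 : ∀ᶠ u' in 𝓝 u, f u' ∈ e'.source :=
    hf.continuousAt.eventually_mem (by rw [hfx]; exact e'.open_source.mem_nhds hy)
  filter_upwards [h1, hfe] with u' h1 h2
  rw [← he, ← he'] at h2
  simp [← h2, e'.left_inv h1]

theorem exists_chartedSpace : ∃ _ : ChartedSpace ℂ X, IsManifold 𝓘(ℂ) ω X ∧
    ∀ i, IsLocalDiffeomorphOn 𝓘(ℂ) 𝓘(ℂ) ω (chart i) (dom i) := by
  have key : ∀ x, ∃ (i : ι) (e : OpenPartialHomeomorph ℂ X),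
      x ∈ e.target ∧ e.source ⊆ dom i ∧ ⇑e = chart i := by
    intro x
    obtain ⟨i, u, hu, rfl⟩ := H.cover x
    obtain ⟨e, h1, h2, h3⟩ := H.exists_openPartialHomeomorph i hu
    exact ⟨i, e, h3 ▸ e.map_source h1, h2, h3⟩
  choose i e het hes he using key
  let C : ChartedSpace ℂ X :=
    { atlas := Set.range fun x => (e x).symm
      chartAt := fun x => (e x).symm
      mem_chart_source := het
      chart_mem_atlas := fun x => ⟨x, rfl⟩ }
  have hM : IsManifold 𝓘(ℂ) ω X := by
    refine isManifold_of_contDiffOn _ _ _ ?_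
    rintro _ _ ⟨x, rfl⟩ ⟨y, rfl⟩ u hu
    refine ContDiffAt.contDiffWithinAt ?_
    simp only [modelWithCornersSelf_coe, modelWithCornersSelf_coe_symm, Function.id_comp,
      Function.comp_id, OpenPartialHomeomorph.symm_symm] at hu ⊢
    exact (H.analyticAt_transition (hes x) (he x) (hes y) (he y) hu.1).contDiffAt
  refine ⟨C, hM, fun j w => ?_⟩
  obtain ⟨w, hw⟩ := w
  obtain ⟨f, hwf, hfd, hf⟩ := H.exists_openPartialHomeomorph j hw
  refine ⟨⟨f.toPartialEquiv, f.open_source, f.open_target, ?_, ?_⟩, hwf, fun u _ => congrFun hf.symm u⟩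
  · intro u hu
    refine ContMDiffAt.contMDiffWithinAt ?_
    rw [contMDiffAt_iff]
    refine ⟨f.continuousAt hu, ContDiffAt.contDiffWithinAt ?_⟩
    have : u ∈ (f ≫ₕ (e (f u)).symm).source := ⟨hu, het _⟩
    exact (H.analyticAt_transition hfd hf (hes _) (he _) this).contDiffAt
  · intro x hx
    refine ContMDiffAt.contMDiffWithinAt ?_
    rw [contMDiffAt_iff]
    refine ⟨f.symm.continuousAt hx, ContDiffAt.contDiffWithinAt ?_⟩
    have : (e x).symm x ∈ (e x ≫ₕ f.symm).source :=
      ⟨(e x).map_target (het x), by simpa [(e x).right_inv (het x)] using hx⟩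
    exact (H.analyticAt_transition (hes _) (he _) hfd hf this).contDiffAt

theorem t2Space (hsep : ∀ i j, ∀ x ∈ dom i, ∀ y ∈ dom j, chart i x ≠ chart j y →
    ∀ᶠ q in 𝓝 (x, y), chart i q.1 ≠ chart j q.2) : T2Space X := by
  refine ⟨fun a b hab => ?_⟩
  obtain ⟨i, x, hx, rfl⟩ := H.cover a
  obtain ⟨j, y, hy, rfl⟩ := H.cover b
  obtain ⟨s, t, hs, hxs, ht, hyt, hst⟩ := mem_nhds_prod_iff'.1 (hsep i j x hx y hy hab)
  refine ⟨_, _, H.isOpen_image i (hs.inter (H.isOpen_dom i)) Set.inter_subset_right,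
    H.isOpen_image j (ht.inter (H.isOpen_dom j)) Set.inter_subset_right,
    ⟨x, ⟨hxs, hx⟩, rfl⟩, ⟨y, ⟨hyt, hy⟩, rfl⟩, ?_⟩
  rw [Set.disjoint_left]
  rintro _ ⟨u, ⟨hu, -⟩, rfl⟩ ⟨v, ⟨hv, -⟩, huv⟩
  exact hst (Set.mk_mem_prod hu hv) huv.symm

end IsHolomorphicGluing

end Gluing

section LocalDiffeomorph

variable {X : Type*} [TopologicalSpace X] [ChartedSpace ℂ X]

theorem IsLocalDiffeomorphOn.exists_injOn {c : ℂ → X} {U : Set ℂ}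
    (hc : IsLocalDiffeomorphOn 𝓘(ℂ) 𝓘(ℂ) ω c U) {x : ℂ} (hx : x ∈ U) :
    ∃ s ∈ 𝓝 x, Set.InjOn c s := by
  obtain ⟨Φ, hΦ, he⟩ := hc ⟨x, hx⟩
  exact ⟨Φ.source, Φ.open_source.mem_nhds hΦ, Φ.injOn.congr he.symm⟩

/-- Two holomorphic parametrizations of a Riemann surface differ by a holomorphic coordinate
change. -/
theorem IsLocalDiffeomorphOn.exists_transition {c c' : ℂ → X} {U U' : Set ℂ}
    (hc : IsLocalDiffeomorphOn 𝓘(ℂ) 𝓘(ℂ) ω c U) (hc' : IsLocalDiffeomorphOn 𝓘(ℂ) 𝓘(ℂ) ω c' U')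
    {x y : ℂ} (hx : x ∈ U) (hy : y ∈ U') (hxy : c x = c' y) :
    ∃ f : ℂ → ℂ, AnalyticAt ℂ f x ∧ f x = y ∧ (∀ᶠ u in 𝓝 x, c' (f u) = c u) ∧
      deriv f x ≠ 0 := by
  have key : ∀ {c c' : ℂ → X} {U U' : Set ℂ}
    (_ : IsLocalDiffeomorphOn 𝓘(ℂ) 𝓘(ℂ) ω c U) (_ : IsLocalDiffeomorphOn 𝓘(ℂ) 𝓘(ℂ) ω c' U')
    {x y : ℂ} (_ : x ∈ U) (_ : y ∈ U') (_ : c x = c' y),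
    ∃ f : ℂ → ℂ, AnalyticAt ℂ f x ∧ f x = y ∧ (∀ᶠ u in 𝓝 x, c' (f u) = c u) := by
    intro c c' U U' hc hc' x y hx hy hxy
    obtain ⟨Φ, hΦ, he⟩ := hc ⟨x, hx⟩
    obtain ⟨Ψ, hΨ, he'⟩ := hc' ⟨y, hy⟩
    have h1 : Φ x = Ψ y := by rw [← he hΦ, ← he' hΨ, hxy]
    have hm : Φ x ∈ Ψ.target := h1 ▸ Ψ.map_source hΨ
    have hn : ∀ᶠ u in 𝓝 x, Φ u ∈ Ψ.target :=
      (Φ.contMDiffOn_toFun.continuousOn.continuousAt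
        (Φ.open_source.mem_nhds hΦ)).eventually_mem (Ψ.open_target.mem_nhds hm)
    refine ⟨fun u => Ψ.symm (Φ u), ?_, ?_, ?_⟩
    · have a1 : ContMDiffAt 𝓘(ℂ) 𝓘(ℂ) ω Φ x :=
        Φ.contMDiffOn_toFun.contMDiffAt (Φ.open_source.mem_nhds hΦ)
      have a2 : ContMDiffAt 𝓘(ℂ) 𝓘(ℂ) ω Ψ.symm (Φ x) :=
        Ψ.contMDiffOn_invFun.contMDiffAt (Ψ.open_target.mem_nhds hm)
      have a3 := (a2.comp x a1).contDiffAt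
      exact a3.analyticAt
    · change Ψ.symm (Φ x) = y
      rw [h1]; exact Ψ.left_inv hΨ
    · filter_upwards [hn, Φ.open_source.mem_nhds hΦ] with u hu hu'
      rw [he hu']
      exact (he' (Ψ.map_target hu)).trans (Ψ.right_inv hu)
  obtain ⟨f, hf, hfx, hfe⟩ := key hc hc' hx hy hxy
  obtain ⟨g, hg, hgy, hge⟩ := key hc' hc hy hx hxy.symm
  refine ⟨f, hf, hfx, hfe, fun h0 => ?_⟩
  obtain ⟨s, hs, hinj⟩ := hc.exists_injOn hx
  have hgf : (fun u => g (f u)) =ᶠ[𝓝 x] id := by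
    have c1 : ContinuousAt (fun u => g (f u)) x :=
      ContinuousAt.comp (by rw [hfx]; exact hg.continuousAt) hf.continuousAt
    have e1 : ∀ᶠ u in 𝓝 x, g (f u) ∈ s := c1.eventually_mem (by simpa [hfx, hgy] using hs)
    have e2 : ∀ᶠ u in 𝓝 x, c (g (f u)) = c' (f u) :=
      hf.continuousAt.eventually (by rw [hfx]; exact hge)
    filter_upwards [e1, e2, hfe, hs] with u h1 h2 h3 h4
    exact hinj h1 h4 (h2.trans h3)
  have h1 := hgf.deriv_eq
  rw [deriv_id, ← Function.comp_def, deriv_comp x (by rw [hfx]; exact hg.differentiableAt)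
    hf.differentiableAt, h0, mul_zero] at h1
  exact zero_ne_one h1

end LocalDiffeomorph

namespace Fatgraph

variable {V : Type*} (τ : Fatgraph V)

theorem bdryNext_apply (d : τ.Dart) : τ.bdryNext d = τ.next.symm (τ.inv d) := rfl

theorem next_bdryNext (d : τ.Dart) : τ.next (τ.bdryNext d) = τ.inv d := by
  simp [bdryNext_apply]

theorem bdry_bdryNext (d : τ.Dart) : τ.bdry (τ.bdryNext d) = τ.bdry d :=
  Quotient.sound (s := Equiv.Perm.SameCycle.setoid τ.bdryNext)
    (Equiv.Perm.sameCycle_apply_left.2 (Equiv.Perm.SameCycle.refl _ _))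

theorem bdry_pow (d : τ.Dart) (i : ℕ) : τ.bdry ((τ.bdryNext ^ i) d) = τ.bdry d :=
  Quotient.sound (s := Equiv.Perm.SameCycle.setoid τ.bdryNext)
    (Equiv.Perm.sameCycle_pow_left.2 (Equiv.Perm.SameCycle.refl _ _))

theorem bdry_out (p : τ.Puncture) : τ.bdry p.out = p := Quotient.out_eq p

/-- The number of directed edges of a boundary cycle. -/
noncomputable def cycleLength (p : τ.Puncture) : ℕ := Function.minimalPeriod τ.bdryNext p.out

/-- The position of a directed edge on its boundary cycle. -/
noncomputable def cycleIndex (d : τ.Dart) : ℕ :=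
  sInf {k : ℕ | (τ.bdryNext ^ k) (τ.bdry d).out = d}

theorem pow_cycleLength (p : τ.Puncture) : (τ.bdryNext ^ τ.cycleLength p) p.out = p.out := by
  rw [Equiv.Perm.coe_pow]
  exact Function.isPeriodicPt_minimalPeriod τ.bdryNext p.out

theorem pow_out_injOn (p : τ.Puncture) :
    Set.InjOn (fun i : ℕ => (τ.bdryNext ^ i) p.out) (Set.Iio (τ.cycleLength p)) := by
  intro i hi j hj h
  simp only [Equiv.Perm.coe_pow] at h
  exact (Function.iterate_injOn_Iio_minimalPeriod (f := τ.bdryNext) (x := p.out)) hi hj h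

/-- The total product over a boundary cycle does not change under a shift of the cycle. -/
theorem finprod_bdry_bdryNext {M : Type*} [CommMonoid M] (f : τ.Dart → M) (p : τ.Puncture) :
    ∏ᶠ d ∈ {d : τ.Dart | τ.bdry d = p}, f (τ.bdryNext d) =
      ∏ᶠ d ∈ {d : τ.Dart | τ.bdry d = p}, f d := by
  refine finprod_mem_eq_of_bijOn τ.bdryNext ⟨?_, τ.bdryNext.injective.injOn, ?_⟩ fun _ _ => rfl
  · intro d hd
    simpa [bdry_bdryNext] using hd
  · intro d hd
    refine ⟨τ.bdryNext.symm d, ?_, by simp⟩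
    have := τ.bdry_bdryNext (τ.bdryNext.symm d)
    rw [Equiv.apply_symm_apply] at this
    rw [Set.mem_ofPred_eq, ← this]
    exact hd

variable [Finite V]

instance : Finite τ.Dart := inferInstanceAs (Finite (Σ v, Fin (τ.valence v)))

instance : Finite τ.Puncture := Quotient.finite _

theorem exists_pow_out (d : τ.Dart) : ∃ k : ℕ, (τ.bdryNext ^ k) (τ.bdry d).out = d := by
  have h : τ.bdryNext.SameCycle (τ.bdry d).out d :=
    Quotient.exact (s := Equiv.Perm.SameCycle.setoid τ.bdryNext) (τ.bdry_out (τ.bdry d))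
  obtain ⟨i, -, hi⟩ := h.exists_pow_eq'
  exact ⟨i, hi⟩

theorem pow_cycleIndex (d : τ.Dart) : (τ.bdryNext ^ τ.cycleIndex d) (τ.bdry d).out = d :=
  Nat.sInf_mem (s := {k : ℕ | (τ.bdryNext ^ k) (τ.bdry d).out = d}) (τ.exists_pow_out d)

theorem cycleLength_pos (p : τ.Puncture) : 0 < τ.cycleLength p := by
  refine Function.minimalPeriod_pos_of_mem_periodicPts ?_
  exact (Function.Injective.mem_periodicPts τ.bdryNext.injective _)

theorem cycleIndex_lt (d : τ.Dart) : τ.cycleIndex d < τ.cycleLength (τ.bdry d) := by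
  by_contra h
  rw [not_lt] at h
  have h1 := τ.pow_cycleIndex d
  obtain ⟨k, hk⟩ := Nat.exists_eq_add_of_le' h
  rw [hk, pow_add, Equiv.Perm.mul_apply, τ.pow_cycleLength] at h1
  have h2 : τ.cycleIndex d ≤ k := Nat.sInf_le h1
  have := τ.cycleLength_pos (τ.bdry d)
  omega

theorem cycleIndex_pow (p : τ.Puncture) {i : ℕ} (hi : i < τ.cycleLength p) :
    τ.cycleIndex ((τ.bdryNext ^ i) p.out) = i := by
  have hb : τ.bdry ((τ.bdryNext ^ i) p.out) = p := by rw [bdry_pow, bdry_out]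
  have h1 := τ.pow_cycleIndex ((τ.bdryNext ^ i) p.out)
  have h2 := τ.cycleIndex_lt ((τ.bdryNext ^ i) p.out)
  rw [hb] at h1 h2
  exact τ.pow_out_injOn p h2 hi h1

theorem cycleIndex_bdryNext (d : τ.Dart) (h : τ.bdryNext d ≠ (τ.bdry d).out) :
    τ.cycleIndex (τ.bdryNext d) = τ.cycleIndex d + 1 := by
  have h1 : (τ.bdryNext ^ (τ.cycleIndex d + 1)) (τ.bdry d).out = τ.bdryNext d := by
    rw [pow_succ', Equiv.Perm.mul_apply, pow_cycleIndex]
  have h2 := τ.cycleIndex_lt d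
  have h3 : τ.cycleIndex d + 1 ≠ τ.cycleLength (τ.bdry d) := by
    intro h3
    rw [h3, τ.pow_cycleLength] at h1
    exact h h1.symm
  rw [← h1, cycleIndex_pow]
  omega

theorem cycleIndex_add_one (d : τ.Dart) (h : τ.bdryNext d = (τ.bdry d).out) :
    τ.cycleIndex d + 1 = τ.cycleLength (τ.bdry d) := by
  have h1 : (τ.bdryNext ^ (τ.cycleIndex d + 1)) (τ.bdry d).out = (τ.bdry d).out := by
    rw [pow_succ', Equiv.Perm.mul_apply, pow_cycleIndex, h]
  have h2 := τ.cycleIndex_lt d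
  by_contra h3
  have h4 := τ.pow_out_injOn (τ.bdry d) (x₁ := τ.cycleIndex d + 1) (x₂ := 0)
    (by simp only [Set.mem_Iio]; omega) (τ.cycleLength_pos _) (by simpa only [pow_zero, Equiv.Perm.one_apply] using h1)
  omega

theorem cycleIndex_out (d : τ.Dart) (h : d = (τ.bdry d).out) : τ.cycleIndex d = 0 := by
  have := τ.cycleIndex_pow (τ.bdry d) (i := 0) (τ.cycleLength_pos _)
  rwa [pow_zero, Equiv.Perm.one_apply, ← h] at this

theorem image_pow_out (p : τ.Puncture) :
    (fun i : ℕ => (τ.bdryNext ^ i) p.out) '' Set.Iio (τ.cycleLength p) =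
      {d : τ.Dart | τ.bdry d = p} := by
  ext d
  constructor
  · rintro ⟨i, -, rfl⟩
    simp [bdry_pow, bdry_out]
  · rintro rfl
    exact ⟨_, τ.cycleIndex_lt d, τ.pow_cycleIndex d⟩

variable {M : Type*} [CommMonoid M]

/-- The product of the values of `f` on the part of the boundary cycle of `d` before `d`. -/
@[to_additive /-- The sum of the values of `f` on the part of the boundary cycle of `d`
before `d`. -/]
noncomputable def initialProd (f : τ.Dart → M) (d : τ.Dart) : M :=
  ∏ i ∈ Finset.range (τ.cycleIndex d), f ((τ.bdryNext ^ i) (τ.bdry d).out)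

@[to_additive]
theorem finprod_bdry (f : τ.Dart → M) (p : τ.Puncture) :
    ∏ᶠ d ∈ {d : τ.Dart | τ.bdry d = p}, f d =
      ∏ i ∈ Finset.range (τ.cycleLength p), f ((τ.bdryNext ^ i) p.out) := by
  rw [← image_pow_out, finprod_mem_image (τ.pow_out_injOn p), ← Finset.coe_range,
    finprod_mem_coe_finset]

@[to_additive]
theorem initialProd_bdryNext (f : τ.Dart → M) (d : τ.Dart) (h : τ.bdryNext d ≠ (τ.bdry d).out) :
    τ.initialProd f (τ.bdryNext d) = τ.initialProd f d * f d := by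
  rw [initialProd, τ.cycleIndex_bdryNext d h, bdry_bdryNext, Finset.prod_range_succ,
    pow_cycleIndex, initialProd]

@[to_additive]
theorem initialProd_mul (f : τ.Dart → M) (d : τ.Dart) (h : τ.bdryNext d = (τ.bdry d).out) :
    τ.initialProd f d * f d = ∏ᶠ e ∈ {e : τ.Dart | τ.bdry e = τ.bdry d}, f e := by
  rw [finprod_bdry, ← τ.cycleIndex_add_one d h, Finset.prod_range_succ, pow_cycleIndex,
    initialProd]

@[to_additive]
theorem initialProd_out (f : τ.Dart → M) (d : τ.Dart) (h : d = (τ.bdry d).out) :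
    τ.initialProd f d = 1 := by
  rw [initialProd, τ.cycleIndex_out d h, Finset.prod_range_zero]

end Fatgraph

namespace MetricFatgraph

variable {V : Type*} (τ : MetricFatgraph V)

theorem offset_eq (d : τ.Dart) : τ.offset d = τ.initialSum τ.len d := rfl

theorem offset_nonneg (d : τ.Dart) : 0 ≤ τ.offset d :=
  Finset.sum_nonneg fun _ _ => (τ.len_pos _).le

variable [Finite V]

theorem offset_add_len_le {d e : τ.Dart} (hb : τ.bdry d = τ.bdry e)
    (h : τ.cycleIndex d < τ.cycleIndex e) : τ.offset d + τ.len d ≤ τ.offset e := by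
  have h1 : τ.offset d + τ.len d = ∑ i ∈ Finset.range (τ.cycleIndex d + 1),
      τ.len ((τ.bdryNext ^ i) (τ.bdry e).out) := by
    rw [Finset.sum_range_succ, ← hb, τ.pow_cycleIndex]
    rfl
  rw [h1]
  exact Finset.sum_le_sum_of_subset_of_nonneg (Finset.range_mono h) fun _ _ _ => (τ.len_pos _).le

theorem perimeter_eq (p : τ.Puncture) : τ.perimeter p =
    ∑ i ∈ Finset.range (τ.cycleLength p), τ.len ((τ.bdryNext ^ i) p.out) :=
  τ.finsum_bdry _ p

theorem offset_add_len_le_perimeter (d : τ.Dart) :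
    τ.offset d + τ.len d ≤ τ.perimeter (τ.bdry d) := by
  have h1 : τ.offset d + τ.len d = ∑ i ∈ Finset.range (τ.cycleIndex d + 1),
      τ.len ((τ.bdryNext ^ i) (τ.bdry d).out) := by
    rw [Finset.sum_range_succ, τ.pow_cycleIndex]
    rfl
  rw [h1, perimeter_eq]
  exact Finset.sum_le_sum_of_subset_of_nonneg (Finset.range_mono (τ.cycleIndex_lt d))
    fun _ _ _ => (τ.len_pos _).le

theorem perimeter_pos (p : τ.Puncture) : 0 < τ.perimeter p := by
  have h := τ.offset_add_len_le_perimeter p.out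
  rw [τ.bdry_out] at h
  linarith [τ.len_pos p.out, τ.offset_nonneg p.out]

theorem exists_offset_le (p : τ.Puncture) (x : ℝ) : ∃ (d : τ.Dart) (k : ℤ), τ.bdry d = p ∧
    τ.offset d ≤ x + k * τ.perimeter p ∧ x + k * τ.perimeter p < τ.offset d + τ.len d := by
  have ha := τ.perimeter_pos p
  set t := toIcoMod ha 0 x with ht
  have ht0 : t ∈ Set.Ico 0 (0 + τ.perimeter p) := toIcoMod_mem_Ico ha 0 x
  rw [zero_add] at ht0
  let A : ℕ → ℝ := fun i => ∑ j ∈ Finset.range i, τ.len ((τ.bdryNext ^ j) p.out)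
  have hA : ∃ i, t < A i := ⟨τ.cycleLength p, ht0.2.trans_eq (τ.perimeter_eq p)⟩
  classical
  obtain ⟨n, hn, hmin⟩ : ∃ n, t < A n ∧ ∀ m < n, ¬ t < A m :=
    ⟨Nat.find hA, Nat.find_spec hA, fun m hm => Nat.find_min hA hm⟩
  have hn0 : n ≠ 0 := by
    rintro rfl
    simp only [A, Finset.range_zero, Finset.sum_empty] at hn
    linarith [ht0.1]
  obtain ⟨i, rfl⟩ := Nat.exists_eq_succ_of_ne_zero hn0
  have hi : i < τ.cycleLength p := by
    by_contra hi
    exact hmin (τ.cycleLength p) (by omega) (ht0.2.trans_eq (τ.perimeter_eq p))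
  have hb : τ.bdry ((τ.bdryNext ^ i) p.out) = p := by rw [τ.bdry_pow, τ.bdry_out]
  have hoff : τ.offset ((τ.bdryNext ^ i) p.out) = A i := by
    rw [offset_eq, Fatgraph.initialSum, τ.cycleIndex_pow p hi, hb]
  refine ⟨(τ.bdryNext ^ i) p.out, -toIcoDiv ha 0 x, hb, ?_⟩
  have hx : x + ((-toIcoDiv ha 0 x : ℤ) : ℝ) * τ.perimeter p = t := by
    rw [ht, toIcoMod]; push_cast; rw [zsmul_eq_mul]; ring
  rw [hx, hoff]
  refine ⟨not_lt.1 (hmin i (Nat.lt_succ_self i)), ?_⟩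
  have : A (i + 1) = A i + τ.len ((τ.bdryNext ^ i) p.out) := Finset.sum_range_succ _ _
  rw [← this]
  exact hn

theorem eq_of_offset_le {d e : τ.Dart} (hb : τ.bdry d = τ.bdry e) {x y : ℝ} {k : ℤ}
    (hxy : y = x + k * τ.perimeter (τ.bdry d))
    (h1 : τ.offset d ≤ x) (h2 : x < τ.offset d + τ.len d)
    (h3 : τ.offset e ≤ y) (h4 : y < τ.offset e + τ.len e) : d = e ∧ x = y := by
  have ha := τ.perimeter_pos (τ.bdry d)
  have hd := τ.offset_add_len_le_perimeter d
  have he := τ.offset_add_len_le_perimeter e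
  rw [← hb] at he
  have hd0 := τ.offset_nonneg d
  have he0 := τ.offset_nonneg e
  have hk : k = 0 := by
    have u1 : (k : ℝ) < 1 := by
      by_contra hc
      rw [not_lt] at hc
      nlinarith
    have u2 : (-1 : ℝ) < k := by
      by_contra hc
      rw [not_lt] at hc
      nlinarith
    have u1' : k < 1 := by exact_mod_cast u1
    have u2' : -1 < k := by exact_mod_cast u2
    omega
  subst hk
  simp only [Int.cast_zero, zero_mul, add_zero] at hxy
  subst hxy
  refine ⟨?_, rfl⟩
  rcases lt_trichotomy (τ.cycleIndex d) (τ.cycleIndex e) with h | h | h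
  · linarith [τ.offset_add_len_le hb h]
  · rw [← τ.pow_cycleIndex d, ← τ.pow_cycleIndex e, h, hb]
  · linarith [τ.offset_add_len_le hb.symm h]

end MetricFatgraph

namespace Fatgraph

variable {V : Type*} (τ : Fatgraph V)

theorem valence_pos (v : V) : (0 : ℝ) < τ.valence v := by
  have := τ.three_le_valence v
  exact_mod_cast (by omega : 0 < τ.valence v)

theorem valence_ne_zero (v : V) : (τ.valence v : ℂ) ≠ 0 := by
  have := (τ.valence_pos v).ne'
  exact_mod_cast this

theorem root_ne_zero (d : τ.Dart) : τ.root d ≠ 0 := exp_ne_zero _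

theorem root_eq_exp (d : τ.Dart) :
    τ.root d = exp (((2 * Real.pi * (d.2 : ℕ) / τ.valence d.1 : ℝ) : ℂ) * I) := by
  rw [root]; congr 1; push_cast; ring

theorem norm_root (d : τ.Dart) : ‖τ.root d‖ = 1 := by
  rw [root_eq_exp, norm_exp_ofReal_mul_I]

theorem next_snd (d : τ.Dart) :
    (((τ.next d).2 : ℕ) = d.2 + 1) ∨ (((τ.next d).2 : ℕ) = 0 ∧ (d.2 : ℕ) + 1 = τ.valence d.1) := by
  obtain ⟨v, j⟩ := d
  change (((finRotate (τ.valence v) j : Fin _) : ℕ) = j + 1) ∨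
    (((finRotate (τ.valence v) j : Fin _) : ℕ) = 0 ∧ (j : ℕ) + 1 = τ.valence v)
  generalize τ.valence v = n at j
  cases n with
  | zero => exact j.elim0
  | succ n =>
    rcases eq_or_ne j (Fin.last n) with h | h
    · right; simp [h]
    · left; exact coe_finRotate_of_ne_last h

theorem root_next (d : τ.Dart) :
    τ.root (τ.next d) = τ.root d * exp (2 * Real.pi * I / τ.valence d.1) := by
  have hm := τ.valence_ne_zero d.1
  rw [root, root, ← Complex.exp_add]
  change exp (2 * Real.pi * I * ((τ.next d).2 : ℕ) / τ.valence d.1) = _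
  rcases τ.next_snd d with h | ⟨h, h'⟩
  · rw [h]; congr 1; push_cast; field_simp
  · rw [h]
    have : (2 * Real.pi * I * (d.2 : ℕ) / τ.valence d.1 + 2 * Real.pi * I / τ.valence d.1 : ℂ) =
        2 * Real.pi * I := by
      have h2 : (τ.valence d.1 : ℂ) = (d.2 : ℕ) + 1 := by exact_mod_cast h'.symm
      field_simp
      rw [h2]
    rw [this, exp_two_pi_mul_I]
    simp

theorem eq_of_abs_arg_sub_lt {d e : τ.Dart} (hde : d.1 = e.1) {w : ℂ} (hw : w ≠ 0)
    (h : |arg (w / τ.root d) - arg (w / τ.root e)| < 2 * Real.pi / τ.valence d.1) : d = e := by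
  obtain ⟨v, i⟩ := d
  obtain ⟨v', j⟩ := e
  obtain rfl : v = v' := hde
  have hm := τ.valence_pos v
  have key : ∀ d : τ.Dart, w = ‖w‖ * exp (((arg (w / τ.root d) +
      2 * Real.pi * (d.2 : ℕ) / τ.valence d.1 : ℝ) : ℂ) * I) := by
    intro d
    have h1 := norm_mul_exp_arg_mul_I (w / τ.root d)
    rw [norm_div, norm_root, div_one, eq_div_iff (τ.root_ne_zero d)] at h1
    generalize arg (w / τ.root d) = α at h1
    conv_lhs => rw [← h1, root_eq_exp, mul_assoc, ← Complex.exp_add]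
    congr 2; push_cast; ring
  have h2 := (key ⟨v, i⟩).symm.trans (key ⟨v, j⟩)
  have h3 := mul_left_cancel₀ (by simpa using hw) h2
  obtain ⟨n, hn⟩ := exp_eq_exp_iff_exists_int.1 h3
  have h4 : arg (w / τ.root ⟨v, i⟩) + 2 * Real.pi * (i : ℕ) / τ.valence v =
      arg (w / τ.root ⟨v, j⟩) + 2 * Real.pi * (j : ℕ) / τ.valence v + n * (2 * Real.pi) := by
    have := congrArg Complex.im hn
    simpa using this
  have h5 : arg (w / τ.root ⟨v, i⟩) - arg (w / τ.root ⟨v, j⟩) =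
      (((j : ℕ) : ℤ) - ((i : ℕ) : ℤ) + n * τ.valence v : ℤ) * (2 * Real.pi / τ.valence v) := by
    push_cast
    field_simp
    field_simp at h4
    linarith
  simp only at h
  rw [h5, abs_mul, abs_of_pos (by positivity : 0 < 2 * Real.pi / (τ.valence v : ℝ)),
    mul_lt_iff_lt_one_left (by positivity), ← Int.cast_abs] at h
  have h6 : |(((j : ℕ) : ℤ) - ((i : ℕ) : ℤ) + n * τ.valence v : ℤ)| < 1 := by exact_mod_cast h
  rw [Int.abs_lt_one_iff] at h6
  have hi := i.2
  have hj := j.2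
  have h7 : n = 0 := by
    by_contra hn0
    rcases lt_or_gt_of_ne hn0 with hn0 | hn0
    · have : n * (τ.valence v : ℤ) ≤ -1 * τ.valence v :=
        mul_le_mul_of_nonneg_right (by omega) (by positivity)
      omega
    · have : 1 * (τ.valence v : ℤ) ≤ n * τ.valence v :=
        mul_le_mul_of_nonneg_right (by omega) (by positivity)
      omega
  subst h7
  congr 1
  ext
  omega

theorem exists_arg_nonneg (v : V) (w : ℂ) : ∃ d : τ.Dart, d.1 = v ∧
    0 ≤ arg (w / τ.root d) ∧ arg (w / τ.root d) < 2 * Real.pi / τ.valence v := by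
  have hm := τ.valence_pos v
  rcases eq_or_ne w 0 with rfl | hw
  · exact ⟨⟨v, ⟨0, by exact_mod_cast hm⟩⟩, rfl, by simp, by simp; positivity⟩
  have h2pi : (0 : ℝ) < 2 * Real.pi := by positivity
  set t := toIcoMod h2pi 0 (arg w) with ht
  have ht0 : t ∈ Set.Ico 0 (0 + 2 * Real.pi) := toIcoMod_mem_Ico h2pi 0 _
  rw [zero_add] at ht0
  set j := ⌊t * τ.valence v / (2 * Real.pi)⌋₊ with hj
  have hq : 0 ≤ t * τ.valence v / (2 * Real.pi) := by have := ht0.1; positivity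
  have h1 := Nat.floor_le hq
  have h2 := Nat.lt_floor_add_one (t * τ.valence v / (2 * Real.pi))
  rw [← hj] at h1 h2
  have hjm : j < τ.valence v := by
    have : (j : ℝ) < τ.valence v := by
      refine h1.trans_lt ?_
      rw [div_lt_iff₀ h2pi, mul_comm]
      exact mul_lt_mul_of_pos_left ht0.2 hm
    exact_mod_cast this
  have hu : w / τ.root ⟨v, ⟨j, hjm⟩⟩ =
      ‖w‖ * exp (((t - 2 * Real.pi * j / τ.valence v : ℝ) : ℂ) * I) := by
    have e1 : (t : ℂ) = arg w - (toIcoDiv h2pi 0 (arg w) : ℂ) * (2 * Real.pi) := by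
      rw [ht, toIcoMod]; push_cast; rw [zsmul_eq_mul]
    rw [div_eq_iff (τ.root_ne_zero _), root_eq_exp, mul_assoc, ← Complex.exp_add]
    conv_lhs => rw [← norm_mul_exp_arg_mul_I w]
    congr 1
    rw [exp_eq_exp_iff_exists_int]
    refine ⟨toIcoDiv h2pi 0 (arg w), ?_⟩
    push_cast
    rw [e1]
    ring
  have b1 : 0 ≤ t - 2 * Real.pi * j / τ.valence v := by
    rw [le_div_iff₀ h2pi] at h1
    rw [sub_nonneg, div_le_iff₀ hm]; linarith
  have b2 : t - 2 * Real.pi * j / τ.valence v < 2 * Real.pi / τ.valence v := by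
    rw [div_lt_iff₀ h2pi] at h2
    rw [sub_lt_iff_lt_add, ← add_div, lt_div_iff₀ hm]; linarith
  have b3 : 2 * Real.pi / τ.valence v ≤ Real.pi := by
    rw [div_le_iff₀ hm, mul_comm]
    have h3 : (3 : ℝ) ≤ τ.valence v := by exact_mod_cast τ.three_le_valence v
    nlinarith [Real.pi_pos]
  have harg : arg (w / τ.root ⟨v, ⟨j, hjm⟩⟩) = t - 2 * Real.pi * j / τ.valence v := by
    rw [hu, arg_real_mul _ (norm_pos_iff.2 hw), arg_exp_mul_I, toIocMod_eq_self]
    constructor <;> linarith [Real.pi_pos]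
  exact ⟨⟨v, ⟨j, hjm⟩⟩, rfl, harg ▸ b1, harg ▸ b2⟩

end Fatgraph

namespace MetricFatgraph

variable {V : Type*} (τ : MetricFatgraph V)

/-- The open sector around the half-edge `d` on which the stripe coordinate is a biholomorphic map
onto the slit plane. -/
def wedge (d : τ.Dart) : Set ℂ :=
  {w | w ≠ 0 ∧ |arg (w / τ.root d)| < 2 * Real.pi / τ.valence d.1}

/-- The inverse `z ↦ c z ^ (2 / m)` of the stripe coordinate. -/
noncomputable def param (d : τ.Dart) (z : ℂ) : ℂ :=
  τ.root d * z ^ (2 / (τ.valence d.1 : ℂ))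

variable {τ} {d : τ.Dart} {w z : ℂ}

theorem two_pi_div_valence_lt (d : τ.Dart) : 2 * Real.pi / τ.valence d.1 < Real.pi := by
  have h3 : (3 : ℝ) ≤ τ.valence d.1 := by exact_mod_cast τ.three_le_valence d.1
  rw [div_lt_iff₀ (τ.valence_pos _)]
  nlinarith [Real.pi_pos]

theorem div_root_ne_zero (hw : w ≠ 0) : w / τ.root d ≠ 0 := div_ne_zero hw (τ.root_ne_zero d)

theorem log_stripeCoord (hw : w ∈ τ.wedge d) :
    log (τ.stripeCoord d w) = (τ.valence d.1 : ℂ) / 2 * log (w / τ.root d) := by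
  have hm := τ.valence_pos d.1
  have hb := hw.2
  rw [lt_div_iff₀ hm] at hb
  have him : ((τ.valence d.1 : ℂ) / 2 * log (w / τ.root d)).im =
      τ.valence d.1 / 2 * arg (w / τ.root d) := by
    have : ((τ.valence d.1 : ℂ) / 2) = ((τ.valence d.1 / 2 : ℝ) : ℂ) := by push_cast; rfl
    rw [this, im_ofReal_mul, log_im]
  rw [stripeCoord, cpow_def_of_ne_zero (div_root_ne_zero hw.1), mul_comm, log_exp]
  · rw [him]
    have := neg_abs_le (arg (w / τ.root d))
    nlinarith
  · rw [him]
    have := le_abs_self (arg (w / τ.root d))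
    nlinarith

theorem stripeCoord_ne_zero (hw : w ≠ 0) : τ.stripeCoord d w ≠ 0 := by
  rw [stripeCoord, cpow_def_of_ne_zero (div_root_ne_zero hw)]
  exact exp_ne_zero _

theorem arg_stripeCoord (hw : w ∈ τ.wedge d) :
    arg (τ.stripeCoord d w) = τ.valence d.1 / 2 * arg (w / τ.root d) := by
  have h := congrArg Complex.im (log_stripeCoord hw)
  have : ((τ.valence d.1 : ℂ) / 2) = ((τ.valence d.1 / 2 : ℝ) : ℂ) := by push_cast; rfl
  rwa [log_im, this, im_ofReal_mul, log_im] at h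

theorem stripeCoord_mem_slitPlane (hw : w ∈ τ.wedge d) : τ.stripeCoord d w ∈ slitPlane := by
  rw [mem_slitPlane_iff_arg]
  refine ⟨?_, stripeCoord_ne_zero hw.1⟩
  rw [arg_stripeCoord hw]
  have hm := τ.valence_pos d.1
  have hb := hw.2
  rw [lt_div_iff₀ hm] at hb
  have := le_abs_self (arg (w / τ.root d))
  nlinarith

theorem param_stripeCoord (hw : w ∈ τ.wedge d) : τ.param d (τ.stripeCoord d w) = w := by
  have hm := τ.valence_ne_zero d.1
  have hu := div_root_ne_zero (d := d) hw.1
  have : (τ.valence d.1 : ℂ) / 2 * log (w / τ.root d) * (2 / (τ.valence d.1 : ℂ)) =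
      log (w / τ.root d) := by field_simp
  rw [param, cpow_def_of_ne_zero (stripeCoord_ne_zero hw.1), log_stripeCoord hw, this,
    exp_log hu, mul_div_cancel₀ _ (τ.root_ne_zero d)]

theorem param_zero (d : τ.Dart) : τ.param d 0 = 0 := by
  rw [param, zero_cpow (div_ne_zero two_ne_zero (τ.valence_ne_zero d.1)), mul_zero]

theorem param_div_root (d : τ.Dart) (z : ℂ) :
    τ.param d z / τ.root d = z ^ (2 / (τ.valence d.1 : ℂ)) := by
  rw [param, mul_div_cancel_left₀ _ (τ.root_ne_zero d)]

theorem log_param (hz : z ≠ 0) :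
    log (τ.param d z / τ.root d) = 2 / (τ.valence d.1 : ℂ) * log z := by
  have hm := τ.valence_pos d.1
  have h3 : (3 : ℝ) ≤ τ.valence d.1 := by exact_mod_cast τ.three_le_valence d.1
  have him : (2 / (τ.valence d.1 : ℂ) * log z).im = 2 / τ.valence d.1 * arg z := by
    have : (2 / (τ.valence d.1 : ℂ)) = ((2 / τ.valence d.1 : ℝ) : ℂ) := by push_cast; rfl
    rw [this, im_ofReal_mul, log_im]
  have h23 : (2 : ℝ) / τ.valence d.1 < 1 := by rw [div_lt_one hm]; linarith
  have h0 : (0 : ℝ) < 2 / τ.valence d.1 := by positivity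
  rw [param_div_root, cpow_def_of_ne_zero hz, mul_comm, log_exp]
  · rw [him]
    nlinarith [neg_pi_lt_arg z, Real.pi_pos]
  · rw [him]
    nlinarith [arg_le_pi z, Real.pi_pos]

theorem param_ne_zero (hz : z ≠ 0) : τ.param d z ≠ 0 := by
  rw [param, cpow_def_of_ne_zero hz]
  exact mul_ne_zero (τ.root_ne_zero d) (exp_ne_zero _)

theorem stripeCoord_zero (d : τ.Dart) : τ.stripeCoord d 0 = 0 := by
  rw [stripeCoord, zero_div, zero_cpow (div_ne_zero (τ.valence_ne_zero d.1) two_ne_zero)]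

theorem stripeCoord_param (d : τ.Dart) (z : ℂ) : τ.stripeCoord d (τ.param d z) = z := by
  rcases eq_or_ne z 0 with rfl | hz
  · rw [param_zero, stripeCoord_zero]
  have hm := τ.valence_ne_zero d.1
  have : 2 / (τ.valence d.1 : ℂ) * log z * ((τ.valence d.1 : ℂ) / 2) = log z := by field_simp
  rw [stripeCoord, cpow_def_of_ne_zero (div_root_ne_zero (param_ne_zero hz)), log_param hz, this,
    exp_log hz]

theorem param_mem_wedge (hz : z ∈ slitPlane) : τ.param d z ∈ τ.wedge d := by
  have hz0 := (mem_slitPlane_iff_arg.1 hz).2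
  have hm := τ.valence_pos d.1
  refine ⟨param_ne_zero hz0, ?_⟩
  have h := congrArg Complex.im (log_param (d := d) hz0)
  have : (2 / (τ.valence d.1 : ℂ)) = ((2 / τ.valence d.1 : ℝ) : ℂ) := by push_cast; rfl
  rw [log_im, this, im_ofReal_mul, log_im] at h
  rw [h, abs_mul, abs_of_pos (by positivity), mul_div_right_comm]
  refine mul_lt_mul_of_pos_left ?_ (by positivity)
  exact abs_lt.2 ⟨neg_pi_lt_arg z, lt_of_le_of_ne (arg_le_pi z) (mem_slitPlane_iff_arg.1 hz).1⟩

theorem im_stripeCoord_pos (hw : w ∈ τ.wedge d) :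
    0 < (τ.stripeCoord d w).im ↔ 0 < arg (w / τ.root d) := by
  have hm := τ.valence_pos d.1
  have h0 : τ.stripeCoord d w ∈ slitPlane := stripeCoord_mem_slitPlane hw
  have h1 := arg_stripeCoord hw
  have h2 : 0 < arg (τ.stripeCoord d w) ↔ 0 < arg (w / τ.root d) := by
    rw [h1]; exact mul_pos_iff_of_pos_left (by positivity)
  rw [← h2]
  constructor
  · intro h
    refine lt_of_le_of_ne (arg_nonneg_iff.2 h.le) fun h' => ?_
    rw [eq_comm, arg_eq_zero_iff] at h'
    exact h.ne' h'.2
  · intro h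
    refine lt_of_le_of_ne (arg_nonneg_iff.1 h.le) fun h' => ?_
    rcases mem_slitPlane_iff.1 h0 with h3 | h3
    · rw [arg_eq_zero_iff.2 ⟨h3.le, h'.symm⟩] at h
      exact lt_irrefl _ h
    · exact h3 h'.symm

theorem im_stripeCoord_neg (hw : w ∈ τ.wedge d) :
    (τ.stripeCoord d w).im < 0 ↔ arg (w / τ.root d) < 0 := by
  have hm := τ.valence_pos d.1
  rw [← arg_neg_iff, arg_stripeCoord hw]
  have h0 : (0 : ℝ) < τ.valence d.1 / 2 := by positivity
  exact ⟨fun h => by nlinarith, fun h => mul_neg_of_pos_of_neg h0 h⟩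

theorem re_stripeCoord_nonneg (hw : w ∈ τ.wedge d) :
    0 ≤ (τ.stripeCoord d w).re ↔ |arg (w / τ.root d)| ≤ Real.pi / τ.valence d.1 := by
  have hm := τ.valence_pos d.1
  rw [← abs_arg_le_pi_div_two_iff, arg_stripeCoord hw, abs_mul, abs_of_pos (by positivity),
    le_div_iff₀ hm]
  constructor <;> intro h <;> linarith

theorem re_stripeCoord_pos (hw : w ∈ τ.wedge d) :
    0 < (τ.stripeCoord d w).re ↔ |arg (w / τ.root d)| < Real.pi / τ.valence d.1 := by
  have hm := τ.valence_pos d.1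
  have h := abs_arg_lt_pi_div_two_iff (z := τ.stripeCoord d w)
  rw [or_iff_left (stripeCoord_ne_zero hw.1), arg_stripeCoord hw, abs_mul,
    abs_of_pos (by positivity)] at h
  rw [← h, lt_div_iff₀ hm]
  constructor <;> intro h <;> linarith

theorem mem_wedge_of_abs_arg_le (hw : w ≠ 0)
    (h : |arg (w / τ.root d)| ≤ Real.pi / τ.valence d.1) : w ∈ τ.wedge d := by
  refine ⟨hw, h.trans_lt ?_⟩
  have hm := τ.valence_pos d.1
  gcongr
  linarith [Real.pi_pos]

theorem mem_stripe_iff : w ∈ τ.stripe d ↔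
    w ∈ τ.wedge d ∧ 0 < (τ.stripeCoord d w).re ∧ (τ.stripeCoord d w).re < τ.len d := by
  constructor
  · rintro ⟨h0, h1, h2⟩
    have hw := mem_wedge_of_abs_arg_le h0 h1.le
    exact ⟨hw, (re_stripeCoord_pos hw).2 h1, h2⟩
  · rintro ⟨h0, h1, h2⟩
    exact ⟨h0.1, (re_stripeCoord_pos h0).1 h1, h2⟩

theorem mem_wedge_next (hw : w ∈ τ.wedge d) (h : 0 < (τ.stripeCoord d w).im) :
    w ∈ τ.wedge (τ.next d) ∧ τ.stripeCoord (τ.next d) w = -τ.stripeCoord d w := by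
  have hm := τ.valence_ne_zero d.1
  have hu := div_root_ne_zero (d := d) hw.1
  rw [im_stripeCoord_pos hw] at h
  have hb := hw.2
  rw [abs_of_pos h] at hb
  have hpi := two_pi_div_valence_lt d
  have hlog : log (w / τ.root (τ.next d)) =
      log (w / τ.root d) - 2 * Real.pi * I / τ.valence d.1 := by
    have e1 : w / τ.root (τ.next d) =
        exp (log (w / τ.root d) - 2 * Real.pi * I / τ.valence d.1) := by
      rw [Complex.exp_sub, exp_log hu, τ.root_next, div_div]
    have e2 : (log (w / τ.root d) - 2 * Real.pi * I / τ.valence d.1).im =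
        arg (w / τ.root d) - 2 * Real.pi / τ.valence d.1 := by
      have : (2 * Real.pi * I / τ.valence d.1 : ℂ) =
        ((2 * Real.pi / τ.valence d.1 : ℝ) : ℂ) * I := by push_cast; ring
      rw [this, sub_im, log_im, im_ofReal_mul, I_im, mul_one]
    rw [e1, log_exp] <;> rw [e2] <;> linarith
  have hu' := div_root_ne_zero (d := τ.next d) hw.1
  refine ⟨⟨hw.1, ?_⟩, ?_⟩
  · have := congrArg Complex.im hlog
    have e : (2 * Real.pi * I / τ.valence d.1 : ℂ) =
        ((2 * Real.pi / τ.valence d.1 : ℝ) : ℂ) * I := by push_cast; ring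
    rw [e, sub_im, log_im, log_im, im_ofReal_mul, I_im, mul_one] at this
    rw [this]
    change _ < 2 * Real.pi / τ.valence d.1
    rw [abs_lt]
    constructor <;> linarith
  · rw [stripeCoord, stripeCoord, cpow_def_of_ne_zero hu', cpow_def_of_ne_zero hu, hlog]
    change exp (_ * (τ.valence d.1 / 2 : ℂ)) = _
    have e : (log (w / τ.root d) - 2 * Real.pi * I / τ.valence d.1) * (τ.valence d.1 / 2 : ℂ) =
      log (w / τ.root d) * (τ.valence d.1 / 2 : ℂ) - Real.pi * I := by field_simp
    rw [e, Complex.exp_sub, exp_pi_mul_I, div_neg, div_one]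

theorem mem_wedge_of_next (hw : w ∈ τ.wedge (τ.next d))
    (h : (τ.stripeCoord (τ.next d) w).im < 0) :
    w ∈ τ.wedge d ∧ τ.stripeCoord d w = -τ.stripeCoord (τ.next d) w := by
  have hm := τ.valence_ne_zero d.1
  have hu := div_root_ne_zero (d := τ.next d) hw.1
  rw [im_stripeCoord_neg hw] at h
  have hb : |arg (w / τ.root (τ.next d))| < 2 * Real.pi / τ.valence d.1 := hw.2
  rw [abs_of_neg h] at hb
  have hpi := two_pi_div_valence_lt d
  have hlog : log (w / τ.root d) =
      log (w / τ.root (τ.next d)) + 2 * Real.pi * I / τ.valence d.1 := by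
    have e1 : w / τ.root d =
        exp (log (w / τ.root (τ.next d)) + 2 * Real.pi * I / τ.valence d.1) := by
      rw [Complex.exp_add, exp_log hu, τ.root_next, div_mul_eq_mul_div, mul_div_mul_right]
      exact exp_ne_zero _
    have e2 : (log (w / τ.root (τ.next d)) + 2 * Real.pi * I / τ.valence d.1).im =
        arg (w / τ.root (τ.next d)) + 2 * Real.pi / τ.valence d.1 := by
      have : (2 * Real.pi * I / τ.valence d.1 : ℂ) =
        ((2 * Real.pi / τ.valence d.1 : ℝ) : ℂ) * I := by push_cast; ring
      rw [this, add_im, log_im, im_ofReal_mul, I_im, mul_one]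
    rw [e1, log_exp] <;> rw [e2] <;> linarith
  have hu' := div_root_ne_zero (d := d) hw.1
  refine ⟨⟨hw.1, ?_⟩, ?_⟩
  · have := congrArg Complex.im hlog
    have e : (2 * Real.pi * I / τ.valence d.1 : ℂ) =
        ((2 * Real.pi / τ.valence d.1 : ℝ) : ℂ) * I := by push_cast; ring
    rw [e, add_im, log_im, log_im, im_ofReal_mul, I_im, mul_one] at this
    rw [this, abs_lt]
    constructor <;> linarith
  · rw [stripeCoord, stripeCoord, cpow_def_of_ne_zero hu', cpow_def_of_ne_zero hu, hlog]
    change _ = -exp (_ * (τ.valence d.1 / 2 : ℂ))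
    have e : (log (w / τ.root (τ.next d)) + 2 * Real.pi * I / τ.valence d.1) *
        (τ.valence d.1 / 2 : ℂ) =
      log (w / τ.root (τ.next d)) * (τ.valence d.1 / 2 : ℂ) + Real.pi * I := by field_simp
    rw [e, Complex.exp_add, exp_pi_mul_I, mul_neg, mul_one]

theorem mem_wedge_prev (hw : w ∈ τ.wedge d) (h : (τ.stripeCoord d w).im < 0) :
    w ∈ τ.wedge (τ.next.symm d) ∧ τ.stripeCoord (τ.next.symm d) w = -τ.stripeCoord d w := by
  obtain ⟨e, rfl⟩ := τ.next.surjective d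
  rw [Equiv.symm_apply_apply]
  exact mem_wedge_of_next hw h

/-- Different open stripes at a vertex are disjoint. -/
theorem eq_of_re_pos {d e : τ.Dart} (hde : d.1 = e.1) (hd : w ∈ τ.wedge d) (he : w ∈ τ.wedge e)
    (h1 : 0 < (τ.stripeCoord d w).re) (h2 : 0 ≤ (τ.stripeCoord e w).re) : d = e := by
  rw [re_stripeCoord_pos hd] at h1
  rw [re_stripeCoord_nonneg he] at h2
  rw [← hde] at h2
  refine τ.eq_of_abs_arg_sub_lt hde hd.1 ((abs_sub _ _).trans_lt ?_)
  rw [two_mul, add_div]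
  exact add_lt_add_of_lt_of_le h1 h2

/-- Different open corners at a vertex are disjoint. -/
theorem eq_of_im_pos {d e : τ.Dart} (hde : d.1 = e.1) (hd : w ∈ τ.wedge d) (he : w ∈ τ.wedge e)
    (h1 : 0 < (τ.stripeCoord d w).im) (h2 : 0 ≤ (τ.stripeCoord e w).im) : d = e := by
  rw [im_stripeCoord_pos hd] at h1
  have h2' : 0 ≤ arg (w / τ.root e) := by
    by_contra h
    exact absurd ((im_stripeCoord_neg he).2 (not_le.1 h)) (not_lt.2 h2)
  have h3 := (abs_lt.1 hd.2).2
  have h4 := (abs_lt.1 he.2).2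
  rw [← hde] at h4
  refine τ.eq_of_abs_arg_sub_lt hde hd.1 (abs_lt.2 ⟨?_, ?_⟩) <;> linarith

theorem exists_mem_wedge (v : V) (hw : w ≠ 0) : ∃ d : τ.Dart, d.1 = v ∧ w ∈ τ.wedge d ∧
    0 ≤ (τ.stripeCoord d w).re := by
  obtain ⟨d, rfl, h1, h2⟩ := τ.exists_arg_nonneg v w
  have hd : w ∈ τ.wedge d := ⟨hw, by rwa [abs_of_nonneg h1]⟩
  rcases le_or_gt 0 (τ.stripeCoord d w).re with h | h
  · exact ⟨d, rfl, hd, h⟩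
  · have him : 0 < (τ.stripeCoord d w).im := by
      refine lt_of_le_of_ne ?_ ?_
      · by_contra hc
        exact absurd ((im_stripeCoord_neg hd).1 (not_le.1 hc)) (not_lt.2 h1)
      · rcases mem_slitPlane_iff.1 (stripeCoord_mem_slitPlane hd) with h3 | h3
        · linarith
        · exact h3.symm
    obtain ⟨h3, h4⟩ := mem_wedge_next hd him
    exact ⟨τ.next d, rfl, h3, by rw [h4, neg_re]; linarith⟩

theorem mem_star_iff (hw : w ∈ τ.wedge d) (h : 0 ≤ (τ.stripeCoord d w).re) :
    w ∈ τ.star d.1 ↔ (τ.stripeCoord d w).re < τ.len d := by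
  constructor
  · exact fun hs => hs d.2 ((re_stripeCoord_nonneg hw).1 h)
  · intro hlt j hj
    have hwj := mem_wedge_of_abs_arg_le (d := (⟨d.1, j⟩ : τ.Dart)) hw.1 hj
    rcases lt_or_ge 0 (τ.stripeCoord ⟨d.1, j⟩ w).re with h1 | h1
    · have h2 := eq_of_re_pos (d := ⟨d.1, j⟩) (e := d) rfl hwj hw h1 h
      rw [h2]
      exact hlt
    · exact h1.trans_lt (τ.len_pos _)

theorem mem_star_of_mem_stripe (hw : w ∈ τ.stripe d) : w ∈ τ.star d.1 := by
  rw [mem_stripe_iff] at hw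
  exact (mem_star_iff hw.1 hw.2.1.le).2 hw.2.2

theorem mem_corner_iff : w ∈ τ.corner d ↔ w ∈ τ.wedge d ∧ 0 < (τ.stripeCoord d w).im ∧
    -τ.len (τ.next d) < (τ.stripeCoord d w).re ∧ (τ.stripeCoord d w).re < τ.len d := by
  constructor
  · rintro ⟨hs, h1, h2⟩
    have hw0 : w ≠ 0 := by rintro rfl; simp at h1
    have hw : w ∈ τ.wedge d := ⟨hw0, by rwa [abs_of_pos h1]⟩
    have him := (im_stripeCoord_pos hw).2 h1
    refine ⟨hw, him, ?_⟩
    obtain ⟨h3, h4⟩ := mem_wedge_next hw him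
    have l1 := τ.len_pos d
    have l2 := τ.len_pos (τ.next d)
    rcases le_total 0 (τ.stripeCoord d w).re with h | h
    · exact ⟨by linarith, (mem_star_iff hw h).1 hs⟩
    · have := (mem_star_iff h3 (by rw [h4, neg_re]; linarith)).1 hs
      rw [h4, neg_re] at this
      constructor <;> linarith
  · rintro ⟨hw, him, h1, h2⟩
    have ha := (im_stripeCoord_pos hw).1 him
    refine ⟨?_, ha, (abs_lt.1 hw.2).2⟩
    obtain ⟨h3, h4⟩ := mem_wedge_next hw him
    rcases le_total 0 (τ.stripeCoord d w).re with h | h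
    · exact (mem_star_iff hw h).2 h2
    · exact (mem_star_iff h3 (by rw [h4, neg_re]; linarith)).2 (by rw [h4, neg_re]; linarith)

end MetricFatgraph

namespace MetricFatgraph

variable {V : Type*} (τ : MetricFatgraph V)

/-- The closure of `wedge d`. -/
def closedWedge (d : τ.Dart) : Set ℂ :=
  {w | |arg (w / τ.root d)| ≤ 2 * Real.pi / τ.valence d.1}

variable {τ} {d : τ.Dart} {w z : ℂ}

theorem wedge_subset_closedWedge (d : τ.Dart) : τ.wedge d ⊆ τ.closedWedge d :=
  fun _ h => h.2.le

theorem isClosed_closedWedge (d : τ.Dart) : IsClosed (τ.closedWedge d) := by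
  have hm := τ.valence_pos d.1
  have hpi := two_pi_div_valence_lt d
  have h0 : (0 : ℝ) ≤ 2 * Real.pi / τ.valence d.1 := by positivity
  have : τ.closedWedge d =
      {w | ‖w / τ.root d‖ * Real.cos (2 * Real.pi / τ.valence d.1) ≤ (w / τ.root d).re} := by
    ext w
    rcases eq_or_ne w 0 with rfl | hw
    · simpa [closedWedge] using h0
    have hu := norm_pos_iff.2 (div_root_ne_zero (d := d) hw)
    have hre : (w / τ.root d).re = ‖w / τ.root d‖ * Real.cos |arg (w / τ.root d)| := by
      rw [Real.cos_abs, norm_mul_cos_arg]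
    change |arg (w / τ.root d)| ≤ 2 * Real.pi / τ.valence d.1 ↔ _ ≤ (w / τ.root d).re
    rw [hre, mul_le_mul_iff_right₀ hu]
    exact (Real.strictAntiOn_cos.le_iff_ge ⟨h0, hpi.le⟩
      ⟨abs_nonneg _, abs_arg_le_pi _⟩).symm
  rw [this]
  exact isClosed_le (by fun_prop) (by fun_prop)

theorem div_root_mem_slitPlane (hw : w ∈ τ.closedWedge d) (h0 : w ≠ 0) :
    w / τ.root d ∈ slitPlane := by
  rw [mem_slitPlane_iff_arg]
  refine ⟨fun h => ?_, div_root_ne_zero h0⟩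
  have h1 : |arg (w / τ.root d)| ≤ _ := hw
  rw [h, abs_of_pos Real.pi_pos] at h1
  exact absurd (two_pi_div_valence_lt d) (not_lt.2 h1)

theorem continuousOn_stripeCoord (d : τ.Dart) :
    ContinuousOn (τ.stripeCoord d) (τ.closedWedge d) := by
  intro w hw
  refine ContinuousAt.continuousWithinAt ?_
  have hdiv : ContinuousAt (fun w : ℂ => w / τ.root d) w := by fun_prop
  rcases eq_or_ne w 0 with rfl | h0
  · have hm := τ.valence_pos d.1
    have hre : 0 < ((τ.valence d.1 : ℂ) / 2).re := by
      have : ((τ.valence d.1 : ℂ) / 2) = ((τ.valence d.1 / 2 : ℝ) : ℂ) := by push_cast; rfl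
      rw [this, ofReal_re]
      positivity
    have h1 : ContinuousAt (fun u : ℂ => u ^ ((τ.valence d.1 : ℂ) / 2)) 0 :=
      ContinuousAt.comp (f := fun u : ℂ => (u, (τ.valence d.1 : ℂ) / 2))
        (continuousAt_cpow_zero_of_re_pos hre) (by fun_prop)
    exact ContinuousAt.comp (g := fun u : ℂ => u ^ ((τ.valence d.1 : ℂ) / 2))
      (by rwa [zero_div]) hdiv
  · exact ContinuousAt.comp (g := fun u : ℂ => u ^ ((τ.valence d.1 : ℂ) / 2))
      (continuousAt_cpow_const (div_root_mem_slitPlane hw h0)) hdiv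

theorem isOpen_wedge (d : τ.Dart) : IsOpen (τ.wedge d) := by
  rw [isOpen_iff_mem_nhds]
  intro w hw
  have h1 : ContinuousAt (fun w : ℂ => |arg (w / τ.root d)|) w :=
    (ContinuousAt.comp (f := fun w : ℂ => w / τ.root d) (g := arg) (continuousAt_arg
      (div_root_mem_slitPlane (wedge_subset_closedWedge d hw) hw.1)) (by fun_prop)).abs
  filter_upwards [isOpen_ne.mem_nhds hw.1, h1.eventually_lt_const hw.2] with u h2 h3
  exact ⟨h2, h3⟩

theorem continuousOn_stripeCoord_wedge (d : τ.Dart) :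
    ContinuousOn (τ.stripeCoord d) (τ.wedge d) :=
  (continuousOn_stripeCoord d).mono (wedge_subset_closedWedge d)

theorem isOpen_wedge_inter (d : τ.Dart) {s : Set ℂ} (hs : IsOpen s) :
    IsOpen (τ.wedge d ∩ τ.stripeCoord d ⁻¹' s) :=
  (continuousOn_stripeCoord_wedge d).isOpen_inter_preimage (isOpen_wedge d) hs

theorem isOpen_stripe (d : τ.Dart) : IsOpen (τ.stripe d) := by
  convert isOpen_wedge_inter d ((isOpen_lt continuous_const continuous_re).inter
    (isOpen_lt continuous_re continuous_const) : IsOpen ({z : ℂ | 0 < z.re} ∩ {z : ℂ | z.re < τ.len d}))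
  ext w
  exact mem_stripe_iff

theorem isOpen_corner (d : τ.Dart) : IsOpen (τ.corner d) := by
  convert isOpen_wedge_inter d ((isOpen_lt continuous_const continuous_im).inter
    ((isOpen_lt continuous_const continuous_re).inter
    (isOpen_lt continuous_re continuous_const)) : IsOpen ({z : ℂ | 0 < z.im} ∩
      ({z : ℂ | -τ.len (τ.next d) < z.re} ∩ {z : ℂ | z.re < τ.len d})))
  ext w
  exact mem_corner_iff

/-- Outside `wedge d` the stripe coordinate is a non-positive real number on `closedWedge d`. -/
theorem mem_wedge_of_mem_closedWedge (hw : w ∈ τ.closedWedge d)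
    (h : 0 < (τ.stripeCoord d w).re ∨ (τ.stripeCoord d w).im ≠ 0) : w ∈ τ.wedge d := by
  have hm := τ.valence_pos d.1
  have h0 : w ≠ 0 := by
    rintro rfl
    simp [stripeCoord_zero] at h
  refine ⟨h0, lt_of_le_of_ne hw fun heq => ?_⟩
  have hz : τ.stripeCoord d w = ((-Real.exp (τ.valence d.1 / 2 * Real.log ‖w / τ.root d‖) : ℝ) : ℂ) := by
    have key : ∀ s : ℝ, s = 1 ∨ s = -1 → arg (w / τ.root d) = s * (2 * Real.pi / τ.valence d.1) →
        τ.stripeCoord d w =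
          ((-Real.exp (τ.valence d.1 / 2 * Real.log ‖w / τ.root d‖) : ℝ) : ℂ) := by
      intro s hs harg
      have hm' := τ.valence_ne_zero d.1
      rw [stripeCoord, cpow_def_of_ne_zero (div_root_ne_zero h0), log, harg]
      have e : ((Real.log ‖w / τ.root d‖ : ℂ) +
          ((s * (2 * Real.pi / τ.valence d.1) : ℝ) : ℂ) * I) * (τ.valence d.1 / 2 : ℂ) =
          ((τ.valence d.1 / 2 * Real.log ‖w / τ.root d‖ : ℝ) : ℂ) + s * (Real.pi * I) := by
        push_cast; field_simp
      rw [e, Complex.exp_add, ← ofReal_exp]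
      have e2 : exp (s * (Real.pi * I)) = -1 := by
        rcases hs with rfl | rfl
        · simp
        · simp [Complex.exp_neg]
      rw [e2]
      push_cast
      ring
    rcases abs_eq (by positivity) |>.1 heq with h1 | h1
    · exact key 1 (Or.inl rfl) (by rw [h1, one_mul])
    · exact key (-1) (Or.inr rfl) (by rw [h1, neg_one_mul])
  rw [hz, ofReal_re, ofReal_im] at h
  rcases h with h | h
  · linarith [Real.exp_pos (τ.valence d.1 / 2 * Real.log ‖w / τ.root d‖)]
  · exact h rfl

theorem isClosed_closedWedge_inter (d : τ.Dart) {s : Set ℂ} (hs : IsClosed s) :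
    IsClosed (τ.closedWedge d ∩ τ.stripeCoord d ⁻¹' s) :=
  (continuousOn_stripeCoord d).preimage_isClosed_of_isClosed (isClosed_closedWedge d) hs

variable (τ) in
theorem isOpen_star [Finite V] (v : V) : IsOpen (τ.star v) := by
  have h : (τ.star v)ᶜ = ⋃ j : Fin (τ.valence v), τ.closedWedge ⟨v, j⟩ ∩
      τ.stripeCoord ⟨v, j⟩ ⁻¹' {z | τ.len ⟨v, j⟩ ≤ z.re} := by
    ext w
    simp only [star, Set.mem_compl_iff, Set.mem_ofPred_eq, not_forall, not_lt, Set.mem_iUnion,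
      Set.mem_inter_iff, Set.mem_preimage]
    refine exists_congr fun j => ?_
    constructor
    · rintro ⟨h1, h2⟩
      refine ⟨h1.trans ?_, h2⟩
      have hm := τ.valence_pos v
      gcongr
      linarith [Real.pi_pos]
    · rintro ⟨h1, h2⟩
      have h3 := mem_wedge_of_mem_closedWedge h1 (Or.inl ((τ.len_pos _).trans_le h2))
      exact ⟨(re_stripeCoord_nonneg h3).1 ((τ.len_pos _).le.trans h2), h2⟩
  rw [← isClosed_compl_iff, h]
  exact isClosed_iUnion_of_finite fun j =>
    isClosed_closedWedge_inter _ (isClosed_le continuous_const continuous_re)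

theorem mul_mem_star {v : V} (hw : w ∈ τ.star v) {t : ℝ} (h0 : 0 ≤ t) (h1 : t ≤ 1) :
    (t : ℂ) * w ∈ τ.star v := by
  rcases h0.eq_or_lt with rfl | h0
  · simpa using τ.zero_mem_star v
  rcases eq_or_ne w 0 with rfl | hw0
  · simpa using τ.zero_mem_star v
  intro j hj
  rw [mul_div_assoc, arg_real_mul _ h0] at hj
  have h2 := hw j hj
  have h3 : τ.stripeCoord ⟨v, j⟩ (t * w) =
      (Real.exp (τ.valence v / 2 * Real.log t) : ℂ) * τ.stripeCoord ⟨v, j⟩ w := by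
    have hu := div_root_ne_zero (d := (⟨v, j⟩ : τ.Dart)) hw0
    rw [stripeCoord, stripeCoord, mul_div_assoc, cpow_def_of_ne_zero hu,
      cpow_def_of_ne_zero (mul_ne_zero (ofReal_ne_zero.2 h0.ne') hu), log_ofReal_mul h0 hu,
      add_mul, Complex.exp_add, ofReal_exp]
    congr 2
    push_cast
    ring
  rw [h3, re_ofReal_mul]
  have h4 : Real.exp (τ.valence v / 2 * Real.log t) ≤ 1 := by
    rw [Real.exp_le_one_iff]
    exact mul_nonpos_of_nonneg_of_nonpos (by positivity) (Real.log_nonpos h0.le h1)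
  have h5 := Real.exp_pos (τ.valence v / 2 * Real.log t)
  rcases le_total 0 (τ.stripeCoord ⟨v, j⟩ w).re with h | h
  · nlinarith
  · exact (mul_nonpos_of_nonneg_of_nonpos h5.le h).trans_lt (τ.len_pos _)

theorem isPreconnected_star (v : V) : IsPreconnected (τ.star v) := by
  have : StarConvex ℝ 0 (τ.star v) := by
    rw [starConvex_zero_iff]
    intro w hw t h0 h1
    rw [real_smul]
    exact mul_mem_star hw h0 h1
  exact (StarConvex.isPathConnected this (τ.zero_mem_star v)).isConnected.isPreconnected

variable (τ) in
/-- The derivative of `param d`. -/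
noncomputable def paramDeriv (d : τ.Dart) (z : ℂ) : ℂ :=
  2 / (τ.valence d.1 : ℂ) * τ.root d * z ^ (2 / (τ.valence d.1 : ℂ) - 1)

theorem paramDeriv_ne_zero (d : τ.Dart) (hz : z ≠ 0) : τ.paramDeriv d z ≠ 0 :=
  mul_ne_zero (mul_ne_zero (div_ne_zero two_ne_zero (τ.valence_ne_zero _)) (τ.root_ne_zero d))
    (by rw [cpow_def_of_ne_zero hz]; exact exp_ne_zero _)

theorem hasDerivAt_param (hz : z ∈ slitPlane) :
    HasDerivAt (τ.param d) (τ.paramDeriv d z) z := by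
  have h := ((hasDerivAt_id z).cpow_const (c := 2 / (τ.valence d.1 : ℂ)) hz).const_mul (τ.root d)
  refine h.congr_deriv ?_
  simp only [paramDeriv, id]
  ring

theorem hasDerivAt_stripeCoord (hw : w ∈ τ.wedge d) :
    HasDerivAt (τ.stripeCoord d) (τ.paramDeriv d (τ.stripeCoord d w))⁻¹ w := by
  refine HasDerivAt.of_local_left_inverse (f := τ.param d) ?_
    (hasDerivAt_param (stripeCoord_mem_slitPlane hw))
    (paramDeriv_ne_zero d (stripeCoord_ne_zero hw.1)) ?_
  · exact (continuousOn_stripeCoord_wedge d).continuousAt ((isOpen_wedge d).mem_nhds hw)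
  · filter_upwards [(isOpen_wedge d).mem_nhds hw] with u hu
    exact param_stripeCoord hu

theorem analyticAt_of_hasDerivAt {f f' : ℂ → ℂ} {s : Set ℂ} (hs : IsOpen s)
    (h : ∀ w ∈ s, HasDerivAt f (f' w) w) {w : ℂ} (hw : w ∈ s) : AnalyticAt ℂ f w :=
  DifferentiableOn.analyticAt (fun u hu => (h u hu).differentiableAt.differentiableWithinAt)
    (hs.mem_nhds hw)

theorem analyticAt_param (hz : z ∈ slitPlane) : AnalyticAt ℂ (τ.param d) z :=
  analyticAt_of_hasDerivAt isOpen_slitPlane (fun _ h => hasDerivAt_param h) hz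

theorem analyticAt_stripeCoord (hw : w ∈ τ.wedge d) : AnalyticAt ℂ (τ.stripeCoord d) w :=
  analyticAt_of_hasDerivAt (isOpen_wedge d) (fun _ h => hasDerivAt_stripeCoord h) hw

theorem mem_wedge_of_mem_stripe (hw : w ∈ τ.stripe d) : w ∈ τ.wedge d := (mem_stripe_iff.1 hw).1

theorem mem_wedge_of_mem_corner (hw : w ∈ τ.corner d) : w ∈ τ.wedge d := (mem_corner_iff.1 hw).1

theorem transition_eq (d : τ.Dart) (w : ℂ) :
    τ.transition d w = τ.param (τ.inv d) (τ.len d - τ.stripeCoord d w) := rfl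

theorem stripeCoord_transition (d : τ.Dart) (w : ℂ) :
    τ.stripeCoord (τ.inv d) (τ.transition d w) = τ.len d - τ.stripeCoord d w :=
  stripeCoord_param _ _

theorem len_sub_mem_slitPlane (hw : w ∈ τ.stripe d) :
    (τ.len d : ℂ) - τ.stripeCoord d w ∈ slitPlane := by
  refine mem_slitPlane_iff.2 (Or.inl ?_)
  rw [sub_re, ofReal_re]
  linarith [(mem_stripe_iff.1 hw).2.2]

theorem transition_mem_stripe (hw : w ∈ τ.stripe d) :
    τ.transition d w ∈ τ.stripe (τ.inv d) := by
  have h := mem_stripe_iff.1 hw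
  rw [mem_stripe_iff, stripeCoord_transition, τ.len_inv, sub_re, ofReal_re]
  exact ⟨param_mem_wedge (len_sub_mem_slitPlane hw), by linarith [h.2.2], by linarith [h.2.1]⟩

theorem transition_transition (hw : w ∈ τ.stripe d) :
    τ.transition (τ.inv d) (τ.transition d w) = w := by
  rw [transition_eq, stripeCoord_transition, τ.len_inv, sub_sub_cancel]
  simp only [τ.inv_inv]
  exact param_stripeCoord (mem_wedge_of_mem_stripe hw)

theorem hasDerivAt_transition (hw : w ∈ τ.stripe d) :
    HasDerivAt (τ.transition d) (-(τ.paramDeriv (τ.inv d) (τ.len d - τ.stripeCoord d w) /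
      τ.paramDeriv d (τ.stripeCoord d w))) w := by
  have h1 := (hasDerivAt_stripeCoord (mem_wedge_of_mem_stripe hw)).const_sub (τ.len d : ℂ)
  have h2 := HasDerivAt.comp w (hasDerivAt_param (d := τ.inv d) (len_sub_mem_slitPlane hw)) h1
  refine h2.congr_deriv ?_
  rw [div_eq_mul_inv, mul_neg]

theorem analyticAt_transition (hw : w ∈ τ.stripe d) : AnalyticAt ℂ (τ.transition d) w :=
  analyticAt_of_hasDerivAt (isOpen_stripe d) (fun _ h => hasDerivAt_transition h) hw

theorem hasDerivAt_cornerTransition (hw : w ∈ τ.wedge d) :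
    HasDerivAt (τ.cornerTransition d) (2 * Real.pi * I / (τ.perimeter (τ.bdry d) : ℂ) *
      τ.cornerTransition d w / τ.paramDeriv d (τ.stripeCoord d w)) w := by
  have h1 := ((((hasDerivAt_stripeCoord hw).const_add (τ.offset d : ℂ))).const_mul
    (2 * Real.pi * I / (τ.perimeter (τ.bdry d) : ℂ))).cexp
  refine h1.congr_deriv ?_
  rw [cornerTransition]
  ring

theorem analyticAt_cornerTransition (hw : w ∈ τ.wedge d) :
    AnalyticAt ℂ (τ.cornerTransition d) w :=
  analyticAt_of_hasDerivAt (isOpen_wedge d) (fun _ h => hasDerivAt_cornerTransition h) hw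

theorem cornerTransition_ne_zero (d : τ.Dart) (w : ℂ) : τ.cornerTransition d w ≠ 0 :=
  exp_ne_zero _

theorem norm_cornerTransition (d : τ.Dart) (w : ℂ) : ‖τ.cornerTransition d w‖ =
    Real.exp (-(2 * Real.pi / τ.perimeter (τ.bdry d) * (τ.stripeCoord d w).im)) := by
  have : 2 * Real.pi * I / (τ.perimeter (τ.bdry d) : ℂ) =
      ((2 * Real.pi / τ.perimeter (τ.bdry d) : ℝ) : ℂ) * I := by push_cast; ring
  rw [cornerTransition, norm_exp, this, mul_assoc, re_ofReal_mul, I_mul_re, add_im, ofReal_im,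
    zero_add, mul_neg]

theorem cornerTransition_mem_ball_iff [Finite V] (d : τ.Dart) (w : ℂ) :
    τ.cornerTransition d w ∈ Metric.ball (0 : ℂ) 1 ↔ 0 < (τ.stripeCoord d w).im := by
  have ha := τ.perimeter_pos (τ.bdry d)
  rw [mem_ball_zero_iff, norm_cornerTransition, Real.exp_lt_one_iff, neg_lt_zero]
  exact mul_pos_iff_of_pos_left (by positivity)

end MetricFatgraph

namespace MetricFatgraph

variable {V : Type*} (τ : MetricFatgraph V)

/-- The points `w` of `star v` and `w'` of `star v'` are identified in the surface. -/
def EdgeRel (v : V) (w : ℂ) (v' : V) (w' : ℂ) : Prop :=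
  (v = v' ∧ w = w') ∨
    ∃ d : τ.Dart, d.1 = v ∧ (τ.inv d).1 = v' ∧ w ∈ τ.stripe d ∧ w' = τ.transition d w

/-- The point `w` of `star v` and the point `y` of the disc around `p` are identified in the
surface. -/
def CornerRel (v : V) (w : ℂ) (p : τ.Puncture) (y : ℂ) : Prop :=
  ∃ d : τ.Dart, d.1 = v ∧ τ.bdry d = p ∧ w ∈ τ.corner d ∧ y = τ.cornerTransition d w

/-- The identifications of points of the patches, as an explicit relation. -/
def Related : τ.Patches → τ.Patches → Prop
  | .inl a, .inl b => τ.EdgeRel a.1 a.2 b.1 b.2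
  | .inl a, .inr b => τ.CornerRel a.1 a.2 b.1 b.2
  | .inr a, .inl b => τ.CornerRel b.1 b.2 a.1 a.2
  | .inr a, .inr b => a.1 = b.1 ∧ (a.2 : ℂ) = b.2

variable {τ} {d : τ.Dart} {w : ℂ} {v v' v'' : V} {w' w'' : ℂ} {p p' : τ.Puncture} {y y' : ℂ}

theorem EdgeRel.refl (v : V) (w : ℂ) : τ.EdgeRel v w v w := Or.inl ⟨rfl, rfl⟩

theorem edgeRel_transition (hw : w ∈ τ.stripe d) :
    τ.EdgeRel d.1 w (τ.inv d).1 (τ.transition d w) := Or.inr ⟨d, rfl, rfl, hw, rfl⟩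

theorem EdgeRel.symm (h : τ.EdgeRel v w v' w') : τ.EdgeRel v' w' v w := by
  rcases h with ⟨rfl, rfl⟩ | ⟨d, rfl, rfl, hw, rfl⟩
  · exact EdgeRel.refl _ _
  · exact Or.inr ⟨τ.inv d, rfl, by rw [τ.inv_inv], transition_mem_stripe hw,
      (transition_transition hw).symm⟩

theorem eq_of_mem_stripe {d e : τ.Dart} (hde : d.1 = e.1) (hd : w ∈ τ.stripe d)
    (he : w ∈ τ.stripe e) : d = e := by
  rw [mem_stripe_iff] at hd he
  exact eq_of_re_pos hde hd.1 he.1 hd.2.1 he.2.1.le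

theorem eq_of_mem_corner {d e : τ.Dart} (hde : d.1 = e.1) (hd : w ∈ τ.corner d)
    (he : w ∈ τ.corner e) : d = e := by
  rw [mem_corner_iff] at hd he
  exact eq_of_im_pos hde hd.1 he.1 hd.2.1 he.2.1.le

theorem eq_transition_of_mem_stripe {d e : τ.Dart} (hde : (τ.inv d).1 = e.1)
    (hd : w ∈ τ.stripe d) (he : τ.transition d w ∈ τ.stripe e) : e = τ.inv d :=
  (eq_of_mem_stripe hde (transition_mem_stripe hd) he).symm

theorem EdgeRel.trans (h : τ.EdgeRel v w v' w') (h' : τ.EdgeRel v' w' v'' w'') :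
    τ.EdgeRel v w v'' w'' := by
  rcases h with ⟨rfl, rfl⟩ | ⟨d, rfl, rfl, hw, rfl⟩
  · exact h'
  rcases h' with ⟨rfl, rfl⟩ | ⟨e, he, rfl, hw', rfl⟩
  · exact edgeRel_transition hw
  obtain rfl := eq_transition_of_mem_stripe he.symm hw hw'
  exact Or.inl ⟨by rw [τ.inv_inv], (transition_transition hw).symm⟩

theorem mem_corner_of_mem_stripe (hw : w ∈ τ.stripe d) (him : 0 < (τ.stripeCoord d w).im) :
    w ∈ τ.corner d := by
  rw [mem_stripe_iff] at hw
  exact mem_corner_iff.2 ⟨hw.1, him, by linarith [τ.len_pos (τ.next d)], hw.2.2⟩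

theorem stripeCoord_bdryNext (hw : w ∈ τ.stripe d) (him : 0 < (τ.stripeCoord d w).im) :
    τ.transition d w ∈ τ.wedge (τ.bdryNext d) ∧
    τ.stripeCoord (τ.bdryNext d) (τ.transition d w) = τ.stripeCoord d w - τ.len d := by
  have h1 := mem_wedge_of_mem_stripe (transition_mem_stripe hw)
  have h2 := mem_wedge_prev h1 (by rw [stripeCoord_transition, sub_im, ofReal_im]; linarith)
  rwa [stripeCoord_transition, neg_sub] at h2

theorem transition_mem_corner (hw : w ∈ τ.stripe d) (him : 0 < (τ.stripeCoord d w).im) :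
    τ.transition d w ∈ τ.corner (τ.bdryNext d) := by
  obtain ⟨h1, h2⟩ := stripeCoord_bdryNext hw him
  have h3 := mem_stripe_iff.1 hw
  rw [mem_corner_iff, h2, τ.next_bdryNext, τ.len_inv, sub_re, sub_im, ofReal_re, ofReal_im]
  exact ⟨h1, by linarith, by linarith, by linarith [τ.len_pos (τ.bdryNext d)]⟩

theorem CornerRel.eq (h : τ.CornerRel v w p y) (h' : τ.CornerRel v w p' y') :
    p = p' ∧ y = y' := by
  obtain ⟨d, rfl, rfl, hw, rfl⟩ := h
  obtain ⟨e, he, rfl, hw', rfl⟩ := h'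
  obtain rfl := eq_of_mem_corner he hw' hw
  exact ⟨rfl, rfl⟩

theorem Related.refl (a : τ.Patches) : τ.Related a a := by
  rcases a with a | a
  · exact EdgeRel.refl _ _
  · exact ⟨rfl, rfl⟩

theorem Related.symm {a b : τ.Patches} (h : τ.Related a b) : τ.Related b a := by
  rcases a with a | a <;> rcases b with b | b
  · exact EdgeRel.symm h
  · exact h
  · exact h
  · exact ⟨h.1.symm, h.2.symm⟩

section Finite

variable [Finite V]

theorem exists_offset_bdryNext (d : τ.Dart) : ∃ k : ℤ,
    τ.offset d + τ.len d = τ.offset (τ.bdryNext d) + k * τ.perimeter (τ.bdry d) := by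
  by_cases h : τ.bdryNext d = (τ.bdry d).out
  · refine ⟨1, ?_⟩
    have h1 := τ.initialSum_add τ.len d h
    have h2 := τ.initialSum_out τ.len (τ.bdryNext d) (by rw [τ.bdry_bdryNext]; exact h)
    rw [offset_eq, offset_eq, h2, h1, zero_add, Int.cast_one, one_mul]
    rfl
  · exact ⟨0, by simp [offset_eq, τ.initialSum_bdryNext τ.len d h]⟩

theorem exp_eq_exp_of_add_mul {a : ℝ} (ha : a ≠ 0) {x x' : ℂ} :
    exp (2 * Real.pi * I / (a : ℂ) * x) = exp (2 * Real.pi * I / (a : ℂ) * x') ↔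
      ∃ k : ℤ, x = x' + k * a := by
  rw [exp_eq_exp_iff_exists_int]
  refine exists_congr fun k => ?_
  have ha' : (a : ℂ) ≠ 0 := ofReal_ne_zero.2 ha
  have hpi : (Real.pi : ℂ) ≠ 0 := ofReal_ne_zero.2 Real.pi_ne_zero
  have : (2 * Real.pi * I / (a : ℂ) * x' + k * (2 * Real.pi * I)) =
      2 * Real.pi * I / (a : ℂ) * (x' + k * a) := by field_simp
  rw [this]
  refine mul_right_inj' ?_
  exact div_ne_zero (mul_ne_zero (mul_ne_zero two_ne_zero hpi) I_ne_zero) ha'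

theorem cornerTransition_transition (hw : w ∈ τ.stripe d) (him : 0 < (τ.stripeCoord d w).im) :
    τ.cornerTransition (τ.bdryNext d) (τ.transition d w) = τ.cornerTransition d w := by
  obtain ⟨h1, h2⟩ := stripeCoord_bdryNext hw him
  obtain ⟨k, hk⟩ := exists_offset_bdryNext d
  rw [cornerTransition, cornerTransition, h2, τ.bdry_bdryNext,
    exp_eq_exp_of_add_mul (τ.perimeter_pos _).ne']
  refine ⟨-k, ?_⟩
  have hk' : (τ.offset d : ℂ) + τ.len d =
      τ.offset (τ.bdryNext d) + k * τ.perimeter (τ.bdry d) := by exact_mod_cast hk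
  push_cast
  linear_combination -hk'

theorem cornerRel_transition (hw : w ∈ τ.stripe d) (him : 0 < (τ.stripeCoord d w).im) :
    τ.CornerRel (τ.inv d).1 (τ.transition d w) (τ.bdry d) (τ.cornerTransition d w) :=
  ⟨τ.bdryNext d, rfl, τ.bdry_bdryNext d, transition_mem_corner hw him,
    (cornerTransition_transition hw him).symm⟩

theorem EdgeRel.cornerRel (h : τ.EdgeRel v w v' w') (h' : τ.CornerRel v' w' p y) :
    τ.CornerRel v w p y := by
  rcases h with ⟨rfl, rfl⟩ | ⟨d, rfl, rfl, hw, rfl⟩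
  · exact h'
  obtain ⟨e, he, rfl, hw', rfl⟩ := h'
  have hs := transition_mem_stripe hw
  have hwd := mem_wedge_of_mem_stripe hs
  have hce := mem_corner_iff.1 hw'
  rcases le_or_gt 0 (τ.stripeCoord (τ.inv d) (τ.transition d w)).im with him | him
  · obtain rfl := eq_of_im_pos he hce.1 hwd hce.2.1 him
    have := cornerRel_transition hs hce.2.1
    simp only [transition_transition hw, τ.inv_inv] at this
    exact this
  · obtain ⟨h1, h2⟩ := mem_wedge_prev hwd him
    obtain rfl := eq_of_im_pos (e := τ.bdryNext d) he hce.1 h1 hce.2.1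
      (by change 0 ≤ (τ.stripeCoord (τ.next.symm (τ.inv d)) _).im
          rw [h2, neg_im]; linarith)
    have him' : 0 < (τ.stripeCoord d w).im := by
      rw [stripeCoord_transition, sub_im, ofReal_im] at him
      linarith
    exact ⟨d, rfl, (τ.bdry_bdryNext d).symm, mem_corner_of_mem_stripe hw him',
      cornerTransition_transition hw him'⟩

/-- Every point of a corner is identified with a point in the corner of a unique directed edge
which projects to this edge. -/
theorem CornerRel.exists_normal (h : τ.CornerRel v w p y) : ∃ (d : τ.Dart) (w' : ℂ),
    τ.bdry d = p ∧ w' ∈ τ.corner d ∧ 0 ≤ (τ.stripeCoord d w').re ∧ y = τ.cornerTransition d w' ∧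
      τ.EdgeRel v w d.1 w' := by
  obtain ⟨d, rfl, rfl, hw, rfl⟩ := h
  rcases le_or_gt 0 (τ.stripeCoord d w).re with hre | hre
  · exact ⟨d, w, rfl, hw, hre, rfl, EdgeRel.refl _ _⟩
  · have hc := mem_corner_iff.1 hw
    obtain ⟨h1, h2⟩ := mem_wedge_next hc.1 hc.2.1
    have hs : w ∈ τ.stripe (τ.next d) := by
      rw [mem_stripe_iff, h2, neg_re]
      exact ⟨h1, by linarith, by linarith [hc.2.2.1]⟩
    have hs' := transition_mem_stripe hs
    have him : 0 < (τ.stripeCoord (τ.inv (τ.next d)) (τ.transition (τ.next d) w)).im := by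
      rw [stripeCoord_transition, h2, sub_im, ofReal_im, neg_im]
      linarith [hc.2.1]
    have hb : τ.bdryNext (τ.inv (τ.next d)) = d := by
      rw [τ.bdryNext_apply, τ.inv_inv, Equiv.symm_apply_apply]
    have h3 := cornerTransition_transition hs' him
    rw [hb, transition_transition hs] at h3
    refine ⟨τ.inv (τ.next d), τ.transition (τ.next d) w, ?_, mem_corner_of_mem_stripe hs' him,
      (mem_stripe_iff.1 hs').2.1.le, h3, edgeRel_transition hs⟩
    rw [← τ.bdry_bdryNext, hb]

theorem CornerRel.edgeRel (h : τ.CornerRel v w p y) (h' : τ.CornerRel v' w' p y) :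
    τ.EdgeRel v w v' w' := by
  obtain ⟨d, u, rfl, hu, hre, rfl, he⟩ := h.exists_normal
  obtain ⟨d', u', hb, hu', hre', hy, he'⟩ := h'.exists_normal
  rw [cornerTransition, cornerTransition, hb,
    exp_eq_exp_of_add_mul (τ.perimeter_pos _).ne'] at hy
  obtain ⟨k, hk⟩ := hy
  have hkr := congrArg Complex.re hk
  have hki := congrArg Complex.im hk
  have e1 : ((k : ℂ) * (τ.perimeter (τ.bdry d) : ℂ)) =
    ((k * τ.perimeter (τ.bdry d) : ℝ) : ℂ) := by push_cast; rfl
  rw [e1] at hkr hki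
  simp only [add_re, add_im, ofReal_re, ofReal_im, zero_add, add_zero] at hkr hki
  have hc := (mem_corner_iff.1 hu).2.2.2
  have hc' := (mem_corner_iff.1 hu').2.2.2
  obtain ⟨rfl, hx⟩ := eq_of_offset_le τ hb (x := τ.offset d' + (τ.stripeCoord d' u').re)
    (y := τ.offset d + (τ.stripeCoord d u).re) (k := k) (by rw [hb]; exact hkr)
    (by linarith) (by linarith) (by linarith) (by linarith)
  have hz : τ.stripeCoord d' u = τ.stripeCoord d' u' := Complex.ext (by linarith) hki
  have huu : u = u' := by
    rw [← param_stripeCoord (mem_wedge_of_mem_corner hu), hz,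
      param_stripeCoord (mem_wedge_of_mem_corner hu')]
  subst huu
  exact he.trans he'.symm

theorem exists_cornerRel (p : τ.Puncture) (hy : y ∈ Metric.ball (0 : ℂ) 1) (hy0 : y ≠ 0) :
    ∃ v, ∃ w ∈ τ.star v, τ.CornerRel v w p y := by
  have ha := τ.perimeter_pos p
  have ha' : (τ.perimeter p : ℂ) ≠ 0 := ofReal_ne_zero.2 ha.ne'
  have hpi : (Real.pi : ℂ) ≠ 0 := ofReal_ne_zero.2 Real.pi_ne_zero
  set ζ : ℂ := τ.perimeter p / (2 * Real.pi * I) * log y with hζ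
  have hyζ : y = exp (2 * Real.pi * I / (τ.perimeter p : ℂ) * ζ) := by
    have : 2 * Real.pi * I / (τ.perimeter p : ℂ) * ζ = log y := by
      rw [hζ]; field_simp [I_ne_zero]
    rw [this, exp_log hy0]
  obtain ⟨d, k, rfl, h1, h2⟩ := τ.exists_offset_le p ζ.re
  set z : ℂ := ζ + k * τ.perimeter (τ.bdry d) - τ.offset d with hz
  have e1 : ((k : ℂ) * (τ.perimeter (τ.bdry d) : ℂ)) =
    ((k * τ.perimeter (τ.bdry d) : ℝ) : ℂ) := by push_cast; rfl
  have hzre : z.re = ζ.re + k * τ.perimeter (τ.bdry d) - τ.offset d := by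
    rw [hz, e1]; simp only [sub_re, add_re, ofReal_re]
  have hYz : τ.cornerTransition d (τ.param d z) = y := by
    rw [cornerTransition, stripeCoord_param, hyζ, exp_eq_exp_of_add_mul ha.ne']
    exact ⟨k, by rw [hz]; ring⟩
  have him : 0 < z.im := by
    rw [← hYz, cornerTransition_mem_ball_iff, stripeCoord_param] at hy
    exact hy
  have hc : τ.param d z ∈ τ.corner d := by
    rw [mem_corner_iff, stripeCoord_param]
    have := τ.len_pos (τ.next d)
    exact ⟨param_mem_wedge (mem_slitPlane_iff.2 (Or.inr him.ne')), him, by linarith, by linarith⟩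
  exact ⟨d.1, τ.param d z, hc.1, d, rfl, rfl, hc, hYz.symm⟩

theorem Related.trans {a b c : τ.Patches} (h : τ.Related a b) (h' : τ.Related b c) :
    τ.Related a c := by
  rcases a with a | ⟨p, y⟩ <;> rcases b with b | ⟨q, t⟩ <;> rcases c with c | ⟨s, u⟩
  · exact EdgeRel.trans h h'
  · exact EdgeRel.cornerRel h h'
  · exact CornerRel.edgeRel h h'
  · obtain ⟨rfl, hx⟩ : q = s ∧ (t : ℂ) = u := h'
    change τ.CornerRel _ _ _ _ at h ⊢
    exact hx ▸ h
  · exact EdgeRel.cornerRel (EdgeRel.symm h') h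
  · exact CornerRel.eq h h'
  · obtain ⟨rfl, hx⟩ : p = q ∧ (y : ℂ) = t := h
    change τ.CornerRel _ _ _ _ at h' ⊢
    exact hx ▸ h'
  · exact ⟨h.1.trans h'.1, h.2.trans h'.2⟩

theorem quot_mk_eq_iff {a b : τ.Patches} :
    (Quot.mk τ.Glue a : τ.Surface) = Quot.mk τ.Glue b ↔ τ.Related a b := by
  constructor
  · intro h
    replace h := Quot.eqvGen_exact h
    induction h with
    | rel _ _ h =>
      cases h with
      | edge d w hw hd hw' => exact edgeRel_transition hd
      | corner d w hw hd hy => exact ⟨d, rfl, rfl, hd, rfl⟩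
    | refl => exact Related.refl _
    | symm _ _ _ ih => exact ih.symm
    | trans _ _ _ _ _ ih ih' => exact ih.trans ih'
  · have corner : ∀ (a : Σ v, τ.star v) (b : Σ _ : τ.Puncture, Metric.ball (0 : ℂ) 1),
        τ.CornerRel a.1 a.2 b.1 b.2 →
        (Quot.mk τ.Glue (.inl a) : τ.Surface) = Quot.mk τ.Glue (.inr b) := by
      rintro ⟨v, w, hw⟩ ⟨p, y, hy⟩ ⟨d, rfl, rfl, hd, hyd⟩
      dsimp only at hyd hd
      subst hyd
      exact Quot.sound (.corner d w hw hd hy)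
    intro h
    rcases a with ⟨v, w, hw⟩ | ⟨p, y, hy⟩ <;> rcases b with ⟨v', w', hw'⟩ | ⟨p', y', hy'⟩
    · rcases h with ⟨h1, h2⟩ | ⟨d, h1, h2, h3, h4⟩
      · dsimp only at h1 h2
        subst h1 h2
        rfl
      · dsimp only at h1 h2 h3 h4
        subst h1 h2 h4
        exact Quot.sound (.edge d w hw h3 hw')
    · exact corner _ _ h
    · exact (corner _ _ h).symm
    · obtain ⟨h1, h2⟩ := h
      dsimp only at h1 h2
      subst h1 h2
      rfl

theorem vertexChart_eq_iff (hw : w ∈ τ.star v) (hw' : w' ∈ τ.star v') :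
    τ.vertexChart v w = τ.vertexChart v' w' ↔ τ.EdgeRel v w v' w' := by
  rw [vertexChart, vertexChart, dif_pos hw, dif_pos hw']
  exact quot_mk_eq_iff

theorem vertexChart_eq_punctureChart_iff (hw : w ∈ τ.star v) (hy : y ∈ Metric.ball (0 : ℂ) 1) :
    τ.vertexChart v w = τ.punctureChart p y ↔ τ.CornerRel v w p y := by
  rw [vertexChart, punctureChart, dif_pos hw, dif_pos hy]
  exact quot_mk_eq_iff

theorem punctureChart_eq_iff (hy : y ∈ Metric.ball (0 : ℂ) 1) (hy' : y' ∈ Metric.ball (0 : ℂ) 1) :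
    τ.punctureChart p y = τ.punctureChart p' y' ↔ p = p' ∧ y = y' := by
  rw [punctureChart, punctureChart, dif_pos hy, dif_pos hy']
  exact quot_mk_eq_iff

end Finite

end MetricFatgraph

namespace MetricFatgraph

variable {V : Type*} (τ : MetricFatgraph V)

/-- The domains of all patches of the surface, at the vertices and at the punctures. -/
def patchDom : V ⊕ τ.Puncture → Set ℂ := Sum.elim τ.star fun _ => Metric.ball 0 1

/-- All patches of the surface, at the vertices and at the punctures. -/
noncomputable def patchChart : V ⊕ τ.Puncture → ℂ → τ.Surface :=
  Sum.elim τ.vertexChart τ.punctureChart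

theorem isOpen_surface_iff (hs : ∀ v, IsOpen (τ.star v)) (s : Set τ.Surface) :
    IsOpen s ↔ ∀ i, IsOpen (τ.patchDom i ∩ τ.patchChart i ⁻¹' s) := by
  have h1 : IsOpen s ↔ IsOpen ((Quot.mk τ.Glue : τ.Patches → τ.Surface) ⁻¹' s) :=
    isQuotientMap_quot_mk.isOpen_preimage.symm
  have sub : ∀ {U : Set ℂ} (_ : IsOpen U) (t : Set U) (t' : Set ℂ),
      (∀ x : U, x ∈ t ↔ (x : ℂ) ∈ t') → (IsOpen t ↔ IsOpen (U ∩ t')) := by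
    intro U hU t t' htt
    have : U ∩ t' = Subtype.val '' t := by
      ext x
      constructor
      · rintro ⟨hx, hx'⟩
        exact ⟨⟨x, hx⟩, (htt _).2 hx', rfl⟩
      · rintro ⟨x, hx, rfl⟩
        exact ⟨x.2, (htt _).1 hx⟩
    rw [this]
    exact hU.isOpenEmbedding_subtypeVal.isOpen_iff_image_isOpen
  rw [h1, isOpen_sum_iff, isOpen_sigma_iff, isOpen_sigma_iff, Sum.forall]
  refine and_congr (forall_congr' fun v => ?_) (forall_congr' fun p => ?_)
  · refine sub (hs v) _ _ fun x => ?_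
    simp only [Set.mem_preimage, patchChart, Sum.elim_inl, vertexChart, dif_pos x.2]
    rfl
  · refine sub Metric.isOpen_ball _ _ fun x => ?_
    simp only [Set.mem_preimage, patchChart, Sum.elim_inr, punctureChart, dif_pos x.2]
    rfl

theorem exists_patchChart_eq (x : τ.Surface) : ∃ i, ∃ u ∈ τ.patchDom i, τ.patchChart i u = x := by
  obtain ⟨⟨v, w, hw⟩ | ⟨p, y, hy⟩, rfl⟩ := Quot.exists_rep x
  · exact ⟨.inl v, w, hw, by simp only [patchChart, Sum.elim_inl, vertexChart, dif_pos hw]; rfl⟩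
  · exact ⟨.inr p, y, hy, by simp only [patchChart, Sum.elim_inr, punctureChart, dif_pos hy]; rfl⟩

variable {τ} {d : τ.Dart} {w : ℂ} {v v' v'' : V} {w' w'' : ℂ} {p p' : τ.Puncture} {y y' : ℂ}

theorem isClosed_edge (d : τ.Dart) : IsClosed {q : ℂ × ℂ | q.1 ∈ τ.closedWedge d ∧
    q.2 ∈ τ.closedWedge (τ.inv d) ∧ 0 ≤ (τ.stripeCoord d q.1).re ∧
    0 ≤ (τ.stripeCoord (τ.inv d) q.2).re ∧
    τ.stripeCoord d q.1 + τ.stripeCoord (τ.inv d) q.2 = τ.len d} := by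
  have hc : ContinuousOn (fun q : ℂ × ℂ => (τ.stripeCoord d q.1, τ.stripeCoord (τ.inv d) q.2))
      (τ.closedWedge d ×ˢ τ.closedWedge (τ.inv d)) :=
    ((continuousOn_stripeCoord d).comp continuousOn_fst fun _ h => h.1).prodMk
      ((continuousOn_stripeCoord (τ.inv d)).comp continuousOn_snd fun _ h => h.2)
  have hs : IsClosed {q : ℂ × ℂ | 0 ≤ q.1.re ∧ 0 ≤ q.2.re ∧ q.1 + q.2 = τ.len d} :=
    IsClosed.and (isClosed_le (by fun_prop) (by fun_prop))
      (IsClosed.and (isClosed_le (by fun_prop) (by fun_prop))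
        (isClosed_eq (by fun_prop) (by fun_prop)))
  convert hc.preimage_isClosed_of_isClosed
    ((isClosed_closedWedge d).prod (isClosed_closedWedge (τ.inv d))) hs using 1
  ext q
  exact and_assoc.symm

theorem isClosed_corner (d : τ.Dart) : IsClosed {q : ℂ × ℂ | q.1 ∈ τ.closedWedge d ∧
    0 ≤ (τ.stripeCoord d q.1).im ∧ τ.cornerTransition d q.1 = q.2} := by
  have hc : ContinuousOn (fun q : ℂ × ℂ => (τ.stripeCoord d q.1, q.2))
      (τ.closedWedge d ×ˢ Set.univ) :=
    ((continuousOn_stripeCoord d).comp continuousOn_fst fun _ h => h.1).prodMk continuousOn_snd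
  have hs : IsClosed {q : ℂ × ℂ | 0 ≤ q.1.im ∧
      exp (2 * Real.pi * I / (τ.perimeter (τ.bdry d) : ℂ) * ((τ.offset d : ℂ) + q.1)) = q.2} :=
    IsClosed.and (isClosed_le (by fun_prop) (by fun_prop))
      (isClosed_eq (by fun_prop) (by fun_prop))
  convert hc.preimage_isClosed_of_isClosed ((isClosed_closedWedge d).prod isClosed_univ) hs using 1
  ext q
  simp [cornerTransition]

theorem mem_edge_iff (hw : w ∈ τ.star d.1) (hw' : w' ∈ τ.star (τ.inv d).1) :
    (w ∈ τ.closedWedge d ∧ w' ∈ τ.closedWedge (τ.inv d) ∧ 0 ≤ (τ.stripeCoord d w).re ∧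
      0 ≤ (τ.stripeCoord (τ.inv d) w').re ∧
      τ.stripeCoord d w + τ.stripeCoord (τ.inv d) w' = τ.len d) ↔
    w ∈ τ.stripe d ∧ w' = τ.transition d w := by
  constructor
  · rintro ⟨h1, h2, h3, h4, h5⟩
    have hre := congrArg Complex.re h5
    rw [add_re, ofReal_re] at hre
    have key : ∀ {e : τ.Dart} {u : ℂ}, u ∈ τ.star e.1 → u ∈ τ.closedWedge e →
        0 ≤ (τ.stripeCoord e u).re → (τ.stripeCoord e u).re < τ.len e := by
      intro e u hu hc h0
      rcases h0.eq_or_lt with h | h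
      · rw [← h]; exact τ.len_pos e
      · exact (mem_star_iff (mem_wedge_of_mem_closedWedge hc (Or.inl h)) h0).1 hu
    have k1 := key hw h1 h3
    have k2 := key hw' h2 h4
    rw [τ.len_inv] at k2
    have m1 := mem_wedge_of_mem_closedWedge h1 (Or.inl (by linarith))
    have m2 := mem_wedge_of_mem_closedWedge h2 (Or.inl (by linarith))
    refine ⟨mem_stripe_iff.2 ⟨m1, by linarith, k1⟩, ?_⟩
    rw [transition_eq, ← h5, add_sub_cancel_left, param_stripeCoord m2]
  · rintro ⟨h1, rfl⟩
    have h2 := transition_mem_stripe h1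
    rw [mem_stripe_iff] at h1 h2
    exact ⟨wedge_subset_closedWedge _ h1.1, wedge_subset_closedWedge _ h2.1, h1.2.1.le, h2.2.1.le,
      by rw [stripeCoord_transition, add_sub_cancel]⟩

theorem mem_corner_edge_iff [Finite V] (hw : w ∈ τ.star d.1) (hy : y ∈ Metric.ball (0 : ℂ) 1) :
    (w ∈ τ.closedWedge d ∧ 0 ≤ (τ.stripeCoord d w).im ∧ τ.cornerTransition d w = y) ↔
    w ∈ τ.corner d ∧ y = τ.cornerTransition d w := by
  constructor
  · rintro ⟨h1, h2, rfl⟩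
    have h3 := (cornerTransition_mem_ball_iff d w).1 hy
    have h4 := mem_wedge_of_mem_closedWedge h1 (Or.inr h3.ne')
    exact ⟨⟨hw, (im_stripeCoord_pos h4).1 h3, (abs_lt.1 h4.2).2⟩, rfl⟩
  · rintro ⟨h1, rfl⟩
    rw [mem_corner_iff] at h1
    exact ⟨wedge_subset_closedWedge _ h1.1, h1.2.1.le, rfl⟩

section Finite

variable [Finite V]

theorem eventually_not_edge (hw : w ∈ τ.star v) (hw' : w' ∈ τ.star v')
    (h : ∀ d : τ.Dart, d.1 = v → (τ.inv d).1 = v' → w ∈ τ.stripe d → w' ≠ τ.transition d w) :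
    ∀ᶠ q in 𝓝 (w, w'), q.1 ∈ τ.star v → q.2 ∈ τ.star v' → ∀ d : τ.Dart, d.1 = v →
      (τ.inv d).1 = v' → q.1 ∈ τ.stripe d → q.2 ≠ τ.transition d q.1 := by
  have : ∀ d : τ.Dart, ∀ᶠ q in 𝓝 (w, w'), q.1 ∈ τ.star v → q.2 ∈ τ.star v' → d.1 = v →
      (τ.inv d).1 = v' → q.1 ∈ τ.stripe d → q.2 ≠ τ.transition d q.1 := by
    intro d
    by_cases hd : d.1 = v ∧ (τ.inv d).1 = v'
    · obtain ⟨rfl, rfl⟩ := hd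
      have hn : (w, w') ∉ {q : ℂ × ℂ | q.1 ∈ τ.closedWedge d ∧
          q.2 ∈ τ.closedWedge (τ.inv d) ∧ 0 ≤ (τ.stripeCoord d q.1).re ∧
          0 ≤ (τ.stripeCoord (τ.inv d) q.2).re ∧
          τ.stripeCoord d q.1 + τ.stripeCoord (τ.inv d) q.2 = τ.len d} := by
        intro hm
        obtain ⟨h1, h2⟩ := (mem_edge_iff hw hw').1 hm
        exact h d rfl rfl h1 h2
      filter_upwards [(isClosed_edge d).isOpen_compl.mem_nhds hn] with q hq h1 h2 _ _ h3 h4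
      exact hq ((mem_edge_iff h1 h2).2 ⟨h3, h4⟩)
    · exact Filter.Eventually.of_forall fun q _ _ h1 h2 => absurd ⟨h1, h2⟩ hd
  filter_upwards [Filter.eventually_all.2 this] with q hq h1 h2 d
  exact hq d h1 h2

theorem eventually_not_edgeRel (hw : w ∈ τ.star v) (hw' : w' ∈ τ.star v')
    (h : ¬ τ.EdgeRel v w v' w') :
    ∀ᶠ q in 𝓝 (w, w'), q.1 ∈ τ.star v → q.2 ∈ τ.star v' → ¬ τ.EdgeRel v q.1 v' q.2 := by
  have h1 : ∀ᶠ q : ℂ × ℂ in 𝓝 (w, w'), v = v' → q.1 ≠ q.2 := by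
    by_cases hv : v = v'
    · have hne : w ≠ w' := fun hww => h (Or.inl ⟨hv, hww⟩)
      filter_upwards [(isClosed_diagonal.isOpen_compl).mem_nhds (x := (w, w')) hne] with q hq _
      exact hq
    · exact Filter.Eventually.of_forall fun q h => absurd h hv
  filter_upwards [h1, eventually_not_edge hw hw' fun d hd hd' hs hs' =>
    h (Or.inr ⟨d, hd, hd', hs, hs'⟩)] with q hq hq' hq1 hq2
  rintro (⟨h2, h3⟩ | ⟨d, h2, h3, h4, h5⟩)
  · exact hq h2 h3
  · exact hq' hq1 hq2 d h2 h3 h4 h5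

theorem eventually_not_cornerRel (hw : w ∈ τ.star v) (hy : y ∈ Metric.ball (0 : ℂ) 1)
    (h : ¬ τ.CornerRel v w p y) :
    ∀ᶠ q in 𝓝 (w, y), q.1 ∈ τ.star v → q.2 ∈ Metric.ball (0 : ℂ) 1 →
      ¬ τ.CornerRel v q.1 p q.2 := by
  have : ∀ d : τ.Dart, ∀ᶠ q : ℂ × ℂ in 𝓝 (w, y), q.1 ∈ τ.star v → q.2 ∈ Metric.ball (0 : ℂ) 1 →
      ¬ (d.1 = v ∧ τ.bdry d = p ∧ q.1 ∈ τ.corner d ∧ q.2 = τ.cornerTransition d q.1) := by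
    intro d
    by_cases hd : d.1 = v ∧ τ.bdry d = p
    · obtain ⟨rfl, rfl⟩ := hd
      have hn : (w, y) ∉ {q : ℂ × ℂ | q.1 ∈ τ.closedWedge d ∧
          0 ≤ (τ.stripeCoord d q.1).im ∧ τ.cornerTransition d q.1 = q.2} := by
        intro hm
        obtain ⟨h1, h2⟩ := (mem_corner_edge_iff hw hy).1 hm
        exact h ⟨d, rfl, rfl, h1, h2⟩
      filter_upwards [(isClosed_corner d).isOpen_compl.mem_nhds hn] with q hq h1 h2 h3
      exact hq ((mem_corner_edge_iff h1 h2).2 h3.2.2)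
    · exact Filter.Eventually.of_forall fun q _ _ h => hd ⟨h.1, h.2.1⟩
  filter_upwards [Filter.eventually_all.2 this] with q hq h1 h2
  rintro ⟨d, hd⟩
  exact hq d h1 h2 hd

theorem exists_analyticAt_transition (i j : V ⊕ τ.Puncture) {x y : ℂ} (hx : x ∈ τ.patchDom i)
    (hy : y ∈ τ.patchDom j) (h : τ.patchChart i x = τ.patchChart j y) :
    ∃ f : ℂ → ℂ, AnalyticAt ℂ f x ∧ f x = y ∧
      ∀ᶠ u in 𝓝 x, τ.patchChart j (f u) = τ.patchChart i u := by
  rcases i with v | p <;> rcases j with v' | p'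
  · rcases (vertexChart_eq_iff hx hy).1 h with ⟨rfl, rfl⟩ | ⟨d, rfl, rfl, hs, rfl⟩
    · exact ⟨id, analyticAt_id, rfl, Filter.Eventually.of_forall fun _ => rfl⟩
    · refine ⟨τ.transition d, analyticAt_transition hs, rfl, ?_⟩
      filter_upwards [(isOpen_stripe d).mem_nhds hs] with u hu
      exact ((vertexChart_eq_iff (mem_star_of_mem_stripe hu)
        (mem_star_of_mem_stripe (transition_mem_stripe hu))).2 (edgeRel_transition hu)).symm
  · obtain ⟨d, rfl, rfl, hc, rfl⟩ := (vertexChart_eq_punctureChart_iff hx hy).1 h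
    refine ⟨τ.cornerTransition d, analyticAt_cornerTransition (mem_wedge_of_mem_corner hc), rfl, ?_⟩
    filter_upwards [(isOpen_corner d).mem_nhds hc] with u hu
    have hu' := (cornerTransition_mem_ball_iff d u).2 (mem_corner_iff.1 hu).2.1
    exact ((vertexChart_eq_punctureChart_iff hu.1 hu').2 ⟨d, rfl, rfl, hu, rfl⟩).symm
  · obtain ⟨d, rfl, rfl, hc, rfl⟩ := (vertexChart_eq_punctureChart_iff hy hx).1 h.symm
    have ha := (τ.perimeter_pos (τ.bdry d)).ne'
    set x := τ.cornerTransition d y with hx'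
    have hx0 : x ≠ 0 := cornerTransition_ne_zero _ _
    have hwd := mem_wedge_of_mem_corner hc
    set g : ℂ → ℂ := fun u => τ.stripeCoord d y +
      (τ.perimeter (τ.bdry d) : ℂ) / (2 * Real.pi * I) * log (u / x) with hg
    have hgx : g x = τ.stripeCoord d y := by simp [hg, hx0]
    have hga : AnalyticAt ℂ g x := by
      have : AnalyticAt ℂ (fun u : ℂ => log (u / x)) x :=
        (analyticAt_id.div analyticAt_const hx0).clog (by simp [hx0, one_mem_slitPlane])
      exact analyticAt_const.add (analyticAt_const.mul this)
    have hfa : AnalyticAt ℂ (fun u => τ.param d (g u)) x :=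
      AnalyticAt.fun_comp (by rw [hgx]; exact analyticAt_param (stripeCoord_mem_slitPlane hwd)) hga
    have hfx : τ.param d (g x) = y := by rw [hgx, param_stripeCoord hwd]
    refine ⟨fun u => τ.param d (g u), hfa, hfx, ?_⟩
    have h1 : ∀ᶠ u in 𝓝 x, τ.param d (g u) ∈ τ.corner d :=
      hfa.continuousAt.eventually_mem (by rw [hfx]; exact (isOpen_corner d).mem_nhds hc)
    filter_upwards [h1, isOpen_ne.mem_nhds hx0, Metric.isOpen_ball.mem_nhds hx] with u hu hu0 hub
    refine (vertexChart_eq_punctureChart_iff hu.1 hub).2 ⟨d, rfl, rfl, hu, ?_⟩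
    have hpi : (Real.pi : ℂ) ≠ 0 := ofReal_ne_zero.2 Real.pi_ne_zero
    have ha' : (τ.perimeter (τ.bdry d) : ℂ) ≠ 0 := ofReal_ne_zero.2 ha
    have e : 2 * Real.pi * I / (τ.perimeter (τ.bdry d) : ℂ) * ((τ.offset d : ℂ) + g u) =
        2 * Real.pi * I / (τ.perimeter (τ.bdry d) : ℂ) * ((τ.offset d : ℂ) + τ.stripeCoord d y) +
        log (u / x) := by
      rw [hg]; field_simp [I_ne_zero]; ring
    rw [cornerTransition, stripeCoord_param, e, Complex.exp_add,
      exp_log (div_ne_zero hu0 hx0)]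
    change u = x * (u / x)
    rw [mul_div_cancel₀ _ hx0]
  · obtain ⟨rfl, rfl⟩ := (punctureChart_eq_iff hx hy).1 h
    exact ⟨id, analyticAt_id, rfl, Filter.Eventually.of_forall fun _ => rfl⟩

variable (τ) in
theorem isHolomorphicGluing : IsHolomorphicGluing τ.patchDom τ.patchChart where
  isOpen_dom := by
    rintro (v | p)
    · exact τ.isOpen_star v
    · exact Metric.isOpen_ball
  isOpen_iff := τ.isOpen_surface_iff τ.isOpen_star
  cover := τ.exists_patchChart_eq
  transition := fun i j _ hx _ hy h => exists_analyticAt_transition i j hx hy h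
  injective := by
    rintro (v | p) x hx
    · have hd := (τ.isOpen_star v).mem_nhds hx
      have h1 := eventually_not_edge hx hx fun d hd hd' hs hs' => by
        have h2 := transition_mem_stripe hs
        rw [← hs'] at h2
        exact τ.inv_ne d (eq_of_mem_stripe (hd.trans hd'.symm) hs h2).symm
      filter_upwards [h1, prod_mem_nhds hd hd] with q hq hqs h
      rcases (vertexChart_eq_iff hqs.1 hqs.2).1 h with h | ⟨d, h2, h3, h4, h5⟩
      · exact h.2
      · exact absurd h5 (hq hqs.1 hqs.2 d h2 h3 h4)
    · have hd := (Metric.isOpen_ball (x := (0 : ℂ)) (ε := 1)).mem_nhds hx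
      filter_upwards [prod_mem_nhds hd hd] with q hqs h
      exact ((punctureChart_eq_iff hqs.1 hqs.2).1 h).2

instance : T2Space τ.Surface := by
  refine τ.isHolomorphicGluing.t2Space ?_
  rintro (v | p) (v' | p') x hx y hy h
  · filter_upwards [eventually_not_edgeRel hx hy fun h' => h ((vertexChart_eq_iff hx hy).2 h'),
      prod_mem_nhds ((τ.isOpen_star v).mem_nhds hx) ((τ.isOpen_star v').mem_nhds hy)] with q hq hqs
    exact fun h' => hq hqs.1 hqs.2 ((vertexChart_eq_iff hqs.1 hqs.2).1 h')
  · filter_upwards [eventually_not_cornerRel hx hy fun h' =>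
      h ((vertexChart_eq_punctureChart_iff hx hy).2 h'),
      prod_mem_nhds ((τ.isOpen_star v).mem_nhds hx) (Metric.isOpen_ball.mem_nhds hy)] with q hq hqs
    exact fun h' => hq hqs.1 hqs.2 ((vertexChart_eq_punctureChart_iff hqs.1 hqs.2).1 h')
  · have h1 := eventually_not_cornerRel hy hx fun h' =>
      h ((vertexChart_eq_punctureChart_iff hy hx).2 h').symm
    have h2 : Filter.Tendsto Prod.swap (𝓝 (x, y)) (𝓝 (y, x)) :=
      continuous_swap.tendsto (x, y)
    filter_upwards [h2.eventually h1,
      prod_mem_nhds (Metric.isOpen_ball.mem_nhds hx) ((τ.isOpen_star v').mem_nhds hy)] with q hq hqs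
    exact fun h' => hq hqs.2 hqs.1 ((vertexChart_eq_punctureChart_iff hqs.2 hqs.1).1 h'.symm)
  · have h0 : ¬ (p = p' ∧ x = y) := fun h' => h ((punctureChart_eq_iff hx hy).2 h')
    have h1 : ∀ᶠ q : ℂ × ℂ in 𝓝 (x, y), ¬ (p = p' ∧ q.1 = q.2) := by
      by_cases hp : p = p'
      · have hne : x ≠ y := fun hxy => h0 ⟨hp, hxy⟩
        filter_upwards [(isClosed_diagonal.isOpen_compl).mem_nhds (x := (x, y)) hne] with q hq hq'
        exact hq hq'.2
      · exact Filter.Eventually.of_forall fun q h => hp h.1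
    filter_upwards [h1, prod_mem_nhds (Metric.isOpen_ball.mem_nhds hx)
      (Metric.isOpen_ball.mem_nhds hy)] with q hq hqs
    exact fun h' => hq ((punctureChart_eq_iff hqs.1 hqs.2).1 h')

end Finite

end MetricFatgraph

namespace MetricFatgraph

variable {V : Type*} (τ : MetricFatgraph V)

variable {τ} {d : τ.Dart} {w z : ℂ} {v v' v'' : V} {w' w'' : ℂ} {p p' : τ.Puncture} {y y' : ℂ}

theorem mem_slitPlane_of_re_nonneg (hz : 0 ≤ z.re) (h0 : z ≠ 0) : z ∈ slitPlane := by
  rw [mem_slitPlane_iff]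
  by_contra! h
  exact h0 (Complex.ext (le_antisymm h.1 hz) h.2)

theorem continuousOn_param (d : τ.Dart) : ContinuousOn (τ.param d) {z | 0 ≤ z.re} := by
  intro z hz
  refine ContinuousAt.continuousWithinAt (continuousAt_const.mul ?_)
  rcases eq_or_ne z 0 with rfl | h0
  · have hm := τ.valence_pos d.1
    have hre : 0 < (2 / (τ.valence d.1 : ℂ)).re := by
      have : (2 / (τ.valence d.1 : ℂ)) = ((2 / τ.valence d.1 : ℝ) : ℂ) := by push_cast; rfl
      rw [this, ofReal_re]
      positivity
    exact ContinuousAt.comp (f := fun u : ℂ => (u, 2 / (τ.valence d.1 : ℂ)))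
      (continuousAt_cpow_zero_of_re_pos hre) (by fun_prop)
  · exact continuousAt_cpow_const (mem_slitPlane_of_re_nonneg hz h0)

theorem param_mem_star (h0 : 0 ≤ z.re) (h1 : z.re < τ.len d) : τ.param d z ∈ τ.star d.1 := by
  rcases eq_or_ne z 0 with rfl | hz
  · rw [param_zero]; exact τ.zero_mem_star _
  · exact (mem_star_iff (param_mem_wedge
      (mem_slitPlane_of_re_nonneg h0 hz)) (by rwa [stripeCoord_param])).2
        (by rwa [stripeCoord_param])

theorem exists_param_eq (hw : w ∈ τ.star v) : ∃ d : τ.Dart, d.1 = v ∧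
    0 ≤ (τ.stripeCoord d w).re ∧ (τ.stripeCoord d w).re < τ.len d ∧
      τ.param d (τ.stripeCoord d w) = w := by
  rcases eq_or_ne w 0 with rfl | h0
  · have hm : 0 < τ.valence v := by have := τ.three_le_valence v; omega
    refine ⟨⟨v, ⟨0, hm⟩⟩, rfl, ?_⟩
    rw [stripeCoord_zero, param_zero]
    exact ⟨le_rfl, τ.len_pos _, rfl⟩
  · obtain ⟨d, rfl, h1, h2⟩ := exists_mem_wedge (τ := τ) v h0
    exact ⟨d, rfl, h2, (mem_star_iff h1 h2).1 hw, param_stripeCoord h1⟩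

theorem mem_wedge_of_param_eq (h : τ.param d (τ.stripeCoord d w) = w)
    (h' : τ.stripeCoord d w ∈ slitPlane) : w ∈ τ.wedge d := by
  rw [← h]; exact param_mem_wedge h'

/-- Outside the cuspidal parts of the corners, every point of a star lies in half of a stripe. -/
theorem exists_mem_rectangle [Finite V] (hw : w ∈ τ.star v) :
    (∃ (d : τ.Dart), ∃ z ∈ Set.Icc 0 (τ.len d / 2) ×ℂ Set.Icc (-1) 1,
      τ.vertexChart d.1 (τ.param d z) = τ.vertexChart v w) ∨
    ∃ p, ∃ y ∈ Metric.closedBall (0 : ℂ) (Real.exp (-(2 * Real.pi / τ.perimeter p))),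
      τ.punctureChart p y = τ.vertexChart v w := by
  have cusp : ∀ d : τ.Dart, d.1 = v → w ∈ τ.corner d → 1 ≤ (τ.stripeCoord d w).im →
      ∃ p, ∃ y ∈ Metric.closedBall (0 : ℂ) (Real.exp (-(2 * Real.pi / τ.perimeter p))),
        τ.punctureChart p y = τ.vertexChart v w := by
    rintro d rfl hc him
    have ha := τ.perimeter_pos (τ.bdry d)
    refine ⟨τ.bdry d, τ.cornerTransition d w, ?_, ?_⟩
    · rw [mem_closedBall_zero_iff, norm_cornerTransition, Real.exp_le_exp, neg_le_neg_iff]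
      exact le_mul_of_one_le_right (by positivity) him
    · exact ((vertexChart_eq_punctureChart_iff hc.1
        ((cornerTransition_mem_ball_iff d w).2 (by linarith))).2 ⟨d, rfl, rfl, hc, rfl⟩).symm
  obtain ⟨d, rfl, h1, h2, h3⟩ := exists_param_eq hw
  rcases le_or_gt 1 (τ.stripeCoord d w).im with him | him
  · have hwd := mem_wedge_of_param_eq h3 (mem_slitPlane_iff.2 (Or.inr (by linarith)))
    exact Or.inr (cusp d rfl (mem_corner_iff.2
      ⟨hwd, by linarith, by linarith [τ.len_pos (τ.next d)], h2⟩) him)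
  rcases le_or_gt (τ.stripeCoord d w).im (-1) with him' | him'
  · have hwd := mem_wedge_of_param_eq h3 (mem_slitPlane_iff.2 (Or.inr (by linarith)))
    obtain ⟨h4, h5⟩ := mem_wedge_prev hwd (by linarith)
    refine Or.inr (cusp (τ.next.symm d) rfl (mem_corner_iff.2 ⟨h4, ?_⟩) ?_)
    · rw [h5, neg_re, neg_im, Equiv.apply_symm_apply]
      exact ⟨by linarith, by linarith, by linarith [τ.len_pos (τ.next.symm d)]⟩
    · rw [h5, neg_im]; linarith
  left
  rcases le_or_gt (τ.stripeCoord d w).re (τ.len d / 2) with hre | hre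
  · exact ⟨d, τ.stripeCoord d w, mem_reProdIm.2 ⟨⟨h1, hre⟩, him'.le, him.le⟩, by rw [h3]⟩
  · have hl := τ.len_pos d
    have hwd := mem_wedge_of_param_eq h3 (mem_slitPlane_iff.2 (Or.inl (by linarith)))
    have hs : w ∈ τ.stripe d := mem_stripe_iff.2 ⟨hwd, by linarith, h2⟩
    refine ⟨τ.inv d, τ.len d - τ.stripeCoord d w, ?_, ?_⟩
    · rw [mem_reProdIm, sub_re, sub_im, ofReal_re, ofReal_im, τ.len_inv]
      exact ⟨⟨by linarith, by linarith⟩, by linarith, by linarith⟩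
    · exact ((vertexChart_eq_iff hw (mem_star_of_mem_stripe (transition_mem_stripe hs))).2
        (edgeRel_transition hs)).symm

section Finite

variable [Finite V]

theorem continuousOn_vertexChart (v : V) : ContinuousOn (τ.vertexChart v) (τ.star v) :=
  τ.isHolomorphicGluing.continuousOn (.inl v)

theorem continuousOn_punctureChart (p : τ.Puncture) :
    ContinuousOn (τ.punctureChart p) (Metric.ball 0 1) :=
  τ.isHolomorphicGluing.continuousOn (.inr p)

theorem iUnion_vertexChart : (⋃ v, τ.vertexChart v '' τ.star v) = τ.puncturesᶜ := by
  have h00 : (0 : ℂ) ∈ Metric.ball (0 : ℂ) 1 := Metric.mem_ball_self one_pos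
  ext x
  simp only [Set.mem_iUnion, Set.mem_compl_iff]
  constructor
  · rintro ⟨v, w, hw, rfl⟩ ⟨p, hp⟩
    obtain ⟨d, -, -, -, h⟩ := (vertexChart_eq_punctureChart_iff hw h00).1 hp.symm
    exact cornerTransition_ne_zero _ _ h.symm
  · intro hx
    obtain ⟨v | p, u, hu, rfl⟩ := τ.exists_patchChart_eq x
    · exact ⟨v, u, hu, rfl⟩
    · have hu0 : u ≠ 0 := by
        rintro rfl
        exact hx ⟨p, rfl⟩
      obtain ⟨v, w, hw, h⟩ := exists_cornerRel p hu hu0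
      exact ⟨v, w, hw, (vertexChart_eq_punctureChart_iff hw hu).2 h⟩

instance : CompactSpace τ.Surface := by
  have hr : ∀ p : τ.Puncture, Metric.closedBall (0 : ℂ) (Real.exp (-(2 * Real.pi / τ.perimeter p)))
      ⊆ Metric.ball 0 1 := fun p => by
    have ha := τ.perimeter_pos p
    refine Metric.closedBall_subset_ball ?_
    rw [Real.exp_lt_one_iff, neg_lt_zero]
    positivity
  have hrect : ∀ d : τ.Dart, Set.MapsTo (τ.param d)
      (Set.Icc 0 (τ.len d / 2) ×ℂ Set.Icc (-1) 1) (τ.star d.1) := by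
    intro d z hz
    rw [mem_reProdIm] at hz
    exact param_mem_star hz.1.1 (by linarith [hz.1.2, τ.len_pos d])
  have hK : IsCompact ((⋃ d : τ.Dart, (fun z => τ.vertexChart d.1 (τ.param d z)) ''
      (Set.Icc 0 (τ.len d / 2) ×ℂ Set.Icc (-1) 1)) ∪
      ⋃ p : τ.Puncture, τ.punctureChart p ''
        Metric.closedBall (0 : ℂ) (Real.exp (-(2 * Real.pi / τ.perimeter p)))) := by
    refine IsCompact.union (isCompact_iUnion fun d => ?_) (isCompact_iUnion fun p => ?_)
    · refine (isCompact_Icc.reProdIm isCompact_Icc).image_of_continuousOn ?_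
      exact (continuousOn_vertexChart d.1).comp
        ((continuousOn_param d).mono fun z hz => (mem_reProdIm.1 hz).1.1) (hrect d)
    · exact (isCompact_closedBall _ _).image_of_continuousOn
        ((continuousOn_punctureChart p).mono (hr p))
  refine ⟨?_⟩
  convert hK
  refine (Set.eq_univ_of_forall fun x => ?_).symm
  have vertex : ∀ v, ∀ w ∈ τ.star v, τ.vertexChart v w ∈
      ((⋃ d : τ.Dart, (fun z => τ.vertexChart d.1 (τ.param d z)) ''
      (Set.Icc 0 (τ.len d / 2) ×ℂ Set.Icc (-1) 1)) ∪
      ⋃ p : τ.Puncture, τ.punctureChart p ''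
        Metric.closedBall (0 : ℂ) (Real.exp (-(2 * Real.pi / τ.perimeter p)))) := by
    intro v w hw
    rcases exists_mem_rectangle hw with ⟨d, z, hz, h⟩ | ⟨p, y, hy, h⟩
    · exact Or.inl (Set.mem_iUnion.2 ⟨d, z, hz, h⟩)
    · exact Or.inr (Set.mem_iUnion.2 ⟨p, y, hy, h⟩)
  obtain ⟨v | p, u, hu, rfl⟩ := τ.exists_patchChart_eq x
  · exact vertex v u hu
  · rcases eq_or_ne u 0 with rfl | hu0
    · exact Or.inr (Set.mem_iUnion.2 ⟨p, 0, Metric.mem_closedBall_self (Real.exp_pos _).le, rfl⟩)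
    · obtain ⟨v, w, hw, h⟩ := exists_cornerRel p hu hu0
      have h2 := (vertexChart_eq_punctureChart_iff hw hu).2 h
      change τ.punctureChart p u ∈ _
      rw [← h2]
      exact vertex v w hw

instance : ConnectedSpace τ.Surface := by
  have hpre : ∀ i, IsPreconnected (τ.patchChart i '' τ.patchDom i) := by
    intro i
    refine IsPreconnected.image ?_ _ (τ.isHolomorphicGluing.continuousOn i)
    rcases i with v | p
    · exact isPreconnected_star v
    · exact (convex_ball (0 : ℂ) 1).isPreconnected
  let R : V ⊕ τ.Puncture → V ⊕ τ.Puncture → Prop := fun i j =>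
    (τ.patchChart i '' τ.patchDom i ∩ τ.patchChart j '' τ.patchDom j).Nonempty
  have hsymm : Std.Symm R := ⟨fun i j h => by
    simp only [R] at h ⊢
    rwa [Set.inter_comm]⟩
  have hVV : ∀ v v', Relation.ReflTransGen R (.inl v) (.inl v') := by
    intro v v'
    refine Relation.ReflTransGen.lift (p := R) Sum.inl ?_ v v' (τ.connected v v')
    rintro a b ⟨j, rfl⟩
    have hl := τ.len_pos ⟨a, j⟩
    have hs : τ.param ⟨a, j⟩ ((τ.len ⟨a, j⟩ / 2 : ℝ) : ℂ) ∈ τ.stripe ⟨a, j⟩ := by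
      rw [mem_stripe_iff, stripeCoord_param, ofReal_re]
      exact ⟨param_mem_wedge (ofReal_mem_slitPlane.2 (by linarith)), by linarith, by linarith⟩
    have hs' := mem_star_of_mem_stripe (transition_mem_stripe hs)
    exact ⟨_, ⟨_, mem_star_of_mem_stripe hs, rfl⟩, ⟨_, hs',
      ((vertexChart_eq_iff (mem_star_of_mem_stripe hs) hs').2 (edgeRel_transition hs)).symm⟩⟩
  have hPV : ∀ p, ∃ v, R (.inl v) (.inr p) := by
    intro p
    have h2 : (1 / 2 : ℂ) ∈ Metric.ball (0 : ℂ) 1 := by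
      rw [mem_ball_zero_iff]; norm_num
    obtain ⟨v, w, hw, h⟩ := exists_cornerRel p h2 (by norm_num)
    exact ⟨v, _, ⟨w, hw, rfl⟩, ⟨_, h2, ((vertexChart_eq_punctureChart_iff hw h2).2 h).symm⟩⟩
  have hall : ∀ i, ∃ v, Relation.ReflTransGen R (.inl v) i := by
    rintro (v | p)
    · exact ⟨v, Relation.ReflTransGen.refl⟩
    · obtain ⟨v, hv⟩ := hPV p
      exact ⟨v, Relation.ReflTransGen.single hv⟩
  have hconn : ∀ i j, Relation.ReflTransGen R i j := by
    intro i j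
    obtain ⟨v, hv⟩ := hall i
    obtain ⟨v', hv'⟩ := hall j
    exact ((Std.Symm.symm (r := Relation.ReflTransGen R) _ _ hv).trans (hVV v v')).trans hv'
  have hU : (⋃ i, τ.patchChart i '' τ.patchDom i) = Set.univ :=
    Set.eq_univ_of_forall fun x => by
      obtain ⟨i, u, hu, rfl⟩ := τ.exists_patchChart_eq x
      exact Set.mem_iUnion.2 ⟨i, u, hu, rfl⟩
  have hp := IsPreconnected.iUnion_of_reflTransGen hpre hconn
  rw [hU] at hp
  obtain ⟨v⟩ := τ.nonempty
  exact { isPreconnected_univ := hp, toNonempty := ⟨τ.vertexChart v 0⟩ }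

variable (τ) in
theorem exists_chartedSpace_surface : ∃ _ : ChartedSpace ℂ τ.Surface,
    IsCompactRiemannSurface τ.Surface ∧
    (∀ v, IsLocalDiffeomorphOn 𝓘(ℂ) 𝓘(ℂ) ω (τ.vertexChart v) (τ.star v)) ∧
    ∀ p, IsLocalDiffeomorphOn 𝓘(ℂ) 𝓘(ℂ) ω (τ.punctureChart p) (Metric.ball 0 1) := by
  obtain ⟨C, h1, h2⟩ := τ.isHolomorphicGluing.exists_chartedSpace
  exact ⟨C, ⟨h1, inferInstance, inferInstance, inferInstance⟩, fun v => h2 (.inl v),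
    fun p => h2 (.inr p)⟩

end Finite

end MetricFatgraph

theorem superD_inr (h g : ℂ → ℂ) (w : ℂ) :
    superD h (fun u => TrivSqZeroExt.inr (g u)) w = TrivSqZeroExt.inl (g w) := by
  simp [superD]

theorem preservesD_iff {h h' f g : ℂ → ℂ} {w : ℂ} :
    PreservesD h h' f g w ↔ h w * deriv f w = h' (f w) * g w ^ 2 ∧ g w ≠ 0 := by
  rw [PreservesD, superD_inr, TrivSqZeroExt.isUnit_inl_iff, isUnit_iff_ne_zero]
  refine and_congr_left fun _ => ?_
  have h1 : superD h (fun u => TrivSqZeroExt.inl (f u)) w =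
      TrivSqZeroExt.inr (h w * deriv f w) := by simp [superD]
  have h2 : (TrivSqZeroExt.inl (h' (f w)) * TrivSqZeroExt.inr (g w) * TrivSqZeroExt.inl (g w) :
      DualNumber ℂ) = TrivSqZeroExt.inr (h' (f w) * g w ^ 2) := by
    rw [TrivSqZeroExt.inl_mul_inr, TrivSqZeroExt.inr_mul_inl]
    congr 1
    simp only [smul_eq_mul, MulOpposite.smul_eq_mul_unop, MulOpposite.unop_op]
    ring
  rw [h1, h2]
  exact TrivSqZeroExt.inr_injective.eq_iff

namespace Fatgraph

variable {V : Type*} {τ : Fatgraph V}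

theorem Orientation.sign_sq (o : τ.Orientation) (d : τ.Dart) : o.sign d ^ 2 = 1 := by
  rw [sign]; split_ifs <;> norm_num

theorem Orientation.sign_ne_zero (o : τ.Orientation) (d : τ.Dart) : o.sign d ≠ 0 := by
  rw [sign]; split_ifs <;> norm_num

theorem Orientation.sign_inv (o : τ.Orientation) (d : τ.Dart) :
    o.sign (τ.inv d) = -o.sign d := by
  rw [sign, sign, o.pos_inv]
  cases o.pos d <;> simp

theorem Orientation.ext_sign {o o' : τ.Orientation} (h : ∀ d, o.sign d = o'.sign d) : o = o' := by
  ext d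
  have := h d
  rw [sign, sign] at this
  cases h1 : o.pos d <;> cases h2 : o'.pos d <;> simp [h1, h2] at this ⊢ <;> norm_num at this

open Classical in
theorem Orientation.sign_reflect (o : τ.Orientation) (v : V) (d : τ.Dart) :
    (o.reflect v).sign d = o.sign d * (if d.1 = v then -1 else 1) *
      (if (τ.inv d).1 = v then -1 else 1) := by
  rw [sign, sign, reflect]
  by_cases h1 : d.1 = v <;> by_cases h2 : (τ.inv d).1 = v <;> cases h3 : o.pos d <;> simp [h1, h2, h3]

open Classical in
theorem Orientation.equivalent_of_finset (s : Finset V) {o o' : τ.Orientation}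
    (h : ∀ d, o'.sign d = o.sign d * (if d.1 ∈ s then -1 else 1) *
      (if (τ.inv d).1 ∈ s then -1 else 1)) : o.Equivalent o' := by
  induction s using Finset.induction_on generalizing o with
  | empty =>
    obtain rfl : o = o' := Orientation.ext_sign fun d => by simp [h]
    exact Relation.ReflTransGen.refl
  | insert v s hv ih =>
    have h1 : (o.reflect v).Equivalent o' := by
      refine ih fun d => ?_
      have hi : ∀ u : V, (if u ∈ insert v s then (-1 : ℂ) else 1) =
          (if u = v then -1 else 1) * (if u ∈ s then -1 else 1) := by
        intro u
        by_cases hu : u = v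
        · subst hu; simp [hv]
        · simp [hu]
      rw [h, sign_reflect, hi, hi]
      ring
    exact Relation.ReflTransGen.head ⟨v, rfl⟩ h1

/-- Orientations are equivalent if and only if their signs differ by the coboundary of a function
on the vertices. -/
theorem Orientation.equivalent_iff [Finite V] {o o' : τ.Orientation} : o.Equivalent o' ↔
    ∃ E : V → ℂ, (∀ v, E v = 1 ∨ E v = -1) ∧
      ∀ d : τ.Dart, E (τ.inv d).1 * o.sign d = E d.1 * o'.sign d := by
  classical
  constructor
  · intro h
    induction h with
    | refl => exact ⟨fun _ => 1, fun _ => Or.inl rfl, fun _ => rfl⟩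
    | @tail b c _ hbc ih =>
      obtain ⟨E, hE, h⟩ := ih
      obtain ⟨v, rfl⟩ := hbc
      refine ⟨fun u => E u * (if u = v then -1 else 1), fun u => ?_, fun d => ?_⟩
      · rcases hE u with h | h <;> dsimp only <;> split_ifs <;> simp [h]
      · dsimp only
        rw [sign_reflect, mul_right_comm, h]
        split_ifs <;> ring
  · rintro ⟨E, hE, h⟩
    have hfin : {v | E v = -1}.Finite := Set.toFinite _
    refine equivalent_of_finset hfin.toFinset fun d => ?_
    have hi : ∀ u : V, (if u ∈ hfin.toFinset then (-1 : ℂ) else 1) = E u := by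
      intro u
      simp only [Set.Finite.mem_toFinset, Set.mem_ofPred_eq]
      rcases hE u with hu | hu <;> norm_num [hu]
    rw [hi, hi]
    have hd := h d
    have h2 : E d.1 * E d.1 = 1 := by rcases hE d.1 with hu | hu <;> norm_num [hu]
    linear_combination -o'.sign d * h2 - E d.1 * hd

end Fatgraph

namespace MetricFatgraph

variable {V : Type*} {τ : MetricFatgraph V} {r : τ.Dart → ℂ} {o o' : τ.Orientation}
  {d : τ.Dart} {w z : ℂ} {v v' v'' : V} {w' w'' : ℂ} {p p' : τ.Puncture} {y y' : ℂ}

theorem root_choice_ne_zero (hr : τ.IsRootChoice r) (d : τ.Dart) : r d ≠ 0 := by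
  intro h
  have := hr d
  rw [h] at this
  exact τ.root_ne_zero d (by rw [← this]; norm_num)

theorem sqrtStripe_sq (hr : τ.IsRootChoice r) (d : τ.Dart) (hz : z ≠ 0) :
    τ.sqrtStripe r d z ^ 2 = τ.paramDeriv d z := by
  have hm := τ.valence_pos d.1
  have h1 : ((Real.sqrt (2 / τ.valence d.1) : ℝ) : ℂ) ^ 2 = 2 / (τ.valence d.1 : ℂ) := by
    rw [← ofReal_pow, Real.sq_sqrt (by positivity)]
    push_cast
    rfl
  have h2 : (z ^ (1 / (τ.valence d.1 : ℂ) - 1 / 2)) ^ 2 = z ^ (2 / (τ.valence d.1 : ℂ) - 1) := by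
    rw [sq, ← cpow_add _ _ hz]
    congr 1
    ring
  rw [sqrtStripe, mul_pow, mul_pow, h1, h2, hr d, paramDeriv]

theorem sqrtStripe_ne_zero (hr : τ.IsRootChoice r) (d : τ.Dart) (hz : z ≠ 0) :
    τ.sqrtStripe r d z ≠ 0 := by
  intro h
  have := sqrtStripe_sq hr d hz
  rw [h, sq, zero_mul] at this
  exact paramDeriv_ne_zero d hz this.symm

theorem analyticAt_sqrtStripe (r : τ.Dart → ℂ) (d : τ.Dart) (hz : z ∈ slitPlane) :
    AnalyticAt ℂ (τ.sqrtStripe r d) z :=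
  analyticAt_const.mul (analyticAt_id.cpow analyticAt_const hz)

theorem len_sub_ne_zero (hw : w ∈ τ.stripe d) : (τ.len d : ℂ) - τ.stripeCoord d w ≠ 0 :=
  slitPlane_ne_zero (len_sub_mem_slitPlane hw)

theorem stripeCoord_ne_zero_of_mem_stripe (hw : w ∈ τ.stripe d) : τ.stripeCoord d w ≠ 0 :=
  stripeCoord_ne_zero hw.1

theorem hasDerivAt_transition_sqrtTransition (hr : τ.IsRootChoice r) (hw : w ∈ τ.stripe d) :
    HasDerivAt (τ.transition d) (τ.sqrtTransition r d w ^ 2) w := by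
  convert hasDerivAt_transition hw using 1
  rw [sqrtTransition, div_pow, mul_pow, I_sq, sqrtStripe_sq hr _ (len_sub_ne_zero hw),
    sqrtStripe_sq hr _ (stripeCoord_ne_zero_of_mem_stripe hw)]
  ring

theorem sqrtTransition_ne_zero (hr : τ.IsRootChoice r) (hw : w ∈ τ.stripe d) :
    τ.sqrtTransition r d w ≠ 0 :=
  div_ne_zero (mul_ne_zero I_ne_zero (sqrtStripe_ne_zero hr _ (len_sub_ne_zero hw)))
    (sqrtStripe_ne_zero hr _ (stripeCoord_ne_zero_of_mem_stripe hw))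

theorem analyticAt_sqrtTransition (hr : τ.IsRootChoice r) (hw : w ∈ τ.stripe d) :
    AnalyticAt ℂ (τ.sqrtTransition r d) w := by
  have hwd := mem_wedge_of_mem_stripe hw
  have h1 := analyticAt_stripeCoord hwd
  have h2 : AnalyticAt ℂ (fun u => (τ.len d : ℂ) - τ.stripeCoord d u) w := analyticAt_const.sub h1
  exact (analyticAt_const.mul
    (AnalyticAt.fun_comp (f := fun u => (τ.len d : ℂ) - τ.stripeCoord d u)
      (analyticAt_sqrtStripe r (τ.inv d) (len_sub_mem_slitPlane hw)) h2)).div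
    (AnalyticAt.fun_comp (f := τ.stripeCoord d) (analyticAt_sqrtStripe r d (stripeCoord_mem_slitPlane hwd)) h1)
    (sqrtStripe_ne_zero hr _ (stripeCoord_ne_zero_of_mem_stripe hw))

theorem sqrtTransition_inv_mul (hr : τ.IsRootChoice r) (hw : w ∈ τ.stripe d) :
    τ.sqrtTransition r (τ.inv d) (τ.transition d w) * τ.sqrtTransition r d w = -1 := by
  have h1 := sqrtStripe_ne_zero hr (τ.inv d) (len_sub_ne_zero hw)
  have h2 := sqrtStripe_ne_zero hr d (stripeCoord_ne_zero_of_mem_stripe hw)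
  rw [sqrtTransition, sqrtTransition, stripeCoord_transition, τ.len_inv, sub_sub_cancel]
  simp only [τ.inv_inv]
  field_simp
  exact I_sq

open Classical in
/-- The transition function of the odd coordinates at the vertices. -/
noncomputable def oddTransition (r : τ.Dart → ℂ) (o : τ.Orientation) (v v' : V) (w w' : ℂ) : ℂ :=
  if h : ∃ d : τ.Dart, d.1 = v ∧ (τ.inv d).1 = v' ∧ w ∈ τ.stripe d ∧ w' = τ.transition d w then
    o.sign h.choose * τ.sqrtTransition r h.choose w
  else 1

theorem oddTransition_transition (hw : w ∈ τ.stripe d) :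
    oddTransition r o d.1 (τ.inv d).1 w (τ.transition d w) = o.sign d * τ.sqrtTransition r d w := by
  have h : ∃ e : τ.Dart, e.1 = d.1 ∧ (τ.inv e).1 = (τ.inv d).1 ∧ w ∈ τ.stripe e ∧
      τ.transition d w = τ.transition e w := ⟨d, rfl, rfl, hw, rfl⟩
  have he : h.choose = d := eq_of_mem_stripe h.choose_spec.1 h.choose_spec.2.2.1 hw
  rw [oddTransition, dif_pos h, he]

theorem oddTransition_self (w : ℂ) : oddTransition r o v v w w = 1 := by
  rw [oddTransition, dif_neg]
  rintro ⟨d, h1, h2, h3, h4⟩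
  have h5 := transition_mem_stripe h3
  rw [← h4] at h5
  exact τ.inv_ne d (eq_of_mem_stripe (h1.trans h2.symm) h3 h5).symm

theorem oddTransition_mul (hr : τ.IsRootChoice r) (h : τ.EdgeRel v w v' w')
    (h' : τ.EdgeRel v' w' v'' w'') :
    oddTransition r o v v'' w w'' = oddTransition r o v' v'' w' w'' * oddTransition r o v v' w w' := by
  rcases h with ⟨rfl, rfl⟩ | ⟨d, rfl, rfl, hw, rfl⟩
  · rw [oddTransition_self, mul_one]
  rcases h' with ⟨rfl, rfl⟩ | ⟨e, he, rfl, hw', rfl⟩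
  · rw [oddTransition_self, one_mul]
  obtain rfl := eq_transition_of_mem_stripe he.symm hw hw'
  rw [oddTransition_transition hw, oddTransition_transition hw', transition_transition hw]
  have h1 : τ.inv (τ.inv d) = d := τ.inv_inv d
  rw [congrArg Sigma.fst h1, oddTransition_self]
  have h2 := sqrtTransition_inv_mul hr hw
  have h3 := o.sign_sq d
  rw [Fatgraph.Orientation.sign_inv]
  linear_combination o.sign d ^ 2 * h2 - h3

theorem oddTransition_ne_zero (hr : τ.IsRootChoice r) (h : τ.EdgeRel v w v' w') :
    oddTransition r o v v' w w' ≠ 0 := by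
  rcases h with ⟨rfl, rfl⟩ | ⟨d, rfl, rfl, hw, rfl⟩
  · rw [oddTransition_self]; exact one_ne_zero
  · rw [oddTransition_transition hw]
    exact mul_ne_zero (o.sign_ne_zero d) (sqrtTransition_ne_zero hr hw)

theorem Presents.isSuperTransition [ChartedSpace ℂ τ.Surface] {S : SplitSRS V τ.Surface τ.punctures}
    (h : τ.Presents r o S) (i j : V) :
    IsSuperTransition (τ.star i) (τ.vertexChart i) (fun _ => 1) (τ.star j) (τ.vertexChart j)
      (fun _ => 1) (S.odd i j) := by
  have := S.superconformal i j
  rwa [h.1, h.2.1] at this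

theorem Presents.odd_self [ChartedSpace ℂ τ.Surface] {S : SplitSRS V τ.Surface τ.punctures}
    (h : τ.Presents r o S) (hw : w ∈ τ.star v) : S.odd v v w w = 1 := by
  obtain ⟨f, -, -, -, -, h0, -⟩ := h.isSuperTransition v v w hw w hw rfl
  have hw' : w ∈ S.dom v := by rwa [h.1]
  have := S.cocycle v v v w hw' w hw' w hw' rfl rfl
  exact (mul_eq_left₀ h0).1 this.symm

theorem Presents.odd_eq [ChartedSpace ℂ τ.Surface] {S : SplitSRS V τ.Surface τ.punctures}
    (h : τ.Presents r o S) (hw : w ∈ τ.star v) (he : τ.EdgeRel v w v' w') :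
    S.odd v v' w w' = oddTransition r o v v' w w' := by
  rcases he with ⟨rfl, rfl⟩ | ⟨d, rfl, rfl, hw, rfl⟩
  · rw [h.odd_self hw, oddTransition_self]
  · rw [h.2.2 d w hw, oddTransition_transition hw]

section Finite

variable [Finite V]

theorem isSuperTransition_oddTransition (hr : τ.IsRootChoice r) (o : τ.Orientation) (v v' : V) :
    IsSuperTransition (τ.star v) (τ.vertexChart v) (fun _ => 1) (τ.star v') (τ.vertexChart v')
      (fun _ => 1) (oddTransition r o v v') := by
  intro w hw w' hw' h
  rcases (vertexChart_eq_iff hw hw').1 h with ⟨rfl, rfl⟩ | ⟨d, rfl, rfl, hs, rfl⟩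
  · refine ⟨id, analyticAt_id, rfl, Filter.Eventually.of_forall fun _ => rfl, ?_, ?_, ?_⟩
    · simp only [id, oddTransition_self]
      exact analyticAt_const
    · rw [oddTransition_self]; exact one_ne_zero
    · simp [preservesD_iff, oddTransition_self]
  · have hev : ∀ᶠ u in 𝓝 w, u ∈ τ.stripe d := (isOpen_stripe d).mem_nhds hs
    refine ⟨τ.transition d, analyticAt_transition hs, rfl, ?_, ?_,
      oddTransition_ne_zero hr (edgeRel_transition hs), ?_⟩
    · filter_upwards [hev] with u hu
      exact ((vertexChart_eq_iff (mem_star_of_mem_stripe hu)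
        (mem_star_of_mem_stripe (transition_mem_stripe hu))).2 (edgeRel_transition hu)).symm
    · have h1 : AnalyticAt ℂ (fun u => o.sign d * τ.sqrtTransition r d u) w :=
        analyticAt_const.mul (analyticAt_sqrtTransition hr hs)
      refine h1.congr ?_
      filter_upwards [hev] with u hu
      exact (oddTransition_transition hu).symm
    · rw [preservesD_iff, oddTransition_transition hs,
        (hasDerivAt_transition_sqrtTransition hr hs).deriv, mul_pow, o.sign_sq]
      exact ⟨by ring, mul_ne_zero (o.sign_ne_zero d) (sqrtTransition_ne_zero hr hs)⟩

variable [ChartedSpace ℂ τ.Surface]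

theorem exists_presents
    (hv : ∀ v, IsLocalDiffeomorphOn 𝓘(ℂ) 𝓘(ℂ) ω (τ.vertexChart v) (τ.star v))
    (hr : τ.IsRootChoice r) (o : τ.Orientation) :
    ∃ S : SplitSRS V τ.Surface τ.punctures, τ.Presents r o S := by
  refine ⟨{ dom := τ.star
            isOpen_dom := τ.isOpen_star
            chart := τ.vertexChart
            holomorphic_chart := hv
            cover := iUnion_vertexChart
            odd := oddTransition r o
            superconformal := isSuperTransition_oddTransition hr o
            cocycle := ?_ }, rfl, rfl, fun d w hw => oddTransition_transition hw⟩
  intro i j l x hx y hy z hz hxy hyz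
  exact oddTransition_mul hr ((vertexChart_eq_iff hx hy).1 hxy) ((vertexChart_eq_iff hy hz).1 hyz)

namespace Presents

variable {S S' : SplitSRS V τ.Surface τ.punctures}

theorem equivalent_of_isIso (hr : τ.IsRootChoice r) (h : τ.Presents r o S)
    (h' : τ.Presents r o' S') (hiso : S.IsIso S') : o.Equivalent o' := by
  obtain ⟨k, hk, hk1, hk2⟩ := hiso
  rw [h.1, h.2.1] at hk1 hk2
  rw [h'.1, h'.2.1] at hk1 hk2
  have hdiag : ∀ v, ∀ w ∈ τ.star v, ContinuousAt (fun u => k v v u u) w ∧ k v v w w ^ 2 = 1 := by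
    intro v w hw
    have hkv := hk v v
    rw [h.1, h.2.1, h'.1, h'.2.1] at hkv
    obtain ⟨f, hf, hfw, hfe, hka, -, hD⟩ := hkv w hw w hw rfl
    have hinj := τ.isHolomorphicGluing.injective (.inl v) w hw
    have hid : f =ᶠ[𝓝 w] id := by
      have ht : Filter.Tendsto (fun u => (f u, u)) (𝓝 w) (𝓝 (w, w)) := by
        have hc : Filter.Tendsto f (𝓝 w) (𝓝 w) := by
          have := hf.continuousAt.tendsto
          rwa [hfw] at this
        rw [nhds_prod_eq]
        exact hc.prodMk Filter.tendsto_id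
      filter_upwards [ht.eventually hinj, hfe] with u h1 h2
      exact h1 h2
    rw [preservesD_iff, hid.deriv_eq, deriv_id, hfw] at hD
    refine ⟨hka.continuousAt.congr ?_, by simpa using hD.1.symm⟩
    filter_upwards [hid] with u hu
    rw [hu, id]
  have hconst : ∀ v, ∃ E : ℂ, (E = 1 ∨ E = -1) ∧ ∀ w ∈ τ.star v, k v v w w = E := by
    intro v
    rcases (isPreconnected_star v).eq_one_or_eq_neg_one_of_sq_eq
      (f := fun u => k v v u u) (fun w hw => (hdiag v w hw).1.continuousWithinAt)
      (fun w hw => (hdiag v w hw).2) with h1 | h1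
    · exact ⟨1, Or.inl rfl, h1⟩
    · exact ⟨-1, Or.inr rfl, h1⟩
  choose E hE hkE using hconst
  refine Fatgraph.Orientation.equivalent_iff.2 ⟨E, hE, fun d => ?_⟩
  have hl := τ.len_pos d
  obtain ⟨w, hs⟩ : ∃ w, w ∈ τ.stripe d := by
    refine ⟨τ.param d ((τ.len d / 2 : ℝ) : ℂ), ?_⟩
    rw [mem_stripe_iff, stripeCoord_param, ofReal_re]
    exact ⟨param_mem_wedge (ofReal_mem_slitPlane.2 (by linarith)), by linarith, by linarith⟩
  have m1 := mem_star_of_mem_stripe hs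
  have m2 := mem_star_of_mem_stripe (transition_mem_stripe hs)
  have heq := (vertexChart_eq_iff m1 m2).2 (edgeRel_transition hs)
  have c1 := hk1 d.1 (τ.inv d).1 (τ.inv d).1 w m1 _ m2 _ m2 heq rfl
  have c2 := hk2 d.1 d.1 (τ.inv d).1 w m1 w m1 _ m2 rfl heq
  rw [c1, hkE _ _ m2, hkE _ _ m1, h.2.2 d w hs, h'.2.2 d w hs] at c2
  refine mul_right_cancel₀ (sqrtTransition_ne_zero hr hs) ?_
  linear_combination c2

theorem isIso_of_equivalent (hr : τ.IsRootChoice r) (h : τ.Presents r o S)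
    (h' : τ.Presents r o' S') (he : o.Equivalent o') : S.IsIso S' := by
  obtain ⟨E, hE, hd⟩ := Fatgraph.Orientation.equivalent_iff.1 he
  have hE2 : ∀ v, E v ^ 2 = 1 := fun v => by rcases hE v with h | h <;> norm_num [h]
  have hE0 : ∀ v, E v ≠ 0 := fun v => by rcases hE v with h | h <;> norm_num [h]
  refine ⟨fun i l x z => E i * S'.odd i l x z, ?_, ?_, ?_⟩
  · intro i l
    rw [h.1, h.2.1, h'.1, h'.2.1]
    intro w hw w' hw' hww
    obtain ⟨f, hf, hfw, hfe, hka, hk0, hD⟩ := h'.isSuperTransition i l w hw w' hw' hww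
    refine ⟨f, hf, hfw, hfe, analyticAt_const.mul hka, mul_ne_zero (hE0 i) hk0, ?_⟩
    rw [preservesD_iff] at hD ⊢
    rw [mul_pow, hE2]
    exact ⟨by linear_combination hD.1, mul_ne_zero (hE0 i) hD.2⟩
  · rw [h.1, h.2.1, h'.1, h'.2.1]
    intro i j l x hx y hy z hz hxy hyz
    have e1 := (vertexChart_eq_iff hx hy).1 hxy
    have e2 := (vertexChart_eq_iff hy hz).1 hyz
    dsimp only
    rw [h'.odd_eq hx (e1.trans e2), h'.odd_eq hy e2, h.odd_eq hx e1, oddTransition_mul hr e1 e2]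
    have key : E i * oddTransition r o' i j x y = E j * oddTransition r o i j x y := by
      rcases e1 with ⟨rfl, rfl⟩ | ⟨d, rfl, rfl, hw, rfl⟩
      · rw [oddTransition_self, oddTransition_self]
      · rw [oddTransition_transition hw, oddTransition_transition hw]
        linear_combination -τ.sqrtTransition r d x * hd d
    linear_combination oddTransition r o' j l y z * key
  · rw [h.1, h.2.1, h'.1, h'.2.1]
    intro i l n x hx z hz t ht hxz hzt
    have e1 := (vertexChart_eq_iff hx hz).1 hxz
    have e2 := (vertexChart_eq_iff hz ht).1 hzt
    dsimp only
    rw [h'.odd_eq hx (e1.trans e2), h'.odd_eq hz e2, h'.odd_eq hx e1, oddTransition_mul hr e1 e2]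
    ring

theorem isIso_iff (hr : τ.IsRootChoice r) (h : τ.Presents r o S) (h' : τ.Presents r o' S') :
    S.IsIso S' ↔ o.Equivalent o' :=
  ⟨h.equivalent_of_isIso hr h', h.isIso_of_equivalent hr h'⟩

end Presents

end Finite

end MetricFatgraph

namespace AnalyticAt

/-- A holomorphic function with non-zero derivative has a holomorphic local inverse. -/
theorem exists_local_rightInverse {f : ℂ → ℂ} {x : ℂ} (hf : AnalyticAt ℂ f x)
    (hf' : deriv f x ≠ 0) : ∃ g : ℂ → ℂ, AnalyticAt ℂ g (f x) ∧ g (f x) = x ∧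
      (∀ᶠ y in 𝓝 (f x), f (g y) = y) ∧ deriv g (f x) = (deriv f x)⁻¹ := by
  have hs := hf.hasStrictDerivAt
  refine ⟨hs.localInverse f _ _ hf', hf.analyticAt_localInverse hf', ?_, ?_, ?_⟩
  · exact HasStrictFDerivAt.localInverse_apply_image (hs.hasStrictFDerivAt_equiv hf')
  · exact HasStrictFDerivAt.eventually_right_inverse (hs.hasStrictFDerivAt_equiv hf')
  · exact (hs.to_localInverse hf').hasDerivAt.deriv

end AnalyticAt

/-- A holomorphic function with a simple zero is not the square of a function which is holomorphic
outside this zero. -/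
theorem deriv_eq_zero_of_eventually_sq {f g : ℂ → ℂ} {x : ℂ} (hf : AnalyticAt ℂ f x)
    (hx : f x = 0) (hg : ∀ᶠ u in 𝓝[≠] x, DifferentiableAt ℂ g u)
    (hfg : ∀ᶠ u in 𝓝 x, f u = g u ^ 2) : deriv f x = 0 := by
  have hgx : g x = 0 := by
    have := hfg.self_of_nhds
    rw [hx] at this
    exact pow_eq_zero_iff two_ne_zero |>.1 this.symm
  have hc : ContinuousAt g x := by
    have h1 : Filter.Tendsto (fun u => Real.sqrt ‖f u‖) (𝓝 x) (𝓝 0) := by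
      have := (Real.continuous_sqrt.comp continuous_norm).continuousAt.tendsto.comp
        hf.continuousAt.tendsto
      simpa [hx, Function.comp_def] using this
    have h2 : Filter.Tendsto (fun u => ‖g u‖) (𝓝 x) (𝓝 0) := by
      refine h1.congr' ?_
      filter_upwards [hfg] with u hu
      rw [hu, norm_pow, Real.sqrt_sq (norm_nonneg _)]
    rw [ContinuousAt, hgx]
    exact tendsto_zero_iff_norm_tendsto_zero.2 h2
  have hga := Complex.analyticAt_of_differentiable_on_punctured_nhds_of_continuousAt hg hc
  have h3 : f =ᶠ[𝓝 x] fun u => g u ^ 2 := hfg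
  rw [h3.deriv_eq]
  have := (hga.differentiableAt.hasDerivAt.fun_pow 2).deriv
  simpa [hgx] using this

namespace SplitSRS

variable {ι X : Type*} [TopologicalSpace X] [ChartedSpace ℂ X] {P : Set X}

theorem odd_ne_zero (S : SplitSRS ι X P) {i j : ι} {x y : ℂ} (hx : x ∈ S.dom i) (hy : y ∈ S.dom j)
    (h : S.chart i x = S.chart j y) : S.odd i j x y ≠ 0 := by
  obtain ⟨-, -, -, -, -, h0, -⟩ := S.superconformal i j x hx y hy h
  exact h0

theorem not_isRamond_and_isNeveuSchwarz (S : SplitSRS ι X P) (p : X) :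
    ¬ (S.IsRamond p ∧ S.IsNeveuSchwarz p) := by
  classical
  rintro ⟨⟨hp, ρ₁, c₁, k₁, hρ₁, hc₁, -, hc₁p, hP₁, ht₁, hk₁⟩,
    ⟨-, ρ₂, c₂, k₂, hρ₂, hc₂, hinj₂, hc₂p, hP₂, ht₂, hk₂⟩⟩
  have hm₁ := Metric.mem_ball_self (x := (0 : ℂ)) hρ₁
  have hm₂ := Metric.mem_ball_self (x := (0 : ℂ)) hρ₂
  obtain ⟨φ, hφ, hφ0, hφe, hφ'⟩ := hc₁.exists_transition hc₂ hm₁ hm₂ (hc₁p.trans hc₂p.symm)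
  let g : ℂ → ℂ := fun u => if h : ∃ q : ι × ℂ, q.2 ∈ S.dom q.1 ∧ S.chart q.1 q.2 = c₁ u then
    k₂ h.choose.1 h.choose.2 (φ u) / k₁ h.choose.1 h.choose.2 u else 0
  have hg0 : g 0 = 0 := by
    refine dif_neg ?_
    rintro ⟨⟨i, x⟩, hx, hx'⟩
    rw [hc₁p] at hx'
    have h1 : p ∈ Pᶜ := by
      rw [← S.cover, ← hx']
      exact Set.mem_iUnion.2 ⟨i, x, hx, rfl⟩
    exact h1 hp
  have hg : ∀ u ∈ Metric.ball (0 : ℂ) ρ₁, φ u ∈ Metric.ball (0 : ℂ) ρ₂ → c₂ (φ u) = c₁ u →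
      ∀ i, ∀ x ∈ S.dom i, S.chart i x = c₁ u → g u = k₂ i x (φ u) / k₁ i x u := by
    intro u hu hφu hcu i x hx hxu
    have h : ∃ q : ι × ℂ, q.2 ∈ S.dom q.1 ∧ S.chart q.1 q.2 = c₁ u := ⟨(i, x), hx, hxu⟩
    have h1 : g u = k₂ h.choose.1 h.choose.2 (φ u) / k₁ h.choose.1 h.choose.2 u := dif_pos h
    obtain ⟨hs1, hs2⟩ := h.choose_spec
    have e : S.chart h.choose.1 h.choose.2 = S.chart i x := hs2.trans hxu.symm
    have h2 := hk₁ _ _ _ hs1 _ hx u hu e hxu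
    have h3 := hk₂ _ _ _ hs1 _ hx (φ u) hφu e (hxu.trans hcu.symm)
    rw [h1, h2, h3, mul_div_mul_right _ _ (S.odd_ne_zero hs1 hx e)]
  have hgood : ∀ᶠ u in 𝓝 (0 : ℂ), u ∈ Metric.ball (0 : ℂ) ρ₁ ∧ φ u ∈ Metric.ball (0 : ℂ) ρ₂ ∧
      c₂ (φ u) = c₁ u ∧ AnalyticAt ℂ φ u := by
    filter_upwards [Metric.isOpen_ball.mem_nhds hm₁, hφe, hφ.eventually_analyticAt,
      hφ.continuousAt.eventually_mem (by rw [hφ0]; exact Metric.isOpen_ball.mem_nhds hm₂)]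
      with u h1 h2 h3 h4
    exact ⟨h1, h4, h2, h3⟩
  have key : ∀ᶠ u in 𝓝 (0 : ℂ), u ≠ 0 → DifferentiableAt ℂ g u ∧ u * deriv φ u = g u ^ 2 := by
    filter_upwards [hgood.eventually_nhds] with u hu hu0
    obtain ⟨h1, h2, h3, h4⟩ := hu.self_of_nhds
    obtain ⟨i, x, hx, hxu⟩ : ∃ i, ∃ x ∈ S.dom i, S.chart i x = c₁ u := by
      have : c₁ u ∈ ⋃ i, S.chart i '' S.dom i := by
        rw [S.cover]
        exact fun h => hu0 (hP₁ u h1 h)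
      obtain ⟨i, x, hx, hxu⟩ := Set.mem_iUnion.1 this
      exact ⟨i, x, hx, hxu⟩
    obtain ⟨f₁, hf₁, hf₁x, hf₁e, hka₁, hk0₁, hD₁⟩ := ht₁ i x hx u h1 hxu
    obtain ⟨f₂, hf₂, hf₂x, hf₂e, hka₂, hk0₂, hD₂⟩ := ht₂ i x hx (φ u) h2 (hxu.trans h3.symm)
    rw [preservesD_iff, hf₁x] at hD₁
    rw [preservesD_iff, hf₂x] at hD₂
    have hd₁ : deriv f₁ x ≠ 0 := by
      rw [← one_mul (deriv f₁ x), hD₁.1]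
      exact mul_ne_zero hu0 (pow_ne_zero 2 hD₁.2)
    obtain ⟨ψ, hψ, hψu, hψe, hψ'⟩ := hf₁.exists_local_rightInverse hd₁
    rw [hf₁x] at hψ hψu hψe hψ'
    have ev₁ : ∀ᶠ t in 𝓝 u, ψ t ∈ S.dom i ∧ c₁ (f₁ (ψ t)) = S.chart i (ψ t) ∧
        c₂ (f₂ (ψ t)) = S.chart i (ψ t) ∧ f₂ (ψ t) ∈ Metric.ball (0 : ℂ) ρ₂ := by
      have hψc := hψ.continuousAt.tendsto
      rw [hψu] at hψc
      have h5 : ∀ᶠ t in 𝓝 x, f₂ t ∈ Metric.ball (0 : ℂ) ρ₂ :=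
        hf₂.continuousAt.eventually_mem (by rw [hf₂x]; exact Metric.isOpen_ball.mem_nhds h2)
      filter_upwards [hψc.eventually ((S.isOpen_dom i).mem_nhds hx), hψc.eventually hf₁e,
        hψc.eventually hf₂e, hψc.eventually h5] with t a b c d
      exact ⟨a, b, c, d⟩
    have ev₂ : ∀ᶠ t in 𝓝 u, S.chart i (ψ t) = c₁ t ∧ f₂ (ψ t) = φ t := by
      filter_upwards [ev₁, hψe, hu] with t ⟨a, b, c, d⟩ e ⟨f, f', f'', _⟩
      rw [e] at b
      exact ⟨b.symm, hinj₂ d f' (by rw [c, f'', b])⟩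
    have hgev : g =ᶠ[𝓝 u] fun t => k₂ i (ψ t) (f₂ (ψ t)) / k₁ i (ψ t) (f₁ (ψ t)) := by
      filter_upwards [ev₁, ev₂, hψe, hu] with t ⟨a, _, _, _⟩ ⟨b, c⟩ d ⟨e, e', e'', _⟩
      rw [hg t e e' e'' i (ψ t) a b, c, d]
    have hgu : g u = k₂ i x (φ u) / k₁ i x u := hg u h1 h2 h3 i x hx hxu
    have hφψ : φ =ᶠ[𝓝 u] fun t => f₂ (ψ t) := by
      filter_upwards [ev₂] with t ht
      exact ht.2.symm
    constructor
    · refine DifferentiableAt.congr_of_eventuallyEq ?_ hgev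
      have a₁ : AnalyticAt ℂ (fun t => k₁ i (ψ t) (f₁ (ψ t))) u :=
        AnalyticAt.fun_comp (g := fun t => k₁ i t (f₁ t)) (by rw [hψu]; exact hka₁) hψ
      have a₂ : AnalyticAt ℂ (fun t => k₂ i (ψ t) (f₂ (ψ t))) u :=
        AnalyticAt.fun_comp (g := fun t => k₂ i t (f₂ t)) (by rw [hψu]; exact hka₂) hψ
      exact (a₂.div a₁ (by rw [hψu, hf₁x]; exact hk0₁)).differentiableAt
    · have hd : deriv φ u = deriv f₂ x * (deriv f₁ x)⁻¹ := by
        rw [hφψ.deriv_eq, ← Function.comp_def, deriv_comp u (by rw [hψu]; exact hf₂.differentiableAt)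
          hψ.differentiableAt, hψu, hψ']
      rw [hd, hgu, ← one_mul (deriv f₁ x), ← one_mul (deriv f₂ x), hD₁.1, hD₂.1]
      field_simp
  have hφd : AnalyticAt ℂ (fun u => u * deriv φ u) 0 := analyticAt_id.mul hφ.deriv
  have h0 : deriv (fun u => u * deriv φ u) 0 = 0 := by
    refine deriv_eq_zero_of_eventually_sq (g := g) hφd (zero_mul _) ?_ ?_
    · filter_upwards [key.filter_mono nhdsWithin_le_nhds, self_mem_nhdsWithin] with u hu hu0
      exact (hu hu0).1
    · filter_upwards [key] with u hu
      rcases eq_or_ne u 0 with rfl | hu0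
      · simp [hg0]
      · exact (hu hu0).2
  have h1 := ((hasDerivAt_id (0 : ℂ)).mul hφ.deriv.differentiableAt.hasDerivAt).deriv
  simp only [id, one_mul, zero_mul, add_zero] at h1
  exact hφ' (h1.symm.trans h0)

end SplitSRS

namespace MetricFatgraph

variable {V : Type*} {τ : MetricFatgraph V} {r : τ.Dart → ℂ} {o o' : τ.Orientation}
  {d e : τ.Dart} {w z : ℂ} {v v' v'' : V} {w' w'' : ℂ} {p p' : τ.Puncture} {y y' : ℂ} {ν : ℕ}

/-- The sign by which the chosen square roots at the two sides of a corner differ. -/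
noncomputable def cornerSign (r : τ.Dart → ℂ) (d : τ.Dart) : ℂ :=
  r (τ.next d) / r d * exp (-(Real.pi * I / τ.valence d.1))

theorem cornerSign_sq (hr : τ.IsRootChoice r) (d : τ.Dart) : cornerSign r d ^ 2 = 1 := by
  have h0 := τ.root_ne_zero d
  rw [cornerSign, mul_pow, div_pow, hr, hr, τ.root_next, mul_div_cancel_left₀ _ h0, ← Complex.exp_nat_mul,
    ← Complex.exp_add, exp_eq_one_iff]
  exact ⟨0, by push_cast; ring⟩

theorem sqrtStripe_next (hr : τ.IsRootChoice r) (d : τ.Dart) (hz : 0 < z.im) :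
    τ.sqrtStripe r (τ.next d) (-z) = I * cornerSign r d * τ.sqrtStripe r d z := by
  have hm := τ.valence_ne_zero d.1
  have hz0 : z ≠ 0 := by rintro rfl; simp at hz
  have hr0 := root_choice_ne_zero hr d
  have hlog : log (-z) = log z - Real.pi * I := by
    rw [log, log, norm_neg, arg_neg_eq_arg_sub_pi_of_im_pos hz]
    push_cast
    ring
  have hpow : (-z) ^ (1 / (τ.valence d.1 : ℂ) - 1 / 2) =
      z ^ (1 / (τ.valence d.1 : ℂ) - 1 / 2) * (I * exp (-(Real.pi * I / τ.valence d.1))) := by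
    rw [cpow_def_of_ne_zero (neg_ne_zero.2 hz0), cpow_def_of_ne_zero hz0, hlog]
    have e : (log z - Real.pi * I) * (1 / (τ.valence d.1 : ℂ) - 1 / 2) =
      log z * (1 / (τ.valence d.1 : ℂ) - 1 / 2) +
        (Real.pi / 2 * I + -(Real.pi * I / τ.valence d.1)) := by field_simp; ring
    rw [e, Complex.exp_add, Complex.exp_add, exp_pi_div_two_mul_I]
  rw [sqrtStripe, sqrtStripe, cornerSign]
  change ((Real.sqrt (2 / τ.valence d.1) : ℝ) : ℂ) * r (τ.next d) *
    (-z) ^ (1 / (τ.valence d.1 : ℂ) - 1 / 2) = _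
  rw [hpow]
  field_simp

/-- The sign which the odd coordinates pick up along an edge of a boundary cycle. -/
noncomputable def edgeSign (r : τ.Dart → ℂ) (o : τ.Orientation) (d : τ.Dart) : ℂ :=
  -(o.sign d * cornerSign r (τ.bdryNext d))

theorem edgeSign_sq (hr : τ.IsRootChoice r) (o : τ.Orientation) (d : τ.Dart) :
    edgeSign r o d ^ 2 = 1 := by
  rw [edgeSign, neg_sq, mul_pow, o.sign_sq, cornerSign_sq hr, one_mul]

/-- The monodromy of the odd coordinate which squares to the differential of the logarithm of the
coordinate around a puncture. -/
noncomputable def holonomy (r : τ.Dart → ℂ) (o : τ.Orientation) (p : τ.Puncture) : ℂ :=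
  ∏ᶠ d ∈ {d : τ.Dart | τ.bdry d = p}, edgeSign r o d

theorem sqrtTransition_eq (hr : τ.IsRootChoice r) (him : 0 < (τ.stripeCoord d w).im) :
    τ.sqrtTransition r d w = -cornerSign r (τ.bdryNext d) *
      τ.sqrtStripe r (τ.bdryNext d) (τ.stripeCoord d w - τ.len d) /
        τ.sqrtStripe r d (τ.stripeCoord d w) := by
  have h := sqrtStripe_next hr (τ.bdryNext d) (z := τ.stripeCoord d w - τ.len d)
    (by rw [sub_im, ofReal_im, sub_zero]; exact him)
  rw [neg_sub, τ.next_bdryNext] at h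
  rw [sqrtTransition, h]
  congr 1
  rw [← mul_assoc, ← mul_assoc, I_mul_I, neg_one_mul]

/-- The odd coordinate `θ = oddCorner * ξ` near a puncture in terms of the odd coordinate at a
vertex. -/
noncomputable def oddCorner (r : τ.Dart → ℂ) (o : τ.Orientation) (ν : ℕ) (d : τ.Dart) (w : ℂ) : ℂ :=
  τ.initialProd (edgeSign r o) d *
    (2 * Real.pi * I / (τ.perimeter (τ.bdry d) : ℂ)) ^ (((2 : ℕ) : ℂ)⁻¹) *
    exp (Real.pi * I * ν / (τ.perimeter (τ.bdry d) : ℂ) * (τ.offset d + τ.stripeCoord d w)) /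
      τ.sqrtStripe r d (τ.stripeCoord d w)

open Classical in
/-- The transition function of the odd coordinates from a vertex to a puncture. -/
noncomputable def oddPuncture (r : τ.Dart → ℂ) (o : τ.Orientation) (ν : ℕ) (p : τ.Puncture)
    (v : V) (w y : ℂ) : ℂ :=
  if h : ∃ d : τ.Dart, d.1 = v ∧ τ.bdry d = p ∧ w ∈ τ.corner d ∧ y = τ.cornerTransition d w then
    oddCorner r o ν h.choose w
  else 1

theorem oddPuncture_eq (hw : w ∈ τ.corner d) :
    oddPuncture r o ν (τ.bdry d) d.1 w (τ.cornerTransition d w) = oddCorner r o ν d w := by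
  have h : ∃ e : τ.Dart, e.1 = d.1 ∧ τ.bdry e = τ.bdry d ∧ w ∈ τ.corner e ∧
      τ.cornerTransition d w = τ.cornerTransition e w := ⟨d, rfl, rfl, hw, rfl⟩
  have he : h.choose = d := eq_of_mem_corner h.choose_spec.1 h.choose_spec.2.2.1 hw
  rw [oddPuncture, dif_pos h, he]

theorem initialProd_edgeSign_sq (hr : τ.IsRootChoice r) (d : τ.Dart) :
    τ.initialProd (edgeSign r o) d ^ 2 = 1 := by
  rw [Fatgraph.initialProd, ← Finset.prod_pow]
  exact Finset.prod_eq_one fun _ _ => edgeSign_sq hr o _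

theorem oddCorner_sq (hr : τ.IsRootChoice r) (hw : w ∈ τ.wedge d) : oddCorner r o ν d w ^ 2 =
    2 * Real.pi * I / (τ.perimeter (τ.bdry d) : ℂ) * τ.cornerTransition d w ^ ν /
      τ.paramDeriv d (τ.stripeCoord d w) := by
  rw [oddCorner, div_pow, mul_pow, mul_pow, initialProd_edgeSign_sq hr, one_mul,
    cpow_nat_inv_pow _ two_ne_zero, sqrtStripe_sq hr _ (stripeCoord_ne_zero hw.1), cornerTransition,
    ← Complex.exp_nat_mul, ← Complex.exp_nat_mul]
  congr 3
  push_cast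
  ring

theorem analyticAt_oddCorner (hr : τ.IsRootChoice r) (hw : w ∈ τ.wedge d) :
    AnalyticAt ℂ (oddCorner r o ν d) w := by
  have h1 := analyticAt_stripeCoord hw
  exact (analyticAt_const.mul (analyticAt_const.mul (analyticAt_const.add h1)).cexp').div
    (AnalyticAt.fun_comp (f := τ.stripeCoord d)
      (analyticAt_sqrtStripe r d (stripeCoord_mem_slitPlane hw)) h1)
    (sqrtStripe_ne_zero hr _ (stripeCoord_ne_zero hw.1))

theorem finprod_mem_sq_eq_one {ι : Type*} {s : Set ι} {f : ι → ℂ} (h : ∀ x ∈ s, f x ^ 2 = 1) :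
    (∏ᶠ x ∈ s, f x) ^ 2 = 1 :=
  finprod_mem_induction (fun x : ℂ => x ^ 2 = 1) (one_pow 2)
    (fun x y hx hy => by rw [mul_pow, hx, hy, one_mul]) h

theorem holonomy_eq_or (hr : τ.IsRootChoice r) (o : τ.Orientation) (p : τ.Puncture) :
    holonomy r o p = 1 ∨ holonomy r o p = -1 :=
  sq_eq_one_iff.1 (finprod_mem_sq_eq_one fun d _ => edgeSign_sq hr o d)

section Finite

variable [Finite V]

theorem perimeter_ne_zero (p : τ.Puncture) : (τ.perimeter p : ℂ) ≠ 0 :=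
  ofReal_ne_zero.2 (τ.perimeter_pos p).ne'

theorem oddCorner_ne_zero (hr : τ.IsRootChoice r) (hw : w ∈ τ.wedge d) :
    oddCorner r o ν d w ≠ 0 := by
  have hpi : (Real.pi : ℂ) ≠ 0 := ofReal_ne_zero.2 Real.pi_ne_zero
  rw [← pow_ne_zero_iff two_ne_zero, oddCorner_sq hr hw]
  refine div_ne_zero (mul_ne_zero (div_ne_zero (mul_ne_zero (mul_ne_zero two_ne_zero hpi)
    I_ne_zero) (perimeter_ne_zero _)) (pow_ne_zero _ (cornerTransition_ne_zero _ _)))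
    (paramDeriv_ne_zero _ (stripeCoord_ne_zero hw.1))

theorem oddCorner_bdryNext (hr : τ.IsRootChoice r) (hν : holonomy r o (τ.bdry d) = (-1) ^ ν)
    (hw : w ∈ τ.stripe d) (him : 0 < (τ.stripeCoord d w).im) :
    oddCorner r o ν d w = oddCorner r o ν (τ.bdryNext d) (τ.transition d w) *
      (o.sign d * τ.sqrtTransition r d w) := by
  obtain ⟨h1, h2⟩ := stripeCoord_bdryNext hw him
  have s1 := sqrtStripe_ne_zero hr d (stripeCoord_ne_zero_of_mem_stripe hw)
  have s2 := sqrtStripe_ne_zero hr (τ.bdryNext d) (stripeCoord_ne_zero (d := τ.bdryNext d) h1.1)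
  have hf := edgeSign_sq hr o d
  rw [h2] at s2
  have key : τ.initialProd (edgeSign r o) d *
      exp (Real.pi * I * ν / (τ.perimeter (τ.bdry d) : ℂ) * (τ.offset d + τ.stripeCoord d w)) =
      τ.initialProd (edgeSign r o) (τ.bdryNext d) * edgeSign r o d *
      exp (Real.pi * I * ν / (τ.perimeter (τ.bdry d) : ℂ) *
        (τ.offset (τ.bdryNext d) + (τ.stripeCoord d w - τ.len d))) := by
    by_cases h : τ.bdryNext d = (τ.bdry d).out
    · have e1 := τ.initialSum_add τ.len d h
      have e2 := τ.initialProd_mul (edgeSign r o) d h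
      have hb : τ.bdryNext d = (τ.bdry (τ.bdryNext d)).out := by rw [τ.bdry_bdryNext]; exact h
      have e3 : τ.offset (τ.bdryNext d) = 0 := τ.initialSum_out τ.len _ hb
      have e4 := τ.initialProd_out (edgeSign r o) _ hb
      have e5 : τ.offset d = τ.perimeter (τ.bdry d) - τ.len d := eq_sub_of_add_eq e1
      change _ = holonomy r o (τ.bdry d) at e2
      rw [hν] at e2
      have e6 : exp (Real.pi * I * ν / (τ.perimeter (τ.bdry d) : ℂ) *
          (τ.offset d + τ.stripeCoord d w)) = (-1) ^ ν *
          exp (Real.pi * I * ν / (τ.perimeter (τ.bdry d) : ℂ) *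
            (τ.stripeCoord d w - τ.len d)) := by
        rw [← exp_pi_mul_I, ← Complex.exp_nat_mul, ← Complex.exp_add, e5]
        congr 1
        have ha := perimeter_ne_zero (τ.bdry d)
        push_cast
        field_simp
        ring
      have e7 : ((-1 : ℂ) ^ ν) ^ 2 = 1 := by rw [← pow_mul, mul_comm, pow_mul]; norm_num
      rw [e3, e4, e6, ofReal_zero, zero_add]
      have e8 : τ.initialProd (edgeSign r o) d = (-1) ^ ν * edgeSign r o d := by
        linear_combination edgeSign r o d * e2 - τ.initialProd (edgeSign r o) d * hf
      rw [e8]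
      linear_combination edgeSign r o d * exp (Real.pi * I * ν / (τ.perimeter (τ.bdry d) : ℂ) *
            (τ.stripeCoord d w - τ.len d)) * e7
    · have e1 : τ.offset (τ.bdryNext d) = τ.offset d + τ.len d :=
        τ.initialSum_bdryNext τ.len d h
      have e2 := τ.initialProd_bdryNext (edgeSign r o) d h
      have e3 : ((τ.offset (τ.bdryNext d) : ℂ) + (τ.stripeCoord d w - τ.len d)) =
          τ.offset d + τ.stripeCoord d w := by
        rw [e1]; push_cast; ring
      rw [e3, e2]
      linear_combination -τ.initialProd (edgeSign r o) d *
        exp (Real.pi * I * ν / (τ.perimeter (τ.bdry d) : ℂ) * (τ.offset d + τ.stripeCoord d w)) * hf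
  rw [sqrtTransition_eq hr him, oddCorner, oddCorner, h2, τ.bdry_bdryNext]
  have hes : edgeSign r o d = -(o.sign d * cornerSign r (τ.bdryNext d)) := rfl
  rw [hes] at key
  generalize exp (_ * _) = E₁ at key ⊢
  generalize exp (_ * _) = E₂ at key ⊢
  rw [mul_right_comm, key]
  field_simp

theorem oddPuncture_mul (hr : τ.IsRootChoice r) (hν : holonomy r o p = (-1) ^ ν)
    (h : τ.EdgeRel v w v' w') (hc : τ.CornerRel v' w' p y) :
    oddPuncture r o ν p v w y = oddPuncture r o ν p v' w' y * oddTransition r o v v' w w' := by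
  rcases h with ⟨rfl, rfl⟩ | ⟨d, rfl, rfl, hw, rfl⟩
  · rw [oddTransition_self, mul_one]
  have key : ∀ {d : τ.Dart} {w : ℂ}, τ.bdry d = p → w ∈ τ.stripe d →
      0 < (τ.stripeCoord d w).im → y = τ.cornerTransition d w →
      oddPuncture r o ν p d.1 w y = oddPuncture r o ν p (τ.inv d).1 (τ.transition d w) y *
        oddTransition r o d.1 (τ.inv d).1 w (τ.transition d w) := by
    rintro d w rfl hw him rfl
    have h1 := oddPuncture_eq (r := r) (o := o) (ν := ν) (transition_mem_corner hw him)
    rw [cornerTransition_transition hw him, τ.bdry_bdryNext] at h1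
    rw [oddPuncture_eq (mem_corner_of_mem_stripe hw him), oddTransition_transition hw,
      oddCorner_bdryNext hr hν hw him]
    congr 1
    exact h1.symm
  have hs := transition_mem_stripe hw
  have hcs := EdgeRel.cornerRel (edgeRel_transition hw) hc
  obtain ⟨f, hf, hfp, hfc, hfy⟩ := hcs
  have hfm := mem_corner_iff.1 hfc
  have hwd := mem_wedge_of_mem_stripe hw
  rcases le_or_gt 0 (τ.stripeCoord d w).im with him | him
  · obtain rfl := eq_of_im_pos hf hfm.1 hwd hfm.2.1 him
    exact key hfp hw hfm.2.1 hfy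
  · obtain ⟨g, hg, hgp, hgc, hgy⟩ := hc
    have hgm := mem_corner_iff.1 hgc
    have him' : 0 ≤ (τ.stripeCoord (τ.inv d) (τ.transition d w)).im := by
      rw [stripeCoord_transition, sub_im, ofReal_im]; linarith
    obtain rfl := eq_of_im_pos hg hgm.1 (mem_wedge_of_mem_stripe hs) hgm.2.1 him'
    have h1 := key hgp hs hgm.2.1 hgy
    have h2 := oddTransition_mul (o := o) hr (edgeRel_transition hw) (edgeRel_transition hs)
    simp only [transition_transition hw, τ.inv_inv] at h1 h2
    rw [oddTransition_self] at h2
    rw [h1, mul_assoc, ← h2, mul_one]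

theorem isSuperTransition_oddPuncture (hr : τ.IsRootChoice r) {h : ℂ → ℂ}
    (hh : ∀ y, y ≠ 0 → h y * y ^ ν = y) (o : τ.Orientation) (p : τ.Puncture) (v : V) :
    IsSuperTransition (τ.star v) (τ.vertexChart v) (fun _ => 1) (Metric.ball 0 1)
      (τ.punctureChart p) h (oddPuncture r o ν p v) := by
  intro w hw y hy hwy
  obtain ⟨d, rfl, rfl, hc, rfl⟩ := (vertexChart_eq_punctureChart_iff hw hy).1 hwy
  have hwd := mem_wedge_of_mem_corner hc
  have hev : ∀ᶠ u in 𝓝 w, u ∈ τ.corner d := (isOpen_corner d).mem_nhds hc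
  refine ⟨τ.cornerTransition d, analyticAt_cornerTransition hwd, rfl, ?_, ?_, ?_, ?_⟩
  · filter_upwards [hev] with u hu
    exact ((vertexChart_eq_punctureChart_iff hu.1
      ((cornerTransition_mem_ball_iff d u).2 (mem_corner_iff.1 hu).2.1)).2
        ⟨d, rfl, rfl, hu, rfl⟩).symm
  · refine (analyticAt_oddCorner (o := o) (ν := ν) hr hwd).congr ?_
    filter_upwards [hev] with u hu
    exact (oddPuncture_eq hu).symm
  · rw [oddPuncture_eq hc]; exact oddCorner_ne_zero hr hwd
  · rw [preservesD_iff, oddPuncture_eq hc, oddCorner_sq hr hwd,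
      (hasDerivAt_cornerTransition hwd).deriv]
    refine ⟨?_, oddCorner_ne_zero hr hwd⟩
    have := hh _ (cornerTransition_ne_zero d w)
    generalize τ.cornerTransition d w = y at this ⊢
    rw [one_mul]
    nth_rewrite 1 [← this]
    ring

variable [ChartedSpace ℂ τ.Surface] {S S' : SplitSRS V τ.Surface τ.punctures}

theorem Presents.hasModelAt
    (hp : ∀ p, IsLocalDiffeomorphOn 𝓘(ℂ) 𝓘(ℂ) ω (τ.punctureChart p) (Metric.ball 0 1))
    (hr : τ.IsRootChoice r) (hS : τ.Presents r o S) {h : ℂ → ℂ}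
    (hh : ∀ y, y ≠ 0 → h y * y ^ ν = y) (hν : holonomy r o p = (-1) ^ ν) :
    S.HasModelAt (τ.punctureChart p 0) h := by
  refine ⟨1, τ.punctureChart p, oddPuncture r o ν p, one_pos, hp p, ?_, rfl, ?_, ?_, ?_⟩
  · intro y hy y' hy' h
    exact ((punctureChart_eq_iff hy hy').1 h).2
  · rintro y hy ⟨p', hp'⟩
    exact ((punctureChart_eq_iff (Metric.mem_ball_self one_pos) hy).1 hp').2.symm
  · intro i
    rw [hS.1, hS.2.1]
    exact isSuperTransition_oddPuncture hr hh o p i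
  · rw [hS.1, hS.2.1]
    intro i j x hx x' hx' y hy h1 h2
    have e1 := (vertexChart_eq_iff hx hx').1 h1
    rw [hS.odd_eq hx e1]
    exact oddPuncture_mul hr hν e1 ((vertexChart_eq_punctureChart_iff hx' hy).1 h2)

theorem Presents.isRamond_iff_and
    (hp : ∀ p, IsLocalDiffeomorphOn 𝓘(ℂ) 𝓘(ℂ) ω (τ.punctureChart p) (Metric.ball 0 1))
    (hr : τ.IsRootChoice r) (hS : τ.Presents r o S) (p : τ.Puncture) :
    (S.IsRamond (τ.punctureChart p 0) ↔ holonomy r o p = 1) ∧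
      (S.IsNeveuSchwarz (τ.punctureChart p 0) ↔ holonomy r o p = -1) := by
  have hP : τ.punctureChart p 0 ∈ τ.punctures := ⟨p, rfl⟩
  have hn := S.not_isRamond_and_isNeveuSchwarz (τ.punctureChart p 0)
  have h1 : (1 : ℂ) ≠ -1 := by norm_num
  rcases holonomy_eq_or hr o p with h | h
  · have hR : S.IsRamond (τ.punctureChart p 0) :=
      ⟨hP, hS.hasModelAt hp hr (ν := 0) (fun y _ => by rw [pow_zero, mul_one])
        (by rw [h, pow_zero])⟩
    exact ⟨iff_of_true hR h, iff_of_false (fun hN => hn ⟨hR, hN⟩) (h ▸ h1)⟩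
  · have hN : S.IsNeveuSchwarz (τ.punctureChart p 0) :=
      ⟨hP, hS.hasModelAt hp hr (ν := 1) (fun y _ => by rw [pow_one, one_mul])
        (by rw [h, pow_one])⟩
    exact ⟨iff_of_false (fun hR => hn ⟨hR, hN⟩) (h ▸ h1.symm), iff_of_true hN h⟩

end Finite

end MetricFatgraph

theorem finprod_mem_ite_neg_one {ι M : Type*} [Finite ι] [CommMonoid M] [HasDistribNeg M]
    (s : Set ι) (q : ι → Prop) [DecidablePred q] :
    ∏ᶠ i ∈ s, (if q i then (1 : M) else -1) = (-1) ^ Set.ncard {i | i ∈ s ∧ ¬ q i} := by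
  classical
  have := Fintype.ofFinite ι
  have h : {i | i ∈ s ∧ ¬ q i} = ((Finset.univ.filter (· ∈ s)).filter fun i => ¬ q i : Finset ι) := by
    ext i; simp
  have hs : s = (Finset.univ.filter (· ∈ s) : Finset ι) := by ext i; simp
  rw [h, Set.ncard_coe_finset]
  conv_lhs => rw [hs, finprod_mem_coe_finset]
  rw [Finset.prod_ite, Finset.prod_const_one, one_mul, Finset.prod_const]

/-- The products of a function over the fibres of a map. -/
noncomputable def fiberProd {D B M : Type*} [Finite D] [CommMonoid M] (π : D → B) :
    (D → M) →* (B → M) where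
  toFun f b := ∏ᶠ d ∈ {d | π d = b}, f d
  map_one' := by ext b; exact finprod_mem_one _
  map_mul' f g := by ext b; exact finprod_mem_mul_distrib (Set.toFinite _)

theorem fiberProd_mulSingle {D B M : Type*} [Finite D] [CommMonoid M] [DecidableEq D]
    [DecidableEq B] (π : D → B) (d : D) (x : M) :
    fiberProd π (Pi.mulSingle d x) = Pi.mulSingle (π d) x := by
  ext b
  change ∏ᶠ e ∈ {e | π e = b}, Pi.mulSingle d x e = _
  rw [finprod_eq_single _ d]
  · rw [Pi.mulSingle_eq_same]
    by_cases h : π d = b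
    · subst h
      rw [Pi.mulSingle_eq_same]
      exact finprod_eq_if.trans (if_pos rfl)
    · rw [Pi.mulSingle_eq_of_ne (Ne.symm h)]
      exact finprod_eq_if.trans (if_neg h)
  · intro e he
    rw [Pi.mulSingle_eq_of_ne he]
    exact finprod_one

namespace Fatgraph

variable {V : Type*} (τ : Fatgraph V) [Finite V]

/-- The functions on the vertices which arise by multiplying at every vertex the signs of the
half-edges, where the product of these signs along every boundary cycle is `1`. -/
noncomputable def vertexSigns : Subgroup (V → ℤˣ) :=
  (fiberProd τ.bdry : (τ.Dart → ℤˣ) →* _).ker.map (fiberProd Sigma.fst)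

theorem mulSingle_mem_vertexSigns [DecidableEq V] (v v' : V) (x : ℤˣ) :
    Pi.mulSingle v x * Pi.mulSingle v' x ∈ τ.vertexSigns := by
  classical
  induction τ.connected v v' with
  | refl =>
    convert τ.vertexSigns.one_mem
    rw [← Pi.mulSingle_mul, Int.units_mul_self, Pi.mulSingle_one]
  | @tail a b _ h ih =>
    obtain ⟨j, rfl⟩ := h
    have h : (Pi.mulSingle a x * Pi.mulSingle (τ.inv ⟨a, j⟩).1 x : V → ℤˣ) ∈ τ.vertexSigns := by
      refine ⟨Pi.mulSingle ⟨a, j⟩ x * Pi.mulSingle (τ.bdryNext ⟨a, j⟩) x, ?_, ?_⟩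
      · rw [SetLike.mem_coe, MonoidHom.mem_ker, map_mul, fiberProd_mulSingle, fiberProd_mulSingle,
          τ.bdry_bdryNext, ← Pi.mulSingle_mul, Int.units_mul_self, Pi.mulSingle_one]
      · rw [map_mul, fiberProd_mulSingle, fiberProd_mulSingle]
        rfl
    convert τ.vertexSigns.mul_mem ih h using 1
    rw [mul_assoc, ← mul_assoc (Pi.mulSingle a x : V → ℤˣ), ← Pi.mulSingle_mul, Int.units_mul_self, Pi.mulSingle_one, one_mul]

theorem mem_vertexSigns [Fintype V] {t : V → ℤˣ} (ht : ∏ v, t v = 1) : t ∈ τ.vertexSigns := by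
  classical
  obtain ⟨v₀⟩ := τ.nonempty
  have h := τ.vertexSigns.prod_mem (t := Finset.univ)
    fun v _ => τ.mulSingle_mem_vertexSigns v v₀ (t v)
  rw [Finset.prod_mul_distrib, Finset.univ_prod_mulSingle] at h
  have h1 : ∏ v, (Pi.mulSingle v₀ (t v) : V → ℤˣ) = 1 := by
    have := map_prod (MonoidHom.mulSingle (fun _ : V => ℤˣ) v₀) t Finset.univ
    rw [ht, map_one] at this
    exact this.symm
  rwa [h1, mul_one] at h

end Fatgraph

namespace MetricFatgraph

variable {V : Type*} {τ : MetricFatgraph V} {r : τ.Dart → ℂ} {o : τ.Orientation} {d : τ.Dart}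
  {σ : τ.Dart → ℂ}

/-- The contribution of the choice of the square roots to the holonomy around a puncture. -/
noncomputable def cornerProd (r : τ.Dart → ℂ) (p : τ.Puncture) : ℂ :=
  ∏ᶠ d ∈ {d : τ.Dart | τ.bdry d = p}, -cornerSign r d

theorem cornerProd_eq_or (hr : τ.IsRootChoice r) (p : τ.Puncture) :
    cornerProd r p = 1 ∨ cornerProd r p = -1 :=
  sq_eq_one_iff.1 (finprod_mem_sq_eq_one fun d _ => by rw [neg_sq, cornerSign_sq hr])

theorem holonomy_eq [Finite V] (r : τ.Dart → ℂ) (o : τ.Orientation) (p : τ.Puncture) :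
    holonomy r o p = cornerProd r p * (-1) ^ o.numOpposite p := by
  have h1 : ∏ᶠ d ∈ {d : τ.Dart | τ.bdry d = p}, o.sign d = (-1) ^ o.numOpposite p := by
    have := finprod_mem_ite_neg_one (M := ℂ) {d : τ.Dart | τ.bdry d = p} (fun d => o.pos d = true)
    simp only [Bool.not_eq_true, Set.mem_ofPred_eq] at this
    exact this
  rw [← h1, cornerProd, ← τ.finprod_bdry_bdryNext, ← finprod_mem_mul_distrib (Set.toFinite _),
    holonomy]
  refine finprod_mem_congr rfl fun d _ => ?_
  rw [edgeSign, neg_mul, mul_comm]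

/-- The square roots of the `root d` which change by the sign `σ d` at the corner of `d`. -/
noncomputable def rootOfSign (σ : τ.Dart → ℂ) (d : τ.Dart) : ℂ :=
  exp (Real.pi * I * (d.2 : ℕ) / τ.valence d.1) *
    ∏ i ∈ Finset.range d.2, if h : i < τ.valence d.1 then σ ⟨d.1, i, h⟩ else 1

theorem isRootChoice_rootOfSign (hσ : ∀ d, σ d ^ 2 = 1) : τ.IsRootChoice (rootOfSign σ) := by
  intro d
  rw [rootOfSign, mul_pow, ← Finset.prod_pow, ← Complex.exp_nat_mul, Fatgraph.root,
    Finset.prod_eq_one, mul_one]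
  · congr 1; push_cast; ring
  · intro i _
    split_ifs
    exacts [hσ _, one_pow 2]

theorem cornerSign_rootOfSign (hσ : ∀ d, σ d ^ 2 = 1)
    (hv : ∀ v, ∏ j, σ ⟨v, j⟩ = -1) (d : τ.Dart) : cornerSign (rootOfSign σ) d = σ d := by
  have hm := τ.valence_ne_zero d.1
  have h0 := root_choice_ne_zero (isRootChoice_rootOfSign hσ) d
  have hd : (if h : (d.2 : ℕ) < τ.valence d.1 then σ ⟨d.1, d.2, h⟩ else 1) = σ d :=
    dif_pos d.2.2
  rw [cornerSign, div_mul_eq_mul_div, div_eq_iff h0, rootOfSign, rootOfSign]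
  change exp (Real.pi * I * ((τ.next d).2 : ℕ) / τ.valence d.1) *
    (∏ i ∈ Finset.range (τ.next d).2, if h : i < τ.valence d.1 then σ ⟨d.1, i, h⟩ else 1) * _ = _
  rcases τ.next_snd d with h | ⟨h, h'⟩
  · rw [h, Finset.prod_range_succ, hd]
    have e : exp (Real.pi * I * ((d.2 : ℕ) + 1 : ℕ) / τ.valence d.1) *
        exp (-(Real.pi * I / τ.valence d.1)) = exp (Real.pi * I * (d.2 : ℕ) / τ.valence d.1) := by
      rw [← Complex.exp_add]; congr 1; push_cast; field_simp; ring
    rw [← e]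
    ring
  · rw [h, Finset.prod_range_zero]
    have h1 := hv d.1
    have h2 := Finset.prod_range
      (fun i => if h : i < τ.valence d.1 then σ ⟨d.1, i, h⟩ else 1) (n := τ.valence d.1)
    simp only [Fin.is_lt, dite_true, Fin.eta] at h2
    rw [h1] at h2
    rw [← congrArg Finset.range h', Finset.prod_range_succ, hd] at h2
    have e : exp (-(Real.pi * I / τ.valence d.1)) =
        -exp (Real.pi * I * (d.2 : ℕ) / τ.valence d.1) := by
      have h3 : (τ.valence d.1 : ℂ) = (d.2 : ℕ) + 1 := by exact_mod_cast h'.symm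
      rw [neg_eq_neg_one_mul (exp _), ← exp_neg_pi_mul_I, ← Complex.exp_add]
      congr 1
      field_simp
      rw [h3]
      ring
    rw [e]
    simp only [Nat.cast_zero, mul_zero, zero_div, exp_zero, mul_one, one_mul]
    rw [mul_left_comm, mul_comm (σ d), h2, mul_neg_one]

theorem exists_rootChoice [Finite V] (h : Even (Set.ncard {v | Even (τ.valence v)})) :
    ∃ r, τ.IsRootChoice r ∧ ∀ p, cornerProd r p = 1 := by
  classical
  have := Fintype.ofFinite V
  set t : V → ℤˣ := fun v => if Odd (τ.valence v) then 1 else -1 with ht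
  have ht1 : ∏ v, t v = 1 := by
    have := finprod_mem_ite_neg_one (M := ℤˣ) (Set.univ : Set V) (fun v => Odd (τ.valence v))
    simp only [Set.mem_univ, true_and, Nat.not_odd_iff_even, finprod_true, h.neg_one_pow] at this
    rwa [finprod_eq_prod_of_fintype] at this
  obtain ⟨s, hs, hst⟩ := τ.mem_vertexSigns ht1
  have hσ : ∀ d, (-((s d : ℤ) : ℂ)) ^ 2 = 1 := by
    intro d
    rcases Int.units_eq_one_or (s d) with h | h <;> simp [h]
  have hv : ∀ v, ∏ j, (fun d => -((s d : ℤ) : ℂ)) ⟨v, j⟩ = -1 := by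
    intro v
    have h1 : ∏ j, s ⟨v, j⟩ = t v := by
      rw [← hst]
      change _ = ∏ᶠ d ∈ {d : τ.Dart | d.1 = v}, s d
      have : {d : τ.Dart | d.1 = v} = Set.range (Sigma.mk v) := by
        ext ⟨a, j⟩
        constructor
        · rintro rfl; exact ⟨j, rfl⟩
        · rintro ⟨i, hi⟩; rw [← hi]; rfl
      rw [this, finprod_mem_range sigma_mk_injective, finprod_eq_prod_of_fintype]
    have h2 : ∏ j, ((s ⟨v, j⟩ : ℤ) : ℂ) = ((t v : ℤ) : ℂ) := by
      rw [← h1]; push_cast; rfl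
    rw [Finset.prod_neg, h2, Finset.card_univ, Fintype.card_fin]
    by_cases hm : Odd (τ.valence v)
    · simp [ht, hm, hm.neg_one_pow]
    · simp [ht, hm, (Nat.not_odd_iff_even.1 hm).neg_one_pow]
  refine ⟨rootOfSign fun d => -((s d : ℤ) : ℂ), isRootChoice_rootOfSign hσ, fun p => ?_⟩
  simp only [cornerProd, cornerSign_rootOfSign hσ hv, neg_neg]
  have h3 : ∏ᶠ d ∈ {d : τ.Dart | τ.bdry d = p}, s d = 1 := congrFun hs p
  have h4 := ((Int.castRingHom ℂ).toMonoidHom.comp (Units.coeHom ℤ)).map_finprod_mem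
    (f := s) (s := {d : τ.Dart | τ.bdry d = p}) (Set.toFinite _)
  rw [h3, map_one] at h4
  exact h4.symm

theorem isRootChoice_pow (h : ∀ v, Odd (τ.valence v)) :
    τ.IsRootChoice fun d => τ.root d ^ ((τ.valence d.1 + 1) / 2) := by
  intro d
  have hm := τ.valence_ne_zero d.1
  have h1 : (τ.valence d.1 + 1) / 2 * 2 = τ.valence d.1 + 1 :=
    Nat.div_mul_cancel (h d.1).add_one.two_dvd
  have h2 : τ.root d ^ τ.valence d.1 = 1 := by
    rw [Fatgraph.root, ← Complex.exp_nat_mul, mul_div_cancel₀ _ hm, exp_eq_one_iff]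
    exact ⟨(d.2 : ℕ), by push_cast; ring⟩
  change (τ.root d ^ ((τ.valence d.1 + 1) / 2)) ^ 2 = _
  rw [← pow_mul, h1, pow_succ, h2, one_mul]

theorem cornerProd_pow (h : ∀ v, Odd (τ.valence v)) (p : τ.Puncture) :
    cornerProd (fun d : τ.Dart => τ.root d ^ ((τ.valence d.1 + 1) / 2)) p = 1 := by
  refine finprod_mem_eq_one_of_forall_eq_one fun d _ => ?_
  have hm := τ.valence_ne_zero d.1
  have h1 : (((τ.valence d.1 + 1) / 2 : ℕ) : ℂ) * 2 = τ.valence d.1 + 1 := by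
    exact_mod_cast Nat.div_mul_cancel (h d.1).add_one.two_dvd
  change -(τ.root (τ.next d) ^ ((τ.valence d.1 + 1) / 2) / τ.root d ^ ((τ.valence d.1 + 1) / 2) *
    exp (-(Real.pi * I / τ.valence d.1))) = 1
  rw [τ.root_next, ← div_pow, mul_div_cancel_left₀ _ (τ.root_ne_zero d), ← Complex.exp_nat_mul,
    ← Complex.exp_add, neg_eq_iff_eq_neg, ← exp_pi_mul_I]
  congr 1
  field_simp
  linear_combination h1

end MetricFatgraph

namespace MetricFatgraph.Presents

variable {V : Type*} [Finite V] {τ : MetricFatgraph V} {r : τ.Dart → ℂ} {o o' : τ.Orientation}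
  [ChartedSpace ℂ τ.Surface] {S S' : SplitSRS V τ.Surface τ.punctures}

theorem xor_isRamond_isNeveuSchwarz
    (hp : ∀ p, IsLocalDiffeomorphOn 𝓘(ℂ) 𝓘(ℂ) ω (τ.punctureChart p) (Metric.ball 0 1))
    (hr : τ.IsRootChoice r) (h : τ.Presents r o S) (p : τ.Puncture) :
    Xor (S.IsRamond (τ.punctureChart p 0)) (S.IsNeveuSchwarz (τ.punctureChart p 0)) := by
  obtain ⟨h1, h2⟩ := h.isRamond_iff_and hp hr p
  rw [h1, h2]
  have h0 : (1 : ℂ) ≠ -1 := by norm_num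
  rcases holonomy_eq_or hr o p with h | h <;> rw [h]
  exacts [Or.inl ⟨rfl, h0⟩, Or.inr ⟨rfl, h0.symm⟩]

theorem isRamond_iff_isRamond_iff
    (hp : ∀ p, IsLocalDiffeomorphOn 𝓘(ℂ) 𝓘(ℂ) ω (τ.punctureChart p) (Metric.ball 0 1))
    (hr : τ.IsRootChoice r) (h : τ.Presents r o S) (h' : τ.Presents r o' S') (p : τ.Puncture) :
    (S.IsRamond (τ.punctureChart p 0) ↔ S'.IsRamond (τ.punctureChart p 0)) ↔
      (Even (o.numOpposite p) ↔ Even (o'.numOpposite p)) := by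
  rw [(h.isRamond_iff_and hp hr p).1, (h'.isRamond_iff_and hp hr p).1, holonomy_eq, holonomy_eq]
  rcases cornerProd_eq_or hr p with hc | hc <;>
  rcases Nat.even_or_odd (o.numOpposite p) with h1 | h1 <;>
  rcases Nat.even_or_odd (o'.numOpposite p) with h2 | h2 <;>
  simp only [hc, h1.neg_one_pow, h2.neg_one_pow, h1, h2, Nat.not_even_iff_odd.2] <;> norm_num

theorem isRamond_iff_even
    (hp : ∀ p, IsLocalDiffeomorphOn 𝓘(ℂ) 𝓘(ℂ) ω (τ.punctureChart p) (Metric.ball 0 1))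
    (hr : τ.IsRootChoice r) (h : τ.Presents r o S) {p : τ.Puncture} (hc : cornerProd r p = 1) :
    (S.IsRamond (τ.punctureChart p 0) ↔ Even (o.numOpposite p)) ∧
      (S.IsNeveuSchwarz (τ.punctureChart p 0) ↔ Odd (o.numOpposite p)) := by
  rw [(h.isRamond_iff_and hp hr p).1, (h.isRamond_iff_and hp hr p).2, holonomy_eq, hc, one_mul]
  have h1 : (1 : ℂ) ≠ -1 := by norm_num
  exact ⟨neg_one_pow_eq_one_iff_even h1.symm, neg_one_pow_eq_neg_one_iff_odd h1.symm⟩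

end MetricFatgraph.Presents

theorem mainTheorem5 {V : Type*} [Finite V] (τ : MetricFatgraph V) :
    ∃ _ : ChartedSpace ℂ τ.Surface,
      -- the closed Riemann surface, its patches and their transition functions
      IsCompactRiemannSurface τ.Surface ∧
      (∀ v, IsOpen (τ.star v) ∧
        IsLocalDiffeomorphOn 𝓘(ℂ) 𝓘(ℂ) ω (τ.vertexChart v) (τ.star v)) ∧
      (∀ p, IsLocalDiffeomorphOn 𝓘(ℂ) 𝓘(ℂ) ω (τ.punctureChart p) (Metric.ball 0 1)) ∧
      (⋃ v, τ.vertexChart v '' τ.star v) = τ.punctures ᶜ ∧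
      (∀ v v', ∀ w ∈ τ.star v, ∀ w' ∈ τ.star v',
        (τ.vertexChart v w = τ.vertexChart v' w' ↔
          (v = v' ∧ w = w') ∨
          ∃ d : τ.Dart, d.1 = v ∧ (τ.inv d).1 = v' ∧ w ∈ τ.stripe d ∧ w' = τ.transition d w)) ∧
      (∀ v p, ∀ w ∈ τ.star v, ∀ y ∈ Metric.ball (0 : ℂ) 1,
        (τ.vertexChart v w = τ.punctureChart p y ↔
          ∃ d : τ.Dart, d.1 = v ∧ τ.bdry d = p ∧ w ∈ τ.corner d ∧ y = τ.cornerTransition d w)) ∧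
      (∀ p p', ∀ y ∈ Metric.ball (0 : ℂ) 1, ∀ y' ∈ Metric.ball (0 : ℂ) 1,
        (τ.punctureChart p y = τ.punctureChart p' y' ↔ p = p' ∧ y = y')) ∧
      -- the split super Riemann surface defined by an orientation of the edges
      (∀ r, τ.IsRootChoice r →
        (∀ d, ∀ w ∈ τ.stripe d,
          HasDerivAt (τ.transition d) (τ.sqrtTransition r d w ^ 2) w) ∧
        (∀ o : τ.Orientation, ∃ S : SplitSRS V τ.Surface τ.punctures, τ.Presents r o S) ∧
        (∀ (o o' : τ.Orientation) (S S' : SplitSRS V τ.Surface τ.punctures),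
          τ.Presents r o S → τ.Presents r o' S' → (S.IsIso S' ↔ o.Equivalent o')) ∧
        (∀ (o : τ.Orientation) (S : SplitSRS V τ.Surface τ.punctures), τ.Presents r o S →
          ∀ p : τ.Puncture,
            Xor' (S.IsRamond (τ.punctureChart p 0)) (S.IsNeveuSchwarz (τ.punctureChart p 0))) ∧
        (∀ (o o' : τ.Orientation) (S S' : SplitSRS V τ.Surface τ.punctures),
          τ.Presents r o S → τ.Presents r o' S' → ∀ p : τ.Puncture,
            ((S.IsRamond (τ.punctureChart p 0) ↔ S'.IsRamond (τ.punctureChart p 0)) ↔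
              (Even (o.numOpposite p) ↔ Even (o'.numOpposite p))))) ∧
      -- the types of the punctures
      (Even (Set.ncard {v | Even (τ.valence v)}) →
        ∃ r, τ.IsRootChoice r ∧
          ((∀ v, Odd (τ.valence v)) → ∀ d, r d = τ.root d ^ ((τ.valence d.1 + 1) / 2)) ∧
          ∀ (o : τ.Orientation) (S : SplitSRS V τ.Surface τ.punctures), τ.Presents r o S →
            ∀ p : τ.Puncture,
              (S.IsRamond (τ.punctureChart p 0) ↔ Even (o.numOpposite p)) ∧
              (S.IsNeveuSchwarz (τ.punctureChart p 0) ↔ Odd (o.numOpposite p))) := by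
  obtain ⟨C, hX, hv, hp⟩ := τ.exists_chartedSpace_surface
  refine ⟨C, hX, fun v => ⟨τ.isOpen_star v, hv v⟩, hp, τ.iUnion_vertexChart,
    fun v v' w hw w' hw' => MetricFatgraph.vertexChart_eq_iff hw hw',
    fun v p w hw y hy => MetricFatgraph.vertexChart_eq_punctureChart_iff hw hy,
    fun p p' y hy y' hy' => MetricFatgraph.punctureChart_eq_iff hy hy',
    fun r hr => ⟨fun d w hw => MetricFatgraph.hasDerivAt_transition_sqrtTransition hr hw,
      MetricFatgraph.exists_presents hv hr,
      fun o o' S S' h h' => MetricFatgraph.Presents.isIso_iff hr h h',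
      fun o S h => h.xor_isRamond_isNeveuSchwarz hp hr,
      fun o o' S S' h h' => h.isRamond_iff_isRamond_iff hp hr h'⟩, fun he => ?_⟩
  by_cases ho : ∀ v, Odd (τ.valence v)
  · have hr := MetricFatgraph.isRootChoice_pow ho
    exact ⟨_, hr, fun _ _ => rfl, fun o S h p =>
      h.isRamond_iff_even hp hr (MetricFatgraph.cornerProd_pow ho p)⟩
  · obtain ⟨r, hr, hc⟩ := MetricFatgraph.exists_rootChoice he
    exact ⟨r, hr, fun ho' => absurd ho' ho, fun o S h p => h.isRamond_iff_even hp hr (hc p)⟩
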